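/- **Setting.** Let $\phi:\mathbb R\to[0,1]$ be $C^\infty$, with $\phi(\xi)=1$ for $|\xi|\le\frac12$ and $\phi(\xi)=0$ for $|\xi|>1$, and let $a:\mathbb R\to\mathbb R$ be an even $C^\infty$ function with $a^2(\xi)=\phi(\xi/2)-\phi(\xi)$. For $N=2^{j+2}$, $j\in\mathbb N$, put $\psi_N(t)=\frac1{\sqrt N}\sum_{l\in\mathbb Z}a(\tfrac{4l}N)e^{ilt}$ and $K_N(t)=\frac1{2\pi N}\bigl|\sum_{k=1}^Ne^{itk}\bigr|^2$. Let $X$ be a real, finite-variance, jointly measurable, isotropic (stationary) random field on the torus $\mathbb R/2\pi\mathbb Z$ with expansion $X(\vartheta)=\sum_{l\in\mathbb Z}w_le^{il\vartheta}$ (convergent in mean square for each $\vartheta$), where $w_l=\frac1{2\pi}\int_{-\pi}^{\pi}X(\vartheta)e^{-il\vartheta}\,d\vartheta$, $w_0=0$, $Ew_l=0$, $C_l:=E|w_l|^2$, $\sum_lC_l<\infty$. Define $$\beta_{Nk}=\frac1{2\pi}\int_{-\pi}^{\pi}X(\vartheta)\psi_N(\vartheta-\tfrac{2\pi k}N)\,d\vartheta,\qquad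 \sigma_N^2=\frac2N\sum_{N/8\le l\le N/2}C_la^2(\tfrac{4l}N),\qquad\widehat\beta_{Nk}=\frac{\beta_{Nk}}{\sigma_N},$$ $$S_N=\frac1{\sqrt N}\sum_{k=1}^N\widehat\beta_{Nk}^3,\qquad U_N=\frac1{\sqrt N}\sum_{k=1}^N(\widehat\beta_{Nk}^4-3).$$ For coefficients $v=(v_l)_{l\in\mathbb Z}$ and $s\in\mathbb R$ (standing for $\sigma_N^2$), with $\delta_{l_1\dots l_p}=E\prod_{i=1}^p|w_{l_i}|^2/C_{l_i}$, put $$Q_{p,N}(v)=\sum_{N/8\le|l_1|,\dots,|l_p|\le N/2}\frac1{\delta_{l_1\dots l_p}}\Bigl\{\prod_{i=1}^p|v_{l_i}|^2a^2(\tfrac{4l_i}N)\Bigr\}K_N\bigl(\tfrac{2\pi}N(l_1+\dots+l_p)\bigr),$$ $$V^S_N(s,v)=\frac{12\pi}{N^3s^3}\,Q_{3,N}(v),\qquad V^U_N(s,v)=\frac{72}{s^2}\frac{2\pi}{N^2}\,Q_{2,N}(v)+\frac{24}{s^4}\frac{2\pi}{N^4}\,Q_{4,N}(v).$$ Let $\widehat\sigma_N^2=\frac2N\sum_{N/8\le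 l\le N/2}|w_l|^2a^2(\tfrac{4l}N)$, $\widehat\sigma^2_{S_N}=V^S_N(\widehat\sigma_N^2,w)$ and $\widehat\sigma^2_{U_N}=V^U_N(\widehat\sigma_N^2,w)$. From the samples $X(2\pi m/M)$, $0\le m<M$, form $$\widetilde w_l=\frac1M\sum_{m=0}^{M-1}X(\tfrac{2\pi m}M)e^{-i\frac{2\pi m}Ml},\qquad\widetilde\sigma_N^2=\frac2N\sum_{N/8\le l\le N/2}|\widetilde w_l|^2a^2(\tfrac{4l}N),$$ and let $\widetilde\sigma^2_{S_N}=V^S_N(s_N,\widetilde w)$ and $\widetilde\sigma^2_{U_N}=V^U_N(s'_N,\widetilde w)$, where the normalizations $s_N$ and $s_N'$ may each be any one of $\sigma_N^2$, $\widehat\sigma_N^2$, $\widetilde\sigma_N^2$. **Assumptions.** There is $\alpha>1$ such that: * (A1) $C_l=g(l)\,l^{-\alpha}$ for all $l\ge1$, with $c_1\le g\le c_2$ for some constants $0<c_1\le c_2<\infty$; * (B) $X$ is Gaussian; * (C) $C_l=L(l)\,l^{-\alpha}$ for all large $l$, with $L$ slowly varying, bounded and bounded away from zero; * (D) $M\to\infty$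 and $N=N(M)$ (of the form $2^{j+2}$) satisfies $\frac1N+\frac N{M^{\alpha/(\alpha+1)}}\to0$. **Proposition.** Under A1, B, C and D, in probability, $$\frac{\widetilde\sigma^2_{S_N}-\widehat\sigma^2_{S_N}}{\widehat\sigma^2_{S_N}}\to0,\qquad\frac{\widetilde\sigma^2_{U_N}-\widehat\sigma^2_{U_N}}{\widehat\sigma^2_{U_N}}\to0,$$ and the studentized central limit theorem holds with the discretely sampled coefficients $\widetilde w_l$ in the variance estimators: $$\Bigl(\frac{S_N}{\widetilde\sigma_{S_N}},\frac{U_N}{\widetilde\sigma_{U_N}}\Bigr)\ \xrightarrow{\ \mathcal D\ }\ N(0,I_2).$$ -/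

import Mathlib

open MeasureTheory ProbabilityTheory Filter Topology
open scoped Real

noncomputable section

namespace TorusNeedlet

/-- The torus `ℝ / 2πℤ`. Its normalised Haar measure `haarAddCircle` is `dϑ / 2π` on `[-π, π]`, and
`fourier l` is the function `ϑ ↦ exp (i l ϑ)` on it. -/
abbrev Torus : Type := AddCircle (2 * π)

instance factTwoPiPos : Fact (0 < 2 * π) := ⟨Real.two_pi_pos⟩

theorem fourier_torus_coe (l : ℤ) (t : ℝ) :
    fourier l (t : Torus) = Complex.exp (Complex.I * l * t) := by
  rw [fourier_coe_apply]
  congr 1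
  have h : (π : ℂ) ≠ 0 := by exact_mod_cast Real.pi_ne_zero
  push_cast
  field_simp

/-! ### The needlet window and the wavelets -/

/-- `φ` is a Littlewood-Paley cut-off function, and `a` is a smooth, even (real) square root of
`φ (ξ / 2) - φ ξ`. Consequently `a ξ = 0` unless `1/2 ≤ |ξ| ≤ 2`. -/
structure IsNeedletWindow (a : ℝ → ℝ) : Prop where
  smooth : ContDiff ℝ (⊤ : ℕ∞) a
  even : ∀ ξ, a (-ξ) = a ξ
  cutoff : ∃ φ : ℝ → ℝ, ContDiff ℝ (⊤ : ℕ∞) φ ∧ (∀ ξ, 0 ≤ φ ξ ∧ φ ξ ≤ 1) ∧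
    (∀ ξ, |ξ| ≤ 1 / 2 → φ ξ = 1) ∧ (∀ ξ, 1 < |ξ| → φ ξ = 0) ∧
    ∀ ξ, a ξ ^ 2 = φ (ξ / 2) - φ ξ

/-- The resolution `N = 2 ^ (j + 2)`. -/
def res (j : ℕ) : ℕ := 2 ^ (j + 2)

/-- The frequencies `l : ℤ` with `N / 8 ≤ |l| ≤ N / 2`; outside of it `a (4 l / N)` vanishes. -/
def band (N : ℕ) : Finset ℤ :=
  (Finset.Icc (-(N : ℤ)) N).filter fun l => (N : ℤ) ≤ 8 * |l| ∧ 2 * |l| ≤ (N : ℤ)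

/-- `ψ_N(t) = N ^ (-1/2) ∑_l a(4l/N) exp(i l t)`, as a complex number. -/
def psiC (a : ℝ → ℝ) (N : ℕ) (t : Torus) : ℂ :=
  ((1 / √(N : ℝ) : ℝ) : ℂ) * ∑ l ∈ band N, ((a (4 * l / N) : ℝ) : ℂ) * fourier l t

/-- The real valued wavelet `ψ_N`; see `psiC_eq_psi`. -/
def psi (a : ℝ → ℝ) (N : ℕ) (t : Torus) : ℝ := (psiC a N t).re

theorem psiC_eq_psi {a : ℝ → ℝ} (ha : ∀ ξ, a (-ξ) = a ξ) (N : ℕ) (t : Torus) :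
    psiC a N t = (psi a N t : ℂ) := by
  have h : (starRingEnd ℂ) (psiC a N t) = psiC a N t := by
    unfold psiC
    rw [map_mul, Complex.conj_ofReal, map_sum]
    congr 1
    refine Finset.sum_bij' (fun l _ => -l) (fun l _ => -l) ?_ ?_ ?_ ?_ ?_
    · intro l hl
      simp only [band, Finset.mem_filter, Finset.mem_Icc, abs_neg] at hl ⊢
      exact ⟨by omega, hl.2⟩
    · intro l hl
      simp only [band, Finset.mem_filter, Finset.mem_Icc, abs_neg] at hl ⊢
      exact ⟨by omega, hl.2⟩
    · intro l _; simp
    · intro l _; simp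
    · intro l _
      rw [map_mul, Complex.conj_ofReal, fourier_neg]
      congr 2
      rw [← ha (4 * l / N)]
      congr 1
      push_cast
      ring
  exact (Complex.conj_eq_iff_re.mp h).symm

/-- Fejér's kernel `K_N(t) = |∑_{k=1}^N exp(i t k)|² / (2πN)`. -/
def fejer (N : ℕ) (t : ℝ) : ℝ :=
  1 / (2 * π * N) * ‖∑ k ∈ Finset.Icc 1 N, Complex.exp (Complex.I * t * k)‖ ^ 2

/-! ### The random field -/

variable {Ω : Type*} [MeasurableSpace Ω]

/-- The Fourier coefficient `w_l = (1/2π) ∫ X(ϑ) exp(-i l ϑ) dϑ` of the field. -/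
def w (X : Torus → Ω → ℝ) (l : ℤ) (ω : Ω) : ℂ :=
  fourierCoeff (fun t : Torus => (X t ω : ℂ)) l

/-- The angular power spectrum `C_l = E |w_l|²`. -/
def C (P : Measure Ω) (X : Torus → Ω → ℝ) (l : ℤ) : ℝ := ∫ ω, ‖w X l ω‖ ^ 2 ∂P

/-- The real, finite variance, isotropic (stationary) random field
`X(ϑ) = ∑_l w_l exp(i l ϑ)` on the torus, the series converging in mean square for each `ϑ`,
with `w_0 = 0`, `E w_l = 0` and `∑_l C_l < ∞`. -/
structure IsTorusField (P : Measure Ω) (X : Torus → Ω → ℝ) : Prop where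
  measurable : Measurable (fun p : Torus × Ω => X p.1 p.2)
  memLp : ∀ t, MemLp (X t) 2 P
  isotropic : ∀ s t h, ∫ ω, X (s + h) ω * X (t + h) ω ∂P = ∫ ω, X s ω * X t ω ∂P
  w_zero : ∀ᵐ ω ∂P, w X 0 ω = 0
  w_centered : ∀ l, ∫ ω, w X l ω ∂P = 0
  summable_C : Summable (C P X)
  expansion : ∀ t, Tendsto
    (fun n : ℕ => eLpNorm
      (fun ω => (X t ω : ℂ) - ∑ l ∈ Finset.Icc (-(n : ℤ)) n, w X l ω * fourier l t) 2 P)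
    atTop (𝓝 0)

/-- Assumption A1: `C_l = g(l) l^(-α)` for `l ≥ 1`, with `α > 1` and `g` bounded and bounded away
from zero. No smoothness of `g` is required. -/
def AssumptionA1 (P : Measure Ω) (X : Torus → Ω → ℝ) (α : ℝ) : Prop :=
  1 < α ∧ ∃ (c₁ c₂ : ℝ) (g : ℕ → ℝ), 0 < c₁ ∧ (∀ l, c₁ ≤ g l ∧ g l ≤ c₂) ∧
    ∀ l : ℕ, 1 ≤ l → C P X l = g l * (l : ℝ) ^ (-α)

/-- Slowly varying functions at infinity, in the sense of Karamata. -/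
structure IsSlowlyVarying (L : ℝ → ℝ) : Prop where
  measurable : Measurable L
  eventually_pos : ∀ᶠ x in atTop, 0 < L x
  tendsto_ratio : ∀ s : ℝ, 0 < s → Tendsto (fun x => L (s * x) / L x) atTop (𝓝 1)

/-- Assumption C: `C_l = L(l) l^(-α)` as `l → ∞`, with `α > 1` and `L` slowly varying, bounded and
bounded away from zero. -/
def AssumptionC (P : Measure Ω) (X : Torus → Ω → ℝ) (α : ℝ) : Prop :=
  1 < α ∧ ∃ L : ℝ → ℝ, IsSlowlyVarying L ∧
    (∃ c₁ c₂ : ℝ, 0 < c₁ ∧ ∀ᶠ x in atTop, c₁ ≤ L x ∧ L x ≤ c₂) ∧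
    ∀ᶠ l : ℕ in atTop, C P X l = L l * (l : ℝ) ^ (-α)

/-- Assumption D for the sequences of resolutions `N = 2 ^ (j n + 2)` and sample sizes `M n → ∞`:
`1 / N + N / M ^ (α / (α + 1)) → 0`. -/
def AssumptionD (α : ℝ) (j M : ℕ → ℕ) : Prop :=
  Tendsto M atTop atTop ∧
    Tendsto (fun n => 1 / (res (j n) : ℝ) + (res (j n) : ℝ) / (M n : ℝ) ^ (α / (α + 1)))
      atTop (𝓝 0)

/-! ### Wavelet coefficients, skewness and kurtosis -/

/-- `β_{Nk} = (1/2π) ∫ X(ϑ) ψ_N(ϑ - 2πk/N) dϑ`. -/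
def beta (a : ℝ → ℝ) (X : Torus → Ω → ℝ) (N k : ℕ) (ω : Ω) : ℝ :=
  ∫ t : Torus, X t ω * psi a N (t - ((2 * π * k / N : ℝ) : Torus)) ∂AddCircle.haarAddCircle

/-- `(2/N) ∑_{N/8 ≤ l ≤ N/2} c_l a²(4l/N)`. -/
def bandMean (a : ℝ → ℝ) (N : ℕ) (c : ℤ → ℝ) : ℝ :=
  2 / N * ∑ l ∈ (band N).filter (0 < ·), c l * a (4 * l / N) ^ 2

/-- The variance `σ_N²` of the wavelet coefficients. -/
def sigmaSq (a : ℝ → ℝ) (P : Measure Ω) (X : Torus → Ω → ℝ) (N : ℕ) : ℝ :=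
  bandMean a N (C P X)

/-- `β_{Nk} / σ_N`. -/
def betaHat (a : ℝ → ℝ) (P : Measure Ω) (X : Torus → Ω → ℝ) (N k : ℕ) (ω : Ω) : ℝ :=
  beta a X N k ω / √(sigmaSq a P X N)

/-- The skewness statistic `S_N`. -/
def S (a : ℝ → ℝ) (P : Measure Ω) (X : Torus → Ω → ℝ) (N : ℕ) (ω : Ω) : ℝ :=
  1 / √(N : ℝ) * ∑ k ∈ Finset.Icc 1 N, betaHat a P X N k ω ^ 3

/-- The kurtosis statistic `U_N`. -/
def U (a : ℝ → ℝ) (P : Measure Ω) (X : Torus → Ω → ℝ) (N : ℕ) (ω : Ω) : ℝ :=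
  1 / √(N : ℝ) * ∑ k ∈ Finset.Icc 1 N, (betaHat a P X N k ω ^ 4 - 3)

/-! ### Variance estimators -/

/-- The discrete approximation
`w̃_l = (1/M) ∑_{m < M} X(2πm/M) exp(-i l 2πm/M)` of `w_l`. -/
def wTilde (X : Torus → Ω → ℝ) (M : ℕ) (l : ℤ) (ω : Ω) : ℂ :=
  1 / (M : ℂ) * ∑ m ∈ Finset.range M,
    (X ((2 * π * m / M : ℝ) : Torus) ω : ℂ) * fourier (-l) ((2 * π * m / M : ℝ) : Torus)

/-- `δ_{l₁ … l_p} = E ∏ᵢ |w_{lᵢ}|² / C_{lᵢ}`. -/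
def delta (P : Measure Ω) (X : Torus → Ω → ℝ) {p : ℕ} (l : Fin p → ℤ) : ℝ :=
  ∫ ω, ∏ i, ‖w X (l i) ω‖ ^ 2 / C P X (l i) ∂P

/-- `∑_{l₁ … l_p} (1 / δ_{l₁ … l_p}) ∏ᵢ |v_{lᵢ}|² a²(4 lᵢ / N) · K_N((2π/N) (l₁ + … + l_p))`
for a family of coefficients `v`. -/
def polySum (a : ℝ → ℝ) (P : Measure Ω) (X : Torus → Ω → ℝ) (p N : ℕ) (v : ℤ → ℂ) : ℝ :=
  ∑ l ∈ Fintype.piFinset (fun _ : Fin p => band N),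
    1 / delta P X l * (∏ i, ‖v (l i)‖ ^ 2 * a (4 * l i / N) ^ 2) *
      fejer N (2 * π / N * ∑ i, (l i : ℝ))

/-- Estimator of the variance of `S_N` from the coefficients `v`; `s` is the value that is used for
the variance `σ_N²` in the normalisation. -/
def skewVar (a : ℝ → ℝ) (P : Measure Ω) (X : Torus → Ω → ℝ) (N : ℕ) (s : ℝ) (v : ℤ → ℂ) : ℝ :=
  12 * π / (N ^ 3 * s ^ 3) * polySum a P X 3 N v

/-- Estimator of the variance of `U_N` from the coefficients `v`; `s` is the value that is used for
the variance `σ_N²` in the normalisation. -/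
def kurtVar (a : ℝ → ℝ) (P : Measure Ω) (X : Torus → Ω → ℝ) (N : ℕ) (s : ℝ) (v : ℤ → ℂ) : ℝ :=
  72 / s ^ 2 * (2 * π / N ^ 2) * polySum a P X 2 N v +
    24 / s ^ 4 * (2 * π / N ^ 4) * polySum a P X 4 N v

/-- `σ̂_N²`, from the Fourier coefficients `w_l`. -/
def sigmaSqHat (a : ℝ → ℝ) (X : Torus → Ω → ℝ) (N : ℕ) (ω : Ω) : ℝ :=
  bandMean a N (fun l => ‖w X l ω‖ ^ 2)

/-- The same estimator of `σ_N²`, with `w̃_l` in place of `w_l`. -/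
def sigmaSqTilde (a : ℝ → ℝ) (X : Torus → Ω → ℝ) (N M : ℕ) (ω : Ω) : ℝ :=
  bandMean a N (fun l => ‖wTilde X M l ω‖ ^ 2)

/-- `σ̂²_{S_N}`. -/
def skewVarHat (a : ℝ → ℝ) (P : Measure Ω) (X : Torus → Ω → ℝ) (N : ℕ) (ω : Ω) : ℝ :=
  skewVar a P X N (sigmaSqHat a X N ω) (fun l => w X l ω)

/-- `σ̂²_{U_N}`. -/
def kurtVarHat (a : ℝ → ℝ) (P : Measure Ω) (X : Torus → Ω → ℝ) (N : ℕ) (ω : Ω) : ℝ :=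
  kurtVar a P X N (sigmaSqHat a X N ω) (fun l => w X l ω)

/-- The possible values for `σ_N²` in the normalisation of the variance estimators: the exact
value, its estimate from the `w_l`, and its estimate from the `w̃_l`. -/
inductive Normalizer
  | exact
  | fourierBased
  | sampleBased

def Normalizer.value (a : ℝ → ℝ) (P : Measure Ω) (X : Torus → Ω → ℝ) (N M : ℕ) (ω : Ω) :
    Normalizer → ℝ
  | .exact => sigmaSq a P X N
  | .fourierBased => sigmaSqHat a X N ω
  | .sampleBased => sigmaSqTilde a X N M ω

/-- `σ̃²_{S_N}`: the estimator with the `w̃_l` in place of the `w_l`. -/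
def skewVarTilde (a : ℝ → ℝ) (P : Measure Ω) (X : Torus → Ω → ℝ) (ν : Normalizer) (N M : ℕ)
    (ω : Ω) : ℝ :=
  skewVar a P X N (ν.value a P X N M ω) (fun l => wTilde X M l ω)

/-- `σ̃²_{U_N}`: the estimator with the `w̃_l` in place of the `w_l`. -/
def kurtVarTilde (a : ℝ → ℝ) (P : Measure Ω) (X : Torus → Ω → ℝ) (ν : Normalizer) (N M : ℕ)
    (ω : Ω) : ℝ :=
  kurtVar a P X N (ν.value a P X N M ω) (fun l => wTilde X M l ω)

end TorusNeedlet

end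

/-! Three facts carry the theorem: aliasing is negligible under Assumption D, the variance
estimators concentrate, and `S_N`, `U_N` satisfy a joint central limit theorem.

Aliasing. Sampling at `M` points replaces `w_l` by the sum of all `w_{l + kM}`. Stationarity makes
the `w_l` orthogonal, so for `2|l| ≤ M` the mean square error is the sum of the `C_{l + kM}`, `k ≠
0`, which is `O(M^(-α))`. Relative to `C_l ≍ N^(-α)` and summed over the `O(N)` frequencies of the
band, this is `O(N^(α+1) M^(-α))`, the power `α + 1` of the quantity in Assumption D. A single
variable `samplingError`, small in mean square, thus controls all frequencies at once
(`exists_integral_samplingError_sq_le`, `tendsto_rate`).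

Concentration. At multiples of `2π/N` Fejér's kernel is the indicator of divisibility by `N`, up to
a factor. The estimators are therefore, up to powers of the ratio of normalisations, forms in the
normalised periodogram `u_l = |w_l|²/C_l` whose weights `N ∏ h(l_i)` live on resonant tuples, those
with `N ∣ l_1 + … + l_p`. Dividing by `δ` gives every term its correct mean. The `u_l` with `l ≥ 0`
are independent, so two terms correlate only when they share a frequency up to sign, and such tuples
carry a share `O(1/N)` of the weight. Hence the forms are close to the constants `resSum`
(`exists_powerForm_bounds`, `tendstoInMeasure_powerForm`). Replacing `w` by `w̃` changes a form by
at most `samplingError` times a variable of bounded mean.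

Central limit theorem. The vector `x` of the `β̂_{Nk}` is Gaussian and its correlation matrix has
bounded norm, because the spectral weights are at most `K/N`. Since `∑ x_k = 0`, `S_N` is also the
normalised sum of `x_k³ - 3 x_k`; both this polynomial and `x⁴ - 3` lie in the image of the Stein
operator `p ↦ x p - p'`. For a linear combination `F` of the two sums, Gaussian integration by parts
gives `E[F exp(itF)] = it E[Γ exp(itF)]`, with `Γ` a carré du champ of mean `V = E F²`. So the
characteristic function of `F` is that of `N(0, V)` up to `E|Γ - V|`, and a Poincaré type
inequality, proved by rotating two independent copies of `x`, makes this `O(N^(-1/4))`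
(`norm_integral_exp_sub_le`, `integral_abs_sub_integral_le`).

The two halves meet because the variances of `S_N` and `U_N` are `6 resSum 3` and `72 resSum 2 + 24
resSum 4`, the very constants the estimators approach, while the covariance vanishes. These
variances stay away from zero since a positive proportion of pairs `(l, -l)` and triples `(l, m,
-l-m)` in the band carry weight (`exists_spectral_bounds`). Slutsky's lemma concludes. -/

noncomputable section

namespace TorusNeedlet

/-! ### Random variables with all moments -/

/-- Having finite moments of all orders. -/
def AllLp {Ω E : Type*} [MeasurableSpace Ω] [NormedAddCommGroup E] (f : Ω → E) (μ : Measure Ω) :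
    Prop :=
  ∀ n : ℕ, MemLp f n μ

namespace AllLp

variable {Ω E : Type*} [MeasurableSpace Ω] [NormedAddCommGroup E] {μ : Measure Ω}

theorem memLp_two {f : Ω → E} (hf : AllLp f μ) : MemLp f 2 μ := by simpa using hf 2

theorem integrable {f : Ω → E} (hf : AllLp f μ) : Integrable f μ :=
  memLp_one_iff_integrable.1 (by simpa using hf 1)

theorem aestronglyMeasurable {f : Ω → E} (hf : AllLp f μ) : AEStronglyMeasurable f μ := (hf 0).1

theorem const [IsFiniteMeasure μ] (c : E) : AllLp (fun _ : Ω => c) μ := fun _ => memLp_const c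

theorem add {f g : Ω → E} (hf : AllLp f μ) (hg : AllLp g μ) : AllLp (fun x => f x + g x) μ :=
  fun n => (hf n).add (hg n)

theorem sub {f g : Ω → E} (hf : AllLp f μ) (hg : AllLp g μ) : AllLp (fun x => f x - g x) μ :=
  fun n => (hf n).sub (hg n)

theorem sum {ι : Type*} {s : Finset ι} {f : ι → Ω → E} (hf : ∀ i ∈ s, AllLp (f i) μ) :
    AllLp (fun x => ∑ i ∈ s, f i x) μ :=
  fun n => memLp_finsetSum s fun i hi => hf i hi n

theorem mul {A : Type*} [NormedRing A] {f g : Ω → A} (hf : AllLp f μ) (hg : AllLp g μ) :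
    AllLp (fun x => f x * g x) μ := by
  intro n
  -- Hölder with `1/(2n) + 1/(2n) = 1/n`; all moments of the factors are available, so products stay
  -- in the class.
  have h : ENNReal.HolderTriple ((2 * n : ℕ) : ENNReal) ((2 * n : ℕ) : ENNReal) (n : ENNReal) := by
    constructor
    rcases Nat.eq_zero_or_pos n with rfl | hn
    · simp
    · push_cast
      rw [ENNReal.mul_inv (by simp) (by simp), ← add_mul, ENNReal.inv_two_add_inv_two, one_mul]
  exact (hg (2 * n)).mul (hf (2 * n)) (r := (n : ENNReal))

theorem const_mul {A : Type*} [NormedRing A] [IsFiniteMeasure μ] {f : Ω → A} (c : A)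
    (hf : AllLp f μ) : AllLp (fun x => c * f x) μ := (const c).mul hf

theorem pow {A : Type*} [NormedRing A] [IsFiniteMeasure μ] {f : Ω → A} (hf : AllLp f μ) (k : ℕ) :
    AllLp (fun x => f x ^ k) μ := by
  induction k with
  | zero => simpa using const (1 : A)
  | succ k ih => simpa only [pow_succ] using ih.mul hf

theorem ofReal {f : Ω → ℝ} (hf : AllLp f μ) : AllLp (fun x => (f x : ℂ)) μ :=
  fun n => (hf n).ofReal

theorem abs {f : Ω → ℝ} (hf : AllLp f μ) : AllLp (fun x => |f x|) μ := fun n => (hf n).abs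

theorem of_bounded [IsFiniteMeasure μ] {f : Ω → E} (hf : AEStronglyMeasurable f μ) (c : ℝ)
    (h : ∀ x, ‖f x‖ ≤ c) : AllLp f μ :=
  fun _ => MemLp.of_bound hf c (Eventually.of_forall h)

end AllLp

/-! ### Gaussian integration by parts -/

/-- Stein's identity in dimension one: the derivative of the Gaussian density is `-x` times the
density, so this is integration by parts on the line. -/
theorem integral_mul_gaussianReal {h h' : ℝ → ℂ} (hd : ∀ x, HasDerivAt h (h' x) x)
    (hi : Integrable h (gaussianReal 0 1))
    (hxi : Integrable (fun x : ℝ => (x : ℂ) * h x) (gaussianReal 0 1))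
    (hi' : Integrable h' (gaussianReal 0 1)) :
    ∫ x, (x : ℂ) * h x ∂gaussianReal 0 1 = ∫ x, h' x ∂gaussianReal 0 1 := by
  have key : ∀ f : ℝ → ℂ, Integrable f (gaussianReal 0 1) →
      Integrable (fun x => f x * (gaussianPDFReal 0 1 x : ℂ)) := by
    intro f hf
    rw [gaussianReal_of_var_ne_zero _ one_ne_zero,
      integrable_withDensity_iff_integrable_smul' (measurable_gaussianPDF _ _)
        (ae_of_all _ fun _ => gaussianPDF_lt_top)] at hf
    refine hf.congr (ae_of_all _ fun x => ?_)
    simp [mul_comm]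
  have hpdf : ∀ x : ℝ, HasDerivAt (fun x : ℝ => (gaussianPDFReal 0 1 x : ℂ))
      (-((x : ℂ) * (gaussianPDFReal 0 1 x : ℂ))) x := by
    intro x
    have : HasDerivAt (gaussianPDFReal 0 1) (-(x * gaussianPDFReal 0 1 x)) x := by
      unfold gaussianPDFReal
      have h1 : HasDerivAt (fun y : ℝ => -(y - 0) ^ 2 / (2 * ((1 : NNReal) : ℝ))) (-x) x := by
        have := (((hasDerivAt_id x).sub_const 0).pow 2).neg.div_const (2 * ((1 : NNReal) : ℝ))
        convert! this using 1
        simp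
        ring
      have := (h1.exp).const_mul (√(2 * π * ((1 : NNReal) : ℝ)))⁻¹
      convert! this using 1
      ring
    have := this.ofReal_comp
    convert! this using 1
    push_cast; ring
  have hxi' : Integrable (h * fun x : ℝ => -((x : ℂ) * (gaussianPDFReal 0 1 x : ℂ))) := by
    refine (key _ hxi).neg.congr (ae_of_all _ fun x => ?_)
    simp only [Pi.mul_apply, Pi.neg_apply]; ring
  have := integral_mul_deriv_eq_deriv_mul_of_integrable (u := h) (u' := h')
    (v := fun x => (gaussianPDFReal 0 1 x : ℂ)) (fun x _ => hd x) (fun x _ => hpdf x)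
    hxi' (key _ hi') (key _ hi)
  rw [integral_gaussianReal_eq_integral_smul one_ne_zero,
    integral_gaussianReal_eq_integral_smul one_ne_zero]
  simp only [Complex.real_smul]
  calc ∫ x, (gaussianPDFReal 0 1 x : ℂ) * ((x : ℂ) * h x)
      = -∫ x, h x * -((x : ℂ) * (gaussianPDFReal 0 1 x : ℂ)) := by
        rw [← integral_neg]; congr 1; ext x; ring
    _ = ∫ x, (gaussianPDFReal 0 1 x : ℂ) * h' x := by
        rw [this, neg_neg]; congr 1; ext x; ring

/-- `μ` is the law of a centred Gaussian vector with correlation matrix `R`, the quadratic form of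
which is bounded by `K`. -/
structure IsCorrelatedGaussian {ι : Type*} [Fintype ι] (μ : Measure (ι → ℝ)) (R : ι → ι → ℝ)
    (K : ℝ) : Prop where
  gaussian : IsGaussian μ
  mean : ∀ i, ∫ x, x i ∂μ = 0
  cov : ∀ i j, ∫ x, x i * x j ∂μ = R i j
  diag : ∀ i, R i i = 1
  quad_le : ∀ v : ι → ℝ, ∫ x, (∑ i, v i * x i) ^ 2 ∂μ ≤ K * ∑ i, v i ^ 2

namespace IsCorrelatedGaussian

variable {ι : Type*} [Fintype ι] {μ : Measure (ι → ℝ)} {R : ι → ι → ℝ} {K : ℝ}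

theorem allLp_eval (hμ : IsCorrelatedGaussian μ R K) (i : ι) : AllLp (fun x => x i) μ := by
  have := hμ.gaussian
  intro n
  have := IsGaussian.memLp_dual μ (ContinuousLinearMap.proj i) n (by simp)
  exact this

theorem symm (hμ : IsCorrelatedGaussian μ R K) (i j : ι) : R i j = R j i := by
  rw [← hμ.cov, ← hμ.cov]; simp_rw [mul_comm]

theorem map_eval (hμ : IsCorrelatedGaussian μ R K) (i : ι) :
    μ.map (fun x => x i) = gaussianReal 0 1 := by
  have := hμ.gaussian
  have h := IsGaussian.map_eq_gaussianReal (μ := μ) (ContinuousLinearMap.proj i)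
  have h1 : μ[(ContinuousLinearMap.proj i : (ι → ℝ) →L[ℝ] ℝ)] = 0 := hμ.mean i
  have h2 : Var[(ContinuousLinearMap.proj i : (ι → ℝ) →L[ℝ] ℝ); μ] = 1 := by
    rw [variance_of_integral_eq_zero (by fun_prop) h1, ← hμ.diag i, ← hμ.cov]
    congr 1; ext x; simp [sq]
  rw [h1, h2, Real.toNNReal_one] at h
  exact h

/-- The residuals `x_j - R_{kj} x_k` are uncorrelated with `x_k`, hence independent of it by joint
Gaussianity. With the residuals frozen, `x` moves along a line of direction `R k` and the
one-dimensional identity applies. -/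
theorem integral_mul_eval (hμ : IsCorrelatedGaussian μ R K) (k : ι) {Φ D : (ι → ℝ) → ℂ}
    (hd : ∀ x, HasDerivAt (fun s : ℝ => Φ (x + s • R k)) (D x) 0)
    (hΦ : Integrable Φ μ) (hxΦ : Integrable (fun x => (x k : ℂ) * Φ x) μ) (hD : Integrable D μ) :
    ∫ x, (x k : ℂ) * Φ x ∂μ = ∫ x, D x ∂μ := by
  have := hμ.gaussian
  let r : ι → ℝ := R k
  let T : (ι → ℝ) →L[ℝ] ((Unit → ℝ) × (ι → ℝ)) :=
    (ContinuousLinearMap.pi fun _ => ContinuousLinearMap.proj k).prod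
      (ContinuousLinearMap.pi fun j => ContinuousLinearMap.proj j - r j • ContinuousLinearMap.proj k)
  have hT : HasGaussianLaw (fun x : ι → ℝ => ((fun _ : Unit => x k), fun j => x j - r j * x k)) μ :=
    (IsGaussian.hasGaussianLaw_id (μ := μ)).map T
  have hind := hT.indepFun_of_covariance_eval (X := fun _ (x : ι → ℝ) => x k) (Y := fun j (x : ι → ℝ) => x j - r j * x k)
    (fun _ j => by
      rw [covariance_eq_sub (hμ.allLp_eval k).memLp_two
        ((hμ.allLp_eval j).sub ((hμ.allLp_eval k).const_mul _)).memLp_two]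
      simp only [hμ.mean, zero_mul, sub_zero, Pi.mul_apply, mul_sub]
      rw [integral_sub ((hμ.allLp_eval k).mul (hμ.allLp_eval j)).integrable
        ((hμ.allLp_eval k).mul ((hμ.allLp_eval k).const_mul _)).integrable, hμ.cov]
      have : ∀ x : ι → ℝ, x k * (r j * x k) = r j * (x k * x k) := fun x => by ring
      simp_rw [this]
      rw [integral_const_mul, hμ.cov, hμ.diag]
      simp [r])
  have hind' : IndepFun (fun x : ι → ℝ => x k) (fun x j => x j - r j * x k) μ :=
    hind.comp (φ := fun f : Unit → ℝ => f ()) (measurable_pi_apply ()) measurable_id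
  have hm : Measurable (fun x : ι → ℝ => fun j => x j - r j * x k) := by fun_prop
  rw [indepFun_iff_map_prod_eq_prod_map_map (measurable_pi_apply k).aemeasurable hm.aemeasurable,
    hμ.map_eval k] at hind'
  set ν := μ.map (fun x j => x j - r j * x k) with hν
  have hνp : IsProbabilityMeasure ν := Measure.isProbabilityMeasure_map hm.aemeasurable
  have hS : Measurable (fun x : ι → ℝ => (x k, fun j => x j - r j * x k)) :=
    (measurable_pi_apply k).prodMk hm
  have emb : MeasurePreserving (fun x : ι → ℝ => (x k, fun j => x j - r j * x k)) μ
      ((gaussianReal 0 1).prod ν) := ⟨hS, hind'⟩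
  let e : ℝ × (ι → ℝ) → (ι → ℝ) := fun p => p.2 + p.1 • r
  have he : Measurable e := by fun_prop
  have hes : ∀ x : ι → ℝ, e (x k, fun j => x j - r j * x k) = x := by
    intro x; ext j; simp [e, mul_comm]
  have hpres : MeasurePreserving e ((gaussianReal 0 1).prod ν) μ := by
    refine ⟨he, ?_⟩
    rw [← hind', Measure.map_map he hS]
    have : e ∘ (fun x : ι → ℝ => (x k, fun j => x j - r j * x k)) = id := funext hes
    rw [this, Measure.map_id]
  -- The `k`-th residual vanishes because `R k k = 1`, but only almost surely under `ν`; hence an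
  -- almost everywhere statement.
  have hek : ∀ᵐ p ∂((gaussianReal 0 1).prod ν), (e p) k = p.1 := by
    rw [← hind', ae_map_iff hS.aemeasurable
      (measurableSet_eq_fun (by fun_prop) (by fun_prop))]
    exact ae_of_all _ fun x => by rw [hes]
  have conv : ∀ g : (ι → ℝ) → ℂ, Integrable g μ →
      ∫ x, g x ∂μ = ∫ p, g (e p) ∂((gaussianReal 0 1).prod ν) := by
    intro g hg
    conv_lhs => rw [← hpres.map_eq]
    exact integral_map he.aemeasurable (by rw [hpres.map_eq]; exact hg.1)
  have hint : ∀ g : (ι → ℝ) → ℂ, Integrable g μ →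
      Integrable (fun p => g (e p)) ((gaussianReal 0 1).prod ν) := fun g hg =>
    hpres.integrable_comp_of_integrable hg
  have hxΦ' : Integrable (fun p : ℝ × (ι → ℝ) => (p.1 : ℂ) * Φ (e p)) ((gaussianReal 0 1).prod ν) :=
    (hint _ hxΦ).congr (hek.mono fun p hp => by simp only [hp])
  rw [conv _ hxΦ, conv _ hD]
  have h1 : ∫ p, ((e p k : ℝ) : ℂ) * Φ (e p) ∂((gaussianReal 0 1).prod ν)
      = ∫ p, (p.1 : ℂ) * Φ (e p) ∂((gaussianReal 0 1).prod ν) :=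
    integral_congr_ae (hek.mono fun p hp => by simp only [hp])
  rw [h1, integral_prod_symm _ hxΦ', integral_prod_symm _ (hint _ hD)]
  refine integral_congr_ae ?_
  filter_upwards [hxΦ'.prod_left_ae, (hint _ hD).prod_left_ae, (hint _ hΦ).prod_left_ae] with y h1 h2 h3
  refine integral_mul_gaussianReal (fun s => ?_) h3 h1 h2
  -- The hypothesis differentiates at parameter `0` from the base point `e (s, y)`; the shift `t ↦ t
  -- - s` turns this into a derivative at `s`.
  have := hd (e (s, y))
  have h4 := (HasDerivAt.scomp s (h := fun t : ℝ => t - s) (h' := 1)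
    (g₁ := fun t : ℝ => Φ (e (s, y) + t • R k)) (by simpa using this)
    ((hasDerivAt_id s).sub_const s))
  rw [one_smul] at h4
  convert! h4 using 2 with t
  simp only [Function.comp, e, r]
  congr 1
  module

/-! ### A Poincaré type inequality in `L¹` by rotating two independent copies -/

/-- The rotation by the angle `θ` in the product of two copies of a vector space. -/
def rotatePair (θ : ℝ) (p : (ι → ℝ) × (ι → ℝ)) : (ι → ℝ) × (ι → ℝ) :=
  (Real.cos θ • p.1 + Real.sin θ • p.2, -Real.sin θ • p.1 + Real.cos θ • p.2)

omit [Fintype ι] in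
theorem continuous_rotatePair :
    Continuous (fun q : ℝ × ((ι → ℝ) × (ι → ℝ)) => rotatePair q.1 q.2) := by
  unfold rotatePair
  fun_prop

theorem measurePreserving_rotatePair (hμ : IsCorrelatedGaussian μ R K) (θ : ℝ) :
    MeasurePreserving (rotatePair θ) (μ.prod μ) (μ.prod μ) := by
  have := hμ.gaussian
  refine ⟨(continuous_rotatePair.comp (Continuous.prodMk_right θ)).measurable, ?_⟩
  refine IsGaussian.map_rotation_eq_self_of_forall_strongDual_eq_zero (fun L => ?_) θ
  classical
  have hL : ∀ x, L x = ∑ i, L (Pi.single i 1) * x i := by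
    intro x
    conv_lhs => rw [pi_eq_sum_univ' x, map_sum]
    refine Finset.sum_congr rfl fun i _ => ?_
    rw [map_smul, smul_eq_mul, mul_comm]
  rw [integral_congr_ae (ae_of_all _ hL), integral_finsetSum _ fun i _ => ((hμ.allLp_eval i).const_mul _).integrable]
  simp_rw [integral_const_mul, hμ.mean, mul_zero, Finset.sum_const_zero]

/-- The path `cos θ • x + sin θ • y` leads from `x` to `y` in a quarter turn, and its velocity is
the second component of the rotated pair; then the fundamental theorem of calculus. -/
theorem enorm_sub_le_lintegral_rotatePair {Γ : (ι → ℝ) → ℝ} {G : ι → (ι → ℝ) → ℝ}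
    (hd : ∀ x, HasFDerivAt Γ (∑ i, G i x • (ContinuousLinearMap.proj i : (ι → ℝ) →L[ℝ] ℝ)) x)
    {g : (ι → ℝ) × (ι → ℝ) → ℝ} (hgdef : ∀ p, g p = ∑ i, G i p.1 * p.2 i) (hg : Continuous g)
    (x y : ι → ℝ) :
    ‖Γ x - Γ y‖ₑ ≤ ∫⁻ θ in Set.Ioc (0 : ℝ) (π / 2), ‖g (rotatePair θ (x, y))‖ₑ := by
  have hder : ∀ θ ∈ Set.uIcc 0 (π / 2), HasDerivAt (fun θ => Γ (rotatePair θ (x, y)).1)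
      (g (rotatePair θ (x, y))) θ := by
    intro θ _
    have h1 : HasDerivAt (fun θ : ℝ => (rotatePair θ (x, y)).1) (rotatePair θ (x, y)).2 θ := by
      unfold rotatePair
      exact ((Real.hasDerivAt_cos θ).smul_const x).add ((Real.hasDerivAt_sin θ).smul_const y)
    have h2 := (hd (rotatePair θ (x, y)).1).comp_hasDerivAt θ h1
    rw [hgdef]
    simpa only [sum_apply, smul_apply, ContinuousLinearMap.proj_apply, smul_eq_mul] using! h2
  have hcont : Continuous (fun θ => g (rotatePair θ (x, y))) := by
    unfold rotatePair
    fun_prop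
  have h3 := intervalIntegral.integral_eq_sub_of_hasDerivAt hder (hcont.intervalIntegrable _ _)
  have e : ‖Γ x - Γ y‖ₑ = ‖∫ θ in (0 : ℝ)..(π / 2), g (rotatePair θ (x, y))‖ₑ := by
    rw [h3, ← enorm_neg, neg_sub]
    simp [rotatePair]
  rw [e, intervalIntegral.integral_of_le (by positivity)]
  exact enorm_integral_le_lintegral_enorm _

/-- Every rotated pair has the law of an independent pair `(x, y)`, so the deviation is at most
`π/2` times `E|⟨∇Γ(x), y⟩|`. Conditionally on `x`, the second moment of this inner product is at
most `K |∇Γ(x)|²`. The free parameter `s` comes from `|g| ≤ (s + g²/s)/2`, used in place of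
Cauchy-Schwarz. -/
theorem integral_abs_sub_integral_le (hμ : IsCorrelatedGaussian μ R K) {Γ : (ι → ℝ) → ℝ}
    {G : ι → (ι → ℝ) → ℝ}
    (hd : ∀ x, HasFDerivAt Γ (∑ i, G i x • (ContinuousLinearMap.proj i : (ι → ℝ) →L[ℝ] ℝ)) x)
    (hG : ∀ i, Continuous (G i)) (hΓ : Integrable Γ μ)
    (hGi : Integrable (fun x => ∑ i, G i x ^ 2) μ) {s : ℝ} (hs : 0 < s) :
    ∫ x, |Γ x - ∫ y, Γ y ∂μ| ∂μ ≤ s + K * (∫ x, ∑ i, G i x ^ 2 ∂μ) / s := by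
  have := hμ.gaussian
  have hΓc : Continuous Γ := continuous_iff_continuousAt.2 fun x => (hd x).continuousAt
  let g : (ι → ℝ) × (ι → ℝ) → ℝ := fun p => ∑ i, G i p.1 * p.2 i
  have hg : Continuous g := by fun_prop
  have h1 : ∫⁻ x, ‖Γ x - ∫ y, Γ y ∂μ‖ₑ ∂μ
      ≤ ENNReal.ofReal (π / 2) * ∫⁻ p, ‖g p‖ₑ ∂(μ.prod μ) := by
    calc ∫⁻ x, ‖Γ x - ∫ y, Γ y ∂μ‖ₑ ∂μ ≤ ∫⁻ x, ∫⁻ y, ‖Γ x - Γ y‖ₑ ∂μ ∂μ := by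
          refine lintegral_mono fun x => ?_
          have : Γ x - ∫ y, Γ y ∂μ = ∫ y, (Γ x - Γ y) ∂μ := by
            rw [integral_sub (integrable_const _) hΓ]; simp
          rw [this]
          exact enorm_integral_le_lintegral_enorm _
      _ ≤ ∫⁻ x, ∫⁻ y, (∫⁻ θ in Set.Ioc 0 (π / 2), ‖g (rotatePair θ (x, y))‖ₑ) ∂μ ∂μ :=
          lintegral_mono fun x => lintegral_mono fun y =>
            enorm_sub_le_lintegral_rotatePair hd (fun _ => rfl) hg x y
      _ = ∫⁻ p, (∫⁻ θ in Set.Ioc 0 (π / 2), ‖g (rotatePair θ p)‖ₑ) ∂(μ.prod μ) := by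
          rw [lintegral_prod]
          refine (Measurable.lintegral_prod_left' (f := fun q : ℝ × ((ι → ℝ) × (ι → ℝ)) =>
            ‖g (rotatePair q.1 q.2)‖ₑ) ?_).aemeasurable
          exact (hg.comp continuous_rotatePair).measurable.enorm
      _ = ∫⁻ θ in Set.Ioc 0 (π / 2), ∫⁻ p, ‖g (rotatePair θ p)‖ₑ ∂(μ.prod μ) := by
          refine lintegral_lintegral_swap (f := fun p θ => ‖g (rotatePair θ p)‖ₑ) ?_
          exact ((hg.comp (continuous_rotatePair.comp continuous_swap)).measurable.enorm).aemeasurable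
      _ = ∫⁻ θ in Set.Ioc 0 (π / 2), ∫⁻ p, ‖g p‖ₑ ∂(μ.prod μ) := by
          refine lintegral_congr fun θ => ?_
          exact (hμ.measurePreserving_rotatePair θ).lintegral_comp hg.measurable.enorm
      _ = ENNReal.ofReal (π / 2) * ∫⁻ p, ‖g p‖ₑ ∂(μ.prod μ) := by
          rw [setLIntegral_const, Real.volume_Ioc, sub_zero, mul_comm]
  have h2 : ∫⁻ p, ‖g p‖ₑ ∂(μ.prod μ)
      ≤ ENNReal.ofReal ((s + K * (∫ x, ∑ i, G i x ^ 2 ∂μ) / s) / 2) := by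
    rw [lintegral_prod _ hg.measurable.enorm.aemeasurable]
    have inner : ∀ x, ∫⁻ y, ‖g (x, y)‖ₑ ∂μ ≤ ENNReal.ofReal ((s + K * (∑ i, G i x ^ 2) / s) / 2) := by
      intro x
      have hL : AllLp (fun y : ι → ℝ => g (x, y)) μ :=
        AllLp.sum (f := fun i (y : ι → ℝ) => G i x * y i)
          fun i _ => (hμ.allLp_eval i).const_mul _
      rw [← ofReal_integral_norm_eq_lintegral_enorm hL.integrable]
      refine ENNReal.ofReal_le_ofReal ?_
      calc ∫ y, ‖g (x, y)‖ ∂μ ≤ ∫ y, (s + g (x, y) ^ 2 / s) / 2 ∂μ := by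
            refine integral_mono hL.integrable.norm
              ((((integrable_const s).add ((hL.pow 2).integrable.div_const s))).div_const 2)
              fun y => ?_
            rw [Real.norm_eq_abs]
            have := sq_nonneg (|g (x, y)| - s)
            rw [sub_sq, sq_abs] at this
            rw [le_div_iff₀ two_pos, ← sub_nonneg]
            have e : s + g (x, y) ^ 2 / s - |g (x, y)| * 2
              = (g (x, y) ^ 2 - 2 * |g (x, y)| * s + s ^ 2) / s := by field_simp; ring
            rw [e]; positivity
        _ = (s + (∫ y, g (x, y) ^ 2 ∂μ) / s) / 2 := by
            rw [integral_div, integral_add (integrable_const _) ((hL.pow 2).integrable.div_const s),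
              integral_div]
            simp
        _ ≤ _ := by
            have := hμ.quad_le (fun i => G i x)
            gcongr
    refine (lintegral_mono inner).trans ?_
    rw [← ofReal_integral_eq_lintegral_ofReal]
    · refine ENNReal.ofReal_le_ofReal (le_of_eq ?_)
      rw [integral_div, integral_add (integrable_const _) ((hGi.const_mul _).div_const s),
        integral_div, integral_const_mul]
      simp
    · exact ((integrable_const _).add ((hGi.const_mul _).div_const s)).div_const 2
    · refine ae_of_all _ fun x => ?_
      have : 0 ≤ K * ∑ i, G i x ^ 2 :=
        le_trans (integral_nonneg fun y => sq_nonneg _) (hμ.quad_le (fun i => G i x))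
      simp only [Pi.zero_apply]
      positivity
  have hK : 0 ≤ K * ∫ x, ∑ i, G i x ^ 2 ∂μ := by
    rw [← integral_const_mul]
    exact integral_nonneg fun x =>
      le_trans (integral_nonneg fun y => sq_nonneg _) (hμ.quad_le (fun i => G i x))
  have h3 := h1.trans (mul_le_mul_right h2 _)
  have hi : Integrable (fun x => Γ x - ∫ y, Γ y ∂μ) μ := hΓ.sub (integrable_const _)
  rw [← ofReal_integral_norm_eq_lintegral_enorm hi, ← ENNReal.ofReal_mul (by positivity),
    ENNReal.ofReal_le_ofReal_iff (by positivity)] at h3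
  refine h3.trans ?_
  have hA : 0 ≤ s + K * (∫ x, ∑ i, G i x ^ 2 ∂μ) / s := by positivity
  -- The factor is `(π/2) · (1/2) = π/4 ≤ 1`.
  nlinarith [Real.pi_le_four]

end IsCorrelatedGaussian

end TorusNeedlet

/-! ### Stein's method for sums of polynomials of a Gaussian vector -/

namespace TorusNeedlet

namespace IsCorrelatedGaussian

variable {ι : Type*} [Fintype ι] {μ : Measure (ι → ℝ)} {R : ι → ι → ℝ} {K : ℝ}

theorem allLp_poly (hμ : IsCorrelatedGaussian μ R K) (p : Polynomial ℝ) (i : ι) :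
    AllLp (fun x => p.eval (x i)) μ := by
  have := hμ.gaussian
  induction p using Polynomial.induction_on' with
  | add p q hp hq => simpa only [Polynomial.eval_add] using hp.add hq
  | monomial n a =>
    simpa only [Polynomial.eval_monomial] using ((hμ.allLp_eval i).pow n).const_mul a

/-- The Stein operator `p ↦ x p - p'` of the standard Gaussian law. -/
def steinOp (p : Polynomial ℝ) : Polynomial ℝ := Polynomial.X * p - p.derivative

/-- The Stein operator is adjoint to differentiation: apply integration by parts to `p(x_k) G`; the
term with `p'` moves to the left and completes `x p - p'`. -/
theorem integral_steinOp_mul (hμ : IsCorrelatedGaussian μ R K) (p : Polynomial ℝ) (k : ι)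
    {G D : (ι → ℝ) → ℂ} (hd : ∀ x, HasDerivAt (fun s : ℝ => G (x + s • R k)) (D x) 0)
    (hG : AllLp G μ) (hD : AllLp D μ) :
    ∫ x, (((steinOp p).eval (x k) : ℝ) : ℂ) * G x ∂μ = ∫ x, ((p.eval (x k) : ℝ) : ℂ) * D x ∂μ := by
  have := hμ.gaussian
  have hp := (hμ.allLp_poly p k).ofReal
  have hp' := (hμ.allLp_poly p.derivative k).ofReal
  have hx := (hμ.allLp_eval k).ofReal
  have h := hμ.integral_mul_eval k (Φ := fun x => ((p.eval (x k) : ℝ) : ℂ) * G x)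
    (D := fun x => ((p.derivative.eval (x k) : ℝ) : ℂ) * G x + ((p.eval (x k) : ℝ) : ℂ) * D x)
    (fun x => by
      have h1 : HasDerivAt (fun s : ℝ => x k + s * R k k) 1 0 := by
        have := ((hasDerivAt_id (0 : ℝ)).mul_const (R k k)).const_add (x k)
        rw [hμ.diag, mul_one] at this
        rw [hμ.diag]
        exact this
      have h2 := (HasDerivAt.comp (0 : ℝ) (by simpa using p.hasDerivAt (x k)) h1).ofReal_comp
      have h3 := h2.mul (hd x)
      refine (h3.congr_deriv ?_)
      simp)
    (hp.mul hG).integrable (hx.mul (hp.mul hG)).integrable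
    ((hp'.mul hG).add (hp.mul hD)).integrable
  rw [integral_add (hp'.mul hG).integrable (hp.mul hD).integrable] at h
  rw [← sub_eq_iff_eq_add', ← integral_sub (hx.mul (hp.mul hG)).integrable
    (hp'.mul hG).integrable] at h
  rw [← h]
  congr 1; ext x
  simp only [steinOp, Polynomial.eval_sub, Polynomial.eval_mul, Polynomial.eval_X]
  push_cast; ring

omit [Fintype ι] in
theorem hasDerivAt_eval_line (q : Polynomial ℝ) (x r : ι → ℝ) (j : ι) :
    HasDerivAt (fun s : ℝ => q.eval ((x + s • r) j)) (q.derivative.eval (x j) * r j) 0 := by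
  have h1 : HasDerivAt (fun s : ℝ => (x + s • r) j) (r j) 0 := by
    simpa using! ((hasDerivAt_id (0 : ℝ)).mul_const (r j)).const_add (x j)
  have h2 := (q.hasDerivAt ((x + (0 : ℝ) • r) j)).comp (0 : ℝ) h1
  simpa using! h2

theorem integral_steinOp_mul_eval (hμ : IsCorrelatedGaussian μ R K) (p q : Polynomial ℝ) (k j : ι) :
    ∫ x, (steinOp p).eval (x k) * q.eval (x j) ∂μ
      = R k j * ∫ x, p.eval (x k) * q.derivative.eval (x j) ∂μ := by
  have := hμ.gaussian
  have h := hμ.integral_steinOp_mul p k (G := fun x => ((q.eval (x j) : ℝ) : ℂ))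
    (D := fun x => ((q.derivative.eval (x j) * R k j : ℝ) : ℂ))
    (fun x => (hasDerivAt_eval_line q x (R k) j).ofReal_comp)
    (hμ.allLp_poly q j).ofReal
    ((hμ.allLp_poly q.derivative j).mul (AllLp.const (R k j))).ofReal
  simp only [← Complex.ofReal_mul, integral_complex_ofReal] at h
  rw [Complex.ofReal_inj.1 h, ← integral_const_mul]
  congr 1; ext x; ring

/-- The normalised sum `N^(-1/2) ∑ f(x_k)`. -/
def normSum (f : Polynomial ℝ) (x : ι → ℝ) : ℝ :=
  (√(Fintype.card ι))⁻¹ * ∑ k, f.eval (x k)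

/-- The carré du champ of `normSum (steinOp p)` and of its image under the inverse generator. -/
def carre (R : ι → ι → ℝ) (p q : Polynomial ℝ) (x : ι → ℝ) : ℝ :=
  (Fintype.card ι : ℝ)⁻¹ * ∑ k, ∑ j, R k j * (p.eval (x k) * q.eval (x j))

theorem hasDerivAt_normSum_line (f : Polynomial ℝ) (x r : ι → ℝ) :
    HasDerivAt (fun s : ℝ => normSum f (x + s • r))
      ((√(Fintype.card ι))⁻¹ * ∑ j, f.derivative.eval (x j) * r j) 0 := by
  unfold normSum
  exact (HasDerivAt.fun_sum fun j _ => hasDerivAt_eval_line f x r j).const_mul _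

theorem allLp_normSum (hμ : IsCorrelatedGaussian μ R K) (f : Polynomial ℝ) :
    AllLp (normSum f) μ := by
  have := hμ.gaussian
  exact (AllLp.sum fun k _ => hμ.allLp_poly f k).const_mul _

theorem allLp_carre (hμ : IsCorrelatedGaussian μ R K) (p q : Polynomial ℝ) :
    AllLp (carre R p q) μ := by
  have := hμ.gaussian
  exact (AllLp.sum fun k _ => AllLp.sum fun j _ =>
    ((hμ.allLp_poly p k).mul (hμ.allLp_poly q j)).const_mul _).const_mul _

/-- For `F = normSum (steinOp p)` and `G` with gradient `H ∇F`, each summand of `F` is integrated by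
parts, and the resulting double sum is `carre` times `H`. It is used with `G = F` for the variance
and with `G = exp(itF)` for the characteristic function. -/
theorem integral_normSum_mul (hμ : IsCorrelatedGaussian μ R K) (p : Polynomial ℝ)
    {G H : (ι → ℝ) → ℂ} (hd : ∀ x r : ι → ℝ, HasDerivAt (fun s : ℝ => G (x + s • r))
      (H x * (((√(Fintype.card ι))⁻¹ * ∑ j, (steinOp p).derivative.eval (x j) * r j : ℝ) : ℂ)) 0)
    (hG : AllLp G μ) (hH : AllLp H μ) :
    ∫ x, (normSum (steinOp p) x : ℂ) * G x ∂μ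
      = ∫ x, (carre R p (steinOp p).derivative x : ℂ) * H x ∂μ := by
  have := hμ.gaussian
  set f := steinOp p
  set c : ℝ := (√(Fintype.card ι))⁻¹ with hc
  have hD : ∀ k, AllLp (fun x => H x *
      ((c * ∑ j, f.derivative.eval (x j) * R k j : ℝ) : ℂ)) μ := fun k =>
    hH.mul (((AllLp.sum fun j _ =>
      (hμ.allLp_poly f.derivative j).mul (AllLp.const _)).const_mul c).ofReal)
  have e1 : ∀ x, (normSum f x : ℂ) * G x = ∑ k, (c : ℂ) * (((f.eval (x k) : ℝ) : ℂ) * G x) := by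
    intro x
    simp only [normSum, ← hc]
    push_cast
    rw [Finset.mul_sum, Finset.sum_mul]
    exact Finset.sum_congr rfl fun k _ => by ring
  have e2 : ∀ x, (carre R p f.derivative x : ℂ) * H x = ∑ k, (c : ℂ) * (((p.eval (x k) : ℝ) : ℂ) *
      (H x * ((c * ∑ j, f.derivative.eval (x j) * R k j : ℝ) : ℂ))) := by
    intro x
    have hcc : ((Fintype.card ι : ℝ))⁻¹ = c * c := by
      rw [hc, ← mul_inv, Real.mul_self_sqrt (Nat.cast_nonneg _)]
    simp only [carre, hcc]
    push_cast
    simp only [Finset.mul_sum, Finset.sum_mul]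
    exact Finset.sum_congr rfl fun k _ => Finset.sum_congr rfl fun j _ => by ring
  simp_rw [e1, e2]
  rw [integral_finsetSum _ fun k _ =>
      (((hμ.allLp_poly f k).ofReal.mul hG).const_mul (c : ℂ)).integrable,
    integral_finsetSum _ fun k _ =>
      (((hμ.allLp_poly p k).ofReal.mul (hD k)).const_mul (c : ℂ)).integrable]
  refine Finset.sum_congr rfl fun k _ => ?_
  rw [integral_const_mul, integral_const_mul,
    hμ.integral_steinOp_mul p k (fun x => hd x (R k)) hG (hD k)]

theorem integral_carre (hμ : IsCorrelatedGaussian μ R K) (p : Polynomial ℝ) :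
    ∫ x, carre R p (steinOp p).derivative x ∂μ = ∫ x, normSum (steinOp p) x ^ 2 ∂μ := by
  have := hμ.gaussian
  have h := hμ.integral_normSum_mul p (G := fun x => (normSum (steinOp p) x : ℂ))
    (H := fun _ => 1) (fun x r => by
      rw [one_mul]; exact (hasDerivAt_normSum_line (steinOp p) x r).ofReal_comp)
    (hμ.allLp_normSum _).ofReal (AllLp.const 1)
  simp only [← Complex.ofReal_mul, integral_complex_ofReal, mul_one] at h
  rw [← Complex.ofReal_inj.1 h]
  simp only [sq]

/-- The characteristic function of `normSum (steinOp p)`, up to the fluctuations of `carre`. -/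
theorem norm_integral_exp_sub_le (hμ : IsCorrelatedGaussian μ R K) (p : Polynomial ℝ) {V δ : ℝ}
    (hV : ∫ x, normSum (steinOp p) x ^ 2 ∂μ = V)
    (hδ : ∫ x, |carre R p (steinOp p).derivative x - V| ∂μ ≤ δ) :
    ‖∫ x, Complex.exp (Complex.I * normSum (steinOp p) x) ∂μ - Complex.exp ((-(V / 2) : ℝ) : ℂ)‖ ≤ δ := by
  have := hμ.gaussian
  set F := normSum (ι := ι) (steinOp p)
  set Γ := carre R p (steinOp p).derivative
  have hF : AllLp F μ := hμ.allLp_normSum _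
  have hΓ : AllLp Γ μ := hμ.allLp_carre _ _
  have hV0 : 0 ≤ V := hV ▸ integral_nonneg fun x => sq_nonneg _
  have hδ0 : 0 ≤ δ := (integral_nonneg fun x => abs_nonneg _).trans hδ
  let E : ℝ → (ι → ℝ) → ℂ := fun t x => Complex.exp (Complex.I * (t * F x : ℝ))
  have hEn : ∀ t x, ‖E t x‖ = 1 := fun t x => by
    simp only [E, mul_comm Complex.I]; exact Complex.norm_exp_ofReal_mul_I _
  have hEm : ∀ t, AEStronglyMeasurable (E t) μ := fun t => by
    have : Measurable (fun y : ℝ => Complex.exp (Complex.I * (t * y : ℝ))) := by fun_prop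
    exact (this.comp_aemeasurable hF.aestronglyMeasurable.aemeasurable).aestronglyMeasurable
  have hE : ∀ t, AllLp (E t) μ := fun t => AllLp.of_bounded (hEm t) 1 fun x => (hEn t x).le
  let φ : ℝ → ℂ := fun t => ∫ x, E t x ∂μ
  have hφ : ∀ t, HasDerivAt φ (∫ x, Complex.I * (F x : ℂ) * E t x ∂μ) t := by
    intro t
    refine (hasDerivAt_integral_of_dominated_loc_of_deriv_le (μ := μ) (𝕜 := ℝ) (F := E)
      (F' := fun t x => Complex.I * (F x : ℂ) * E t x) (x₀ := t) (s := Set.univ)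
      (bound := fun x => |F x|) Filter.univ_mem (Eventually.of_forall hEm) (hE t).integrable
      (((AllLp.const Complex.I).mul hF.ofReal).mul (hE t)).aestronglyMeasurable ?_
      hF.abs.integrable ?_).2
    · refine ae_of_all _ fun x s _ => ?_
      rw [norm_mul, hEn, mul_one, norm_mul, Complex.norm_I, one_mul, Complex.norm_real,
        Real.norm_eq_abs]
    · refine ae_of_all _ fun x s _ => ?_
      have h1 : HasDerivAt (fun s : ℝ => Complex.I * (s * F x : ℝ)) (Complex.I * (F x : ℂ)) s := by
        simpa using! (((hasDerivAt_id s).mul_const (F x)).ofReal_comp).const_mul Complex.I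
      refine h1.cexp.congr_deriv ?_
      simp only [E]; ring
  -- Integration by parts turns the derivative of the characteristic function into `-t E[Γ
  -- exp(itF)]`; with `Γ` replaced by `V` this would be the equation solved by `exp(-t²V/2)`.
  have hstein : ∀ t : ℝ, ∫ x, Complex.I * (F x : ℂ) * E t x ∂μ
      = -(t : ℂ) * ∫ x, (Γ x : ℂ) * E t x ∂μ := by
    intro t
    have h := hμ.integral_normSum_mul p (G := E t) (H := fun x => Complex.I * t * E t x)
      (fun x r => by
        have h1 := ((hasDerivAt_normSum_line (steinOp p) x r).const_mul t).ofReal_comp.const_mul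
          Complex.I
        refine h1.cexp.congr_deriv ?_
        simp only [E, zero_smul, add_zero, F]
        push_cast
        ring) (hE t) ((hE t).const_mul _)
    simp_rw [mul_assoc Complex.I]
    rw [integral_const_mul, h, ← integral_const_mul, ← integral_const_mul]
    congr 1; ext x
    linear_combination ((t : ℂ) * (Γ x : ℂ) * E t x) * Complex.I_mul_I
  -- The integrating factor leaves only `Γ - V` in the derivative, which is then at most `δ
  -- exp(V/2)` on `[0, 1]`. The value at `t = 1` suffices, as the frequency can be absorbed into
  -- `p`.
  let ψ : ℝ → ℂ := fun t => φ t * Complex.exp ((t ^ 2 * V / 2 : ℝ) : ℂ)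
  have hψ : ∀ t : ℝ, HasDerivAt ψ ((-(t : ℂ) * ∫ x, ((Γ x - V : ℝ) : ℂ) * E t x ∂μ) *
      Complex.exp ((t ^ 2 * V / 2 : ℝ) : ℂ)) t := by
    intro t
    have h1 : HasDerivAt (fun t : ℝ => ((t ^ 2 * V / 2 : ℝ) : ℂ)) ((t * V : ℝ) : ℂ) t := by
      have := (((hasDerivAt_id t).pow 2).mul_const V).div_const 2
      refine HasDerivAt.ofReal_comp (this.congr_deriv ?_)
      simp; ring
    refine ((hφ t).mul h1.cexp).congr_deriv ?_
    rw [hstein]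
    have : ∫ x, ((Γ x - V : ℝ) : ℂ) * E t x ∂μ = ∫ x, (Γ x : ℂ) * E t x ∂μ - V * φ t := by
      simp only [φ]
      rw [← integral_const_mul, ← integral_sub (hΓ.ofReal.mul (hE t)).integrable
        ((hE t).const_mul _).integrable]
      congr 1; ext x; push_cast; ring
    rw [this]
    push_cast
    ring
  have hbound := norm_image_sub_le_of_norm_deriv_le_segment_01' (f := ψ) (C := δ * Real.exp (V / 2))
    (fun t _ => (hψ t).hasDerivWithinAt) (fun t ht => by
      rw [norm_mul, norm_mul, norm_neg, Complex.norm_real, ← Complex.ofReal_exp, Complex.norm_real,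
        Real.norm_eq_abs, Real.norm_eq_abs, Real.abs_exp, abs_of_nonneg ht.1]
      have h2 : ‖∫ x, ((Γ x - V : ℝ) : ℂ) * E t x ∂μ‖ ≤ δ := by
        refine (norm_integral_le_integral_norm _).trans (le_trans (le_of_eq ?_) hδ)
        congr 1; ext x
        rw [norm_mul, hEn, mul_one, Complex.norm_real, Real.norm_eq_abs]
      have h3 : t * ‖∫ x, ((Γ x - V : ℝ) : ℂ) * E t x ∂μ‖ ≤ δ := by
        nlinarith [norm_nonneg (∫ x, ((Γ x - V : ℝ) : ℂ) * E t x ∂μ), ht.1, ht.2]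
      refine mul_le_mul h3 (Real.exp_le_exp.2 ?_) (Real.exp_nonneg _) hδ0
      have : t ^ 2 ≤ 1 := by nlinarith [ht.1, ht.2]
      nlinarith)
  have e0 : ψ 0 = 1 := by simp [ψ, φ, E]
  have e1 : ψ 1 = (∫ x, Complex.exp (Complex.I * F x) ∂μ) * Complex.exp ((V / 2 : ℝ) : ℂ) := by
    simp [ψ, φ, E]
  have hfin : ∫ x, Complex.exp (Complex.I * F x) ∂μ - Complex.exp ((-(V / 2) : ℝ) : ℂ)
      = (ψ 1 - ψ 0) * Complex.exp ((-(V / 2) : ℝ) : ℂ) := by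
    rw [e0, e1, sub_mul, mul_assoc, ← Complex.exp_add]
    simp
  rw [hfin, norm_mul, ← Complex.ofReal_exp, Complex.norm_real,
    Real.norm_eq_abs, Real.abs_exp]
  calc ‖ψ 1 - ψ 0‖ * Real.exp (-(V / 2)) ≤ δ * Real.exp (V / 2) * Real.exp (-(V / 2)) := by gcongr
    _ = δ := by rw [mul_assoc, ← Real.exp_add]; simp

/-- A bound on the quadratic form of `R` bounds its operator norm. With `v = R y`, `|v|²` is the
expectation of `⟨v, x⟩⟨y, x⟩`; splitting this product with weight `K` lets half of `|v|²` be
absorbed on the left. -/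
theorem sum_sq_corr_le (hμ : IsCorrelatedGaussian μ R K) (hK : 0 < K) (y : ι → ℝ) :
    ∑ i, (∑ j, R i j * y j) ^ 2 ≤ K ^ 2 * ∑ j, y j ^ 2 := by
  have := hμ.gaussian
  set v : ι → ℝ := fun i => ∑ j, R i j * y j with hv
  have hL : ∀ z : ι → ℝ, AllLp (fun x : ι → ℝ => ∑ i, z i * x i) μ := fun z =>
    AllLp.sum fun i _ => (hμ.allLp_eval i).const_mul _
  have e : ∑ i, v i ^ 2 = ∫ x, (∑ i, v i * x i) * (∑ j, y j * x j) ∂μ := by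
    have h1 : ∀ x : ι → ℝ, (∑ i, v i * x i) * (∑ j, y j * x j)
        = ∑ i, ∑ j, (v i * y j) * (x i * x j) := fun x => by
      rw [Finset.sum_mul_sum]
      exact Finset.sum_congr rfl fun i _ => Finset.sum_congr rfl fun j _ => by ring
    have hint : ∀ i j, AllLp (fun x : ι → ℝ => (v i * y j) * (x i * x j)) μ := fun i j =>
      ((hμ.allLp_eval i).mul (hμ.allLp_eval j)).const_mul _
    simp_rw [h1]
    rw [integral_finsetSum _ fun i _ => (AllLp.sum fun j _ => hint i j).integrable]
    refine Finset.sum_congr rfl fun i _ => ?_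
    rw [integral_finsetSum _ fun j _ => (hint i j).integrable]
    simp_rw [integral_const_mul, hμ.cov]
    rw [sq]
    conv_lhs => rw [hv]
    simp only []
    rw [Finset.sum_mul]
    refine Finset.sum_congr rfl fun j _ => ?_
    simp only [hv]; ring
  have h2 : ∑ i, v i ^ 2 ≤ (K * ∑ i, v i ^ 2) / (2 * K) + K / 2 * (K * ∑ j, y j ^ 2) := by
    calc ∑ i, v i ^ 2 = ∫ x, (∑ i, v i * x i) * (∑ j, y j * x j) ∂μ := e
      _ ≤ ∫ x, ((∑ i, v i * x i) ^ 2 / (2 * K) + K / 2 * (∑ j, y j * x j) ^ 2) ∂μ := by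
          refine integral_mono ((hL v).mul (hL y)).integrable
            ((((hL v).pow 2).integrable.div_const _).add (((hL y).pow 2).integrable.const_mul _))
            fun x => ?_
          simp only []
          rw [← sub_nonneg]
          have e2 : ∀ a b : ℝ, a ^ 2 / (2 * K) + K / 2 * b ^ 2 - a * b
              = (a - K * b) ^ 2 / (2 * K) := fun a b => by field_simp; ring
          rw [e2]; positivity
      _ = (∫ x, (∑ i, v i * x i) ^ 2 ∂μ) / (2 * K) + K / 2 * ∫ x, (∑ j, y j * x j) ^ 2 ∂μ := by
          rw [integral_add (((hL v).pow 2).integrable.div_const _)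
            (((hL y).pow 2).integrable.const_mul _), integral_div, integral_const_mul]
      _ ≤ _ := by
          have a1 := hμ.quad_le v
          have a2 := hμ.quad_le y
          gcongr
  have e3 : (K * ∑ i, v i ^ 2) / (2 * K) = (∑ i, v i ^ 2) / 2 := by field_simp
  rw [e3] at h2
  linarith

/-- The gradient of `carre R p q`. -/
def carreGrad (R : ι → ι → ℝ) (p q : Polynomial ℝ) (i : ι) (x : ι → ℝ) : ℝ :=
  (Fintype.card ι : ℝ)⁻¹ * (p.derivative.eval (x i) * ∑ j, R i j * q.eval (x j) +
    q.derivative.eval (x i) * ∑ k, R i k * p.eval (x k))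

theorem hasFDerivAt_carre (hμ : IsCorrelatedGaussian μ R K) (p q : Polynomial ℝ) (x : ι → ℝ) :
    HasFDerivAt (carre R p q) (∑ i, carreGrad R p q i x •
      (ContinuousLinearMap.proj i : (ι → ℝ) →L[ℝ] ℝ)) x := by
  have h1 : ∀ (p : Polynomial ℝ) (k : ι), HasFDerivAt (fun x : ι → ℝ => p.eval (x k))
      (p.derivative.eval (x k) • (ContinuousLinearMap.proj k : (ι → ℝ) →L[ℝ] ℝ)) x := fun p k =>
    (p.hasDerivAt (x k)).comp_hasFDerivAt (f := fun x : ι → ℝ => x k) x (hasFDerivAt_apply k x)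
  have h2 := (HasFDerivAt.fun_sum (u := Finset.univ) fun k _ => HasFDerivAt.fun_sum
    (u := Finset.univ) fun j _ => ((h1 p k).mul (h1 q j)).const_mul (R k j)).const_mul
      (Fintype.card ι : ℝ)⁻¹
  refine h2.congr_fderiv ?_
  ext v
  simp only [smul_apply, sum_apply, add_apply, ContinuousLinearMap.proj_apply, smul_eq_mul,
    carreGrad]
  have e1 : ∑ k, ∑ j, R k j * (p.eval (x k) * (q.derivative.eval (x j) * v j) +
      q.eval (x j) * (p.derivative.eval (x k) * v k))
      = ∑ i, (p.derivative.eval (x i) * ∑ j, R i j * q.eval (x j) +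
        q.derivative.eval (x i) * ∑ k, R i k * p.eval (x k)) * v i := by
    simp only [mul_add, add_mul, Finset.sum_add_distrib]
    rw [add_comm]
    congr 1
    · refine Finset.sum_congr rfl fun i _ => ?_
      simp only [Finset.mul_sum, Finset.sum_mul]
      exact Finset.sum_congr rfl fun j _ => by ring
    · rw [Finset.sum_comm]
      refine Finset.sum_congr rfl fun i _ => ?_
      simp only [Finset.mul_sum, Finset.sum_mul]
      exact Finset.sum_congr rfl fun j _ => by rw [hμ.symm i j]; ring
  rw [e1, Finset.mul_sum]
  exact Finset.sum_congr rfl fun i _ => by ring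

theorem integral_eval_pow (hμ : IsCorrelatedGaussian μ R K) (p : Polynomial ℝ) (i : ι) (n : ℕ) :
    ∫ x, p.eval (x i) ^ n ∂μ = ∫ t, p.eval t ^ n ∂gaussianReal 0 1 := by
  rw [← hμ.map_eval i, integral_map (measurable_pi_apply i).aemeasurable (by fun_prop)]

/-- With `z = R q(x)`, use `(p z)² ≤ (p⁴/s + s z⁴)/2` and `∑ z_i⁴ ≤ (∑ z_i²)² ≤ K⁴ (∑ q²)² ≤ K⁴ N ∑
q⁴`. Only one-dimensional fourth moments remain; the price is the factor `N²` in the second term, to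
be balanced by `s`. -/
theorem integral_sum_sq_mul_sq_corr_le (hμ : IsCorrelatedGaussian μ R K) (hK : 0 < K)
    (p q : Polynomial ℝ) {A : ℝ} (hp : ∫ t, p.eval t ^ 4 ∂gaussianReal 0 1 ≤ A)
    (hq : ∫ t, q.eval t ^ 4 ∂gaussianReal 0 1 ≤ A) {s : ℝ} (hs : 0 < s) :
    ∫ x, ∑ i, (p.eval (x i) * ∑ j, R i j * q.eval (x j)) ^ 2 ∂μ
      ≤ (Fintype.card ι * A / s + s * K ^ 4 * (Fintype.card ι) ^ 2 * A) / 2 := by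
  have := hμ.gaussian
  set N := (Fintype.card ι : ℝ)
  have hP : AllLp (fun x : ι → ℝ => ∑ i, p.eval (x i) ^ 4) μ :=
    AllLp.sum fun i _ => (hμ.allLp_poly p i).pow 4
  have hQ : AllLp (fun x : ι → ℝ => ∑ i, q.eval (x i) ^ 4) μ :=
    AllLp.sum fun i _ => (hμ.allLp_poly q i).pow 4
  have hPi : ∫ x, ∑ i, p.eval (x i) ^ 4 ∂μ ≤ N * A := by
    rw [integral_finsetSum _ fun i _ => ((hμ.allLp_poly p i).pow 4).integrable]
    simp_rw [hμ.integral_eval_pow]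
    rw [Finset.sum_const, nsmul_eq_mul, Finset.card_univ]
    gcongr
  have hQi : ∫ x, ∑ i, q.eval (x i) ^ 4 ∂μ ≤ N * A := by
    rw [integral_finsetSum _ fun i _ => ((hμ.allLp_poly q i).pow 4).integrable]
    simp_rw [hμ.integral_eval_pow]
    rw [Finset.sum_const, nsmul_eq_mul, Finset.card_univ]
    gcongr
  have hR : AllLp (fun x : ι → ℝ => ∑ i, (p.eval (x i) * ∑ j, R i j * q.eval (x j)) ^ 2) μ :=
    AllLp.sum fun i _ => ((hμ.allLp_poly p i).mul (AllLp.sum fun j _ =>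
      (hμ.allLp_poly q j).const_mul _)).pow 2
  calc ∫ x, ∑ i, (p.eval (x i) * ∑ j, R i j * q.eval (x j)) ^ 2 ∂μ
      ≤ ∫ x, ((∑ i, p.eval (x i) ^ 4) / s + s * K ^ 4 * N * ∑ i, q.eval (x i) ^ 4) / 2 ∂μ := by
        refine integral_mono hR.integrable (((hP.integrable.div_const s).add
          (hQ.integrable.const_mul _)).div_const 2) fun x => ?_
        set z : ι → ℝ := fun i => ∑ j, R i j * q.eval (x j)
        have h1 : ∀ i, (p.eval (x i) * z i) ^ 2 ≤ (p.eval (x i) ^ 4 / s + s * (z i ^ 2) ^ 2) / 2 := by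
          intro i
          rw [← sub_nonneg]
          have e : (p.eval (x i) ^ 4 / s + s * (z i ^ 2) ^ 2) / 2 - (p.eval (x i) * z i) ^ 2
              = (p.eval (x i) ^ 2 - s * z i ^ 2) ^ 2 / (2 * s) := by field_simp; ring
          rw [e]; positivity
        have h2 : ∑ i, (z i ^ 2) ^ 2 ≤ (∑ i, z i ^ 2) ^ 2 :=
          Finset.sum_sq_le_sq_sum_of_nonneg fun i _ => sq_nonneg _
        have h3 : (∑ i, z i ^ 2) ^ 2 ≤ (K ^ 2 * ∑ j, q.eval (x j) ^ 2) ^ 2 := by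
          have := hμ.sum_sq_corr_le hK (fun j => q.eval (x j))
          have h0 : 0 ≤ ∑ i, z i ^ 2 := Finset.sum_nonneg fun i _ => sq_nonneg _
          gcongr
        have h4 : (∑ j, q.eval (x j) ^ 2) ^ 2 ≤ N * ∑ j, q.eval (x j) ^ 4 := by
          have := sq_sum_le_card_mul_sum_sq (s := Finset.univ) (f := fun j => q.eval (x j) ^ 2)
          simpa only [← pow_mul, Finset.card_univ] using! this
        calc ∑ i, (p.eval (x i) * z i) ^ 2
            ≤ ∑ i, (p.eval (x i) ^ 4 / s + s * (z i ^ 2) ^ 2) / 2 := Finset.sum_le_sum fun i _ => h1 i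
          _ = ((∑ i, p.eval (x i) ^ 4) / s + s * ∑ i, (z i ^ 2) ^ 2) / 2 := by
              rw [← Finset.sum_div, Finset.sum_add_distrib, ← Finset.sum_div, ← Finset.mul_sum]
          _ ≤ ((∑ i, p.eval (x i) ^ 4) / s + s * (K ^ 4 * (N * ∑ j, q.eval (x j) ^ 4))) / 2 := by
              have h5 : ∑ i, (z i ^ 2) ^ 2 ≤ K ^ 4 * (N * ∑ j, q.eval (x j) ^ 4) := by
                calc _ ≤ (K ^ 2 * ∑ j, q.eval (x j) ^ 2) ^ 2 := h2.trans h3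
                  _ = K ^ 4 * (∑ j, q.eval (x j) ^ 2) ^ 2 := by ring
                  _ ≤ _ := by gcongr
              gcongr
          _ = _ := by ring
    _ = ((∫ x, ∑ i, p.eval (x i) ^ 4 ∂μ) / s
        + s * K ^ 4 * N * ∫ x, ∑ i, q.eval (x i) ^ 4 ∂μ) / 2 := by
        rw [integral_div, integral_add (hP.integrable.div_const s) (hQ.integrable.const_mul _),
          integral_div, integral_const_mul]
    _ ≤ (N * A / s + s * K ^ 4 * N * (N * A)) / 2 := by gcongr
    _ = _ := by ring

/-- With `r = N^(1/4)`, the choice `s = r^(-2)` in the preceding bound makes the mean squared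
gradient of `carre` of order `r^(-2)`, and `s = 1/r` in the Poincaré inequality then gives the rate
`1/r`. -/
theorem integral_abs_carre_sub_le [Nonempty ι] (hμ : IsCorrelatedGaussian μ R K) (hK : 0 < K)
    (p q : Polynomial ℝ) {A : ℝ} (hp : ∫ t, p.eval t ^ 4 ∂gaussianReal 0 1 ≤ A)
    (hp' : ∫ t, p.derivative.eval t ^ 4 ∂gaussianReal 0 1 ≤ A)
    (hq : ∫ t, q.eval t ^ 4 ∂gaussianReal 0 1 ≤ A)
    (hq' : ∫ t, q.derivative.eval t ^ 4 ∂gaussianReal 0 1 ≤ A) :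
    ∫ x, |carre R p q x - ∫ y, carre R p q y ∂μ| ∂μ
      ≤ (1 + 2 * K * A * (1 + K ^ 4)) / √√(Fintype.card ι) := by
  have := hμ.gaussian
  set N := (Fintype.card ι : ℝ)
  have hN : 0 < N := by simp only [N]; positivity
  set r := √√N with hr
  have hr0 : 0 < r := by positivity
  have hrN : r ^ 4 = N := by
    rw [hr, show 4 = 2 * 2 from rfl, pow_mul, Real.sq_sqrt (Real.sqrt_nonneg _),
      Real.sq_sqrt hN.le]
  have hG : ∀ i, AllLp (carreGrad R p q i) μ := fun i =>
    (((hμ.allLp_poly p.derivative i).mul (AllLp.sum fun j _ =>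
      (hμ.allLp_poly q j).const_mul _)).add ((hμ.allLp_poly q.derivative i).mul
        (AllLp.sum fun j _ => (hμ.allLp_poly p j).const_mul _))).const_mul _
  have hGs : AllLp (fun x => ∑ i, carreGrad R p q i x ^ 2) μ :=
    AllLp.sum fun i _ => (hG i).pow 2
  refine (hμ.integral_abs_sub_integral_le (hμ.hasFDerivAt_carre p q)
    (fun i => by unfold carreGrad; fun_prop) (hμ.allLp_carre p q).integrable
    hGs.integrable (s := 1 / r) (by positivity)).trans ?_
  have b1 := hμ.integral_sum_sq_mul_sq_corr_le hK p.derivative q hp' hq (s := 1 / r ^ 2)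
    (by positivity)
  have b2 := hμ.integral_sum_sq_mul_sq_corr_le hK q.derivative p hq' hp (s := 1 / r ^ 2)
    (by positivity)
  have hP : ∀ p q : Polynomial ℝ,
      AllLp (fun x : ι → ℝ => ∑ i, (p.eval (x i) * ∑ j, R i j * q.eval (x j)) ^ 2) μ := fun p q =>
    AllLp.sum fun i _ => ((hμ.allLp_poly p i).mul (AllLp.sum fun j _ =>
      (hμ.allLp_poly q j).const_mul _)).pow 2
  have b3 : ∫ x, ∑ i, carreGrad R p q i x ^ 2 ∂μ ≤ 2 * A * (1 + K ^ 4) / r ^ 2 := by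
    calc ∫ x, ∑ i, carreGrad R p q i x ^ 2 ∂μ
        ≤ ∫ x, 2 / N ^ 2 * (∑ i, (p.derivative.eval (x i) * ∑ j, R i j * q.eval (x j)) ^ 2
          + ∑ i, (q.derivative.eval (x i) * ∑ j, R i j * p.eval (x j)) ^ 2) ∂μ := by
          refine integral_mono hGs.integrable (((hP _ _).integrable.add
            (hP _ _).integrable).const_mul _) fun x => ?_
          simp only []
          rw [← Finset.sum_add_distrib, Finset.mul_sum]
          refine Finset.sum_le_sum fun i _ => ?_
          unfold carreGrad
          rw [mul_pow, show 2 / N ^ 2 = N⁻¹ ^ 2 * 2 by field_simp, mul_assoc]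
          refine mul_le_mul_of_nonneg_left ?_ (sq_nonneg _)
          exact add_sq_le
      _ = 2 / N ^ 2 * (∫ x, ∑ i, (p.derivative.eval (x i) * ∑ j, R i j * q.eval (x j)) ^ 2 ∂μ
          + ∫ x, ∑ i, (q.derivative.eval (x i) * ∑ j, R i j * p.eval (x j)) ^ 2 ∂μ) := by
          rw [integral_const_mul, integral_add (hP _ _).integrable (hP _ _).integrable]
      _ ≤ 2 / N ^ 2 * ((N * A / (1 / r ^ 2) + 1 / r ^ 2 * K ^ 4 * N ^ 2 * A) / 2
          + (N * A / (1 / r ^ 2) + 1 / r ^ 2 * K ^ 4 * N ^ 2 * A) / 2) := by gcongr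
      _ = _ := by
          rw [← hrN]; field_simp; ring
  calc 1 / r + K * (∫ x, ∑ i, carreGrad R p q i x ^ 2 ∂μ) / (1 / r)
      ≤ 1 / r + K * (2 * A * (1 + K ^ 4) / r ^ 2) / (1 / r) := by gcongr
    _ = _ := by field_simp

/-- A quantitative central limit theorem for sums of polynomials of a stationary Gaussian vector. -/
theorem norm_charFun_normSum_sub_le [Nonempty ι] (hμ : IsCorrelatedGaussian μ R K) (hK : 0 < K)
    (p : Polynomial ℝ) {A : ℝ} (hp : ∫ t, p.eval t ^ 4 ∂gaussianReal 0 1 ≤ A)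
    (hp' : ∫ t, p.derivative.eval t ^ 4 ∂gaussianReal 0 1 ≤ A)
    (hq : ∫ t, (steinOp p).derivative.eval t ^ 4 ∂gaussianReal 0 1 ≤ A)
    (hq' : ∫ t, (steinOp p).derivative.derivative.eval t ^ 4 ∂gaussianReal 0 1 ≤ A) :
    ‖∫ x, Complex.exp (Complex.I * normSum (steinOp p) x) ∂μ
      - Complex.exp ((-((∫ x, normSum (steinOp p) x ^ 2 ∂μ) / 2) : ℝ) : ℂ)‖
      ≤ (1 + 2 * K * A * (1 + K ^ 4)) / √√(Fintype.card ι) := by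
  refine hμ.norm_integral_exp_sub_le p rfl ?_
  rw [← hμ.integral_carre]
  exact hμ.integral_abs_carre_sub_le hK p _ hp hp' hq hq'

end IsCorrelatedGaussian

end TorusNeedlet

/-! ### The cubic and quartic statistics of a Gaussian vector -/

namespace TorusNeedlet

namespace IsCorrelatedGaussian

variable {ι : Type*} [Fintype ι] {μ : Measure (ι → ℝ)} {R : ι → ι → ℝ} {K : ℝ}

open Polynomial in
/-- `x² - 1`, which the Stein operator maps to `x³ - 3x`. -/
def skewPoly : ℝ[X] := X ^ 2 - 1

open Polynomial in
/-- `x³ + 3x`, which the Stein operator maps to `x⁴ - 3`. -/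
def kurtPoly : ℝ[X] := X ^ 3 + 3 * X

theorem steinOp_add (p q : Polynomial ℝ) : steinOp (p + q) = steinOp p + steinOp q := by
  simp only [steinOp, Polynomial.derivative_add]; ring

theorem steinOp_C_mul (c : ℝ) (p : Polynomial ℝ) :
    steinOp (Polynomial.C c * p) = Polynomial.C c * steinOp p := by
  simp only [steinOp, Polynomial.derivative_C_mul]; ring

theorem eval_steinOp_skewPoly (x : ℝ) : (steinOp skewPoly).eval x = x ^ 3 - 3 * x := by
  simp [steinOp, skewPoly]; ring

theorem eval_steinOp_kurtPoly (x : ℝ) : (steinOp kurtPoly).eval x = x ^ 4 - 3 := by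
  simp [steinOp, kurtPoly]; ring

/-- `x³ - 3x` is the third Hermite polynomial, the Stein operator applied three times to `1`, so
three integrations by parts each produce a factor `R k j`. -/
theorem integral_steinOp_skewPoly_mul (hμ : IsCorrelatedGaussian μ R K) (k j : ι)
    (q : Polynomial ℝ) :
    ∫ x, (steinOp skewPoly).eval (x k) * q.eval (x j) ∂μ
      = R k j ^ 3 * ∫ x, q.derivative.derivative.derivative.eval (x j) ∂μ := by
  have h2 : skewPoly = steinOp Polynomial.X := by simp [skewPoly, steinOp, sq]
  have h1 : (Polynomial.X : Polynomial ℝ) = steinOp 1 := by simp [steinOp]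
  rw [hμ.integral_steinOp_mul_eval, h2, hμ.integral_steinOp_mul_eval]
  conv_lhs => rw [h1]
  rw [hμ.integral_steinOp_mul_eval]
  simp only [Polynomial.eval_one, one_mul]
  ring

/-- `x⁴ - 3` is the fourth Hermite polynomial plus six times the second. The constants `5` and `6`
below peel off one Stein operator at a time. -/
theorem integral_steinOp_kurtPoly_mul (hμ : IsCorrelatedGaussian μ R K) (k j : ι)
    (q : Polynomial ℝ) :
    ∫ x, (steinOp kurtPoly).eval (x k) * q.eval (x j) ∂μ
      = R k j ^ 4 * ∫ x, q.derivative.derivative.derivative.derivative.eval (x j) ∂μ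
        + 6 * R k j ^ 2 * ∫ x, q.derivative.derivative.eval (x j) ∂μ := by
  have h3 : kurtPoly = steinOp (Polynomial.X ^ 2 + 5) := by
    simp [kurtPoly, steinOp]; ring
  have h2 : (Polynomial.X ^ 2 + 5 : Polynomial ℝ) = steinOp Polynomial.X + 6 := by
    simp [steinOp]; ring
  have h1 : (Polynomial.X : Polynomial ℝ) = steinOp 1 := by simp [steinOp]
  rw [hμ.integral_steinOp_mul_eval, h3, hμ.integral_steinOp_mul_eval, h2]
  simp only [Polynomial.eval_add, add_mul]
  rw [integral_add ((hμ.allLp_poly _ k).mul (hμ.allLp_poly _ j)).integrable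
    ((hμ.allLp_poly _ k).mul (hμ.allLp_poly _ j)).integrable, hμ.integral_steinOp_mul_eval]
  conv_lhs => rw [h1]
  rw [hμ.integral_steinOp_mul_eval]
  simp only [Polynomial.eval_one, one_mul, Polynomial.eval_ofNat]
  rw [integral_const_mul]
  ring

/-- No mixed term in `c d` appears: it would be a multiple of the mean of `x_j` or of the integral
of a vanishing higher derivative. This is why the limit covariance is diagonal. -/
theorem integral_sq_skew_kurt (hμ : IsCorrelatedGaussian μ R K) (k j : ι) (c d : ℝ) :
    ∫ x, (steinOp (Polynomial.C c * skewPoly + Polynomial.C d * kurtPoly)).eval (x k) *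
        (steinOp (Polynomial.C c * skewPoly + Polynomial.C d * kurtPoly)).eval (x j) ∂μ
      = c ^ 2 * (6 * R k j ^ 3) + d ^ 2 * (24 * R k j ^ 4 + 72 * R k j ^ 2) := by
  have := hμ.gaussian
  set q := steinOp (Polynomial.C c * skewPoly + Polynomial.C d * kurtPoly) with hq
  have hq' : q = Polynomial.C c * steinOp skewPoly + Polynomial.C d * steinOp kurtPoly := by
    rw [hq, steinOp_add, steinOp_C_mul, steinOp_C_mul]
  have hqe : q = Polynomial.C c * (Polynomial.X ^ 3 - 3 * Polynomial.X)
      + Polynomial.C d * (Polynomial.X ^ 4 - 3) := by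
    refine Polynomial.funext fun t => ?_
    rw [hq']
    simp [eval_steinOp_skewPoly, eval_steinOp_kurtPoly]
  have h0 : ∀ x : ι → ℝ, q.eval (x k) * q.eval (x j)
      = c * ((steinOp skewPoly).eval (x k) * q.eval (x j))
        + d * ((steinOp kurtPoly).eval (x k) * q.eval (x j)) := fun x => by
    have : q.eval (x k) = c * (steinOp skewPoly).eval (x k) + d * (steinOp kurtPoly).eval (x k) := by
      rw [hq']; simp
    rw [this]; ring
  simp_rw [h0]
  rw [integral_add (((hμ.allLp_poly _ k).mul (hμ.allLp_poly _ j)).const_mul _).integrable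
    (((hμ.allLp_poly _ k).mul (hμ.allLp_poly _ j)).const_mul _).integrable,
    integral_const_mul, integral_const_mul, hμ.integral_steinOp_skewPoly_mul,
    hμ.integral_steinOp_kurtPoly_mul]
  have i1 : Integrable (fun x : ι → ℝ => x j) μ := (hμ.allLp_eval j).integrable
  have i2 : Integrable (fun x : ι → ℝ => x j ^ 2) μ := ((hμ.allLp_eval j).pow 2).integrable
  have m2 : ∫ x, x j ^ 2 ∂μ = 1 := by
    rw [← hμ.diag j, ← hμ.cov]; simp only [sq]
  have e2 : ∀ t, q.derivative.derivative.eval t = c * 6 * t + d * 12 * t ^ 2 := fun t => by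
    simp [hqe]; ring
  have e3 : ∀ t, q.derivative.derivative.derivative.eval t = c * 6 + d * 24 * t := fun t => by
    simp [hqe]; ring
  have e4 : ∀ t, q.derivative.derivative.derivative.derivative.eval t = d * 24 := fun t => by
    simp [hqe]
    exact Or.inl (by norm_num)
  simp_rw [e2, e3, e4]
  rw [integral_add (i1.const_mul _) (i2.const_mul _), integral_add (integrable_const _)
    (i1.const_mul _)]
  simp only [integral_const_mul, integral_const, hμ.mean, m2, probReal_univ, smul_eq_mul]
  ring

theorem integral_normSum_sq (hμ : IsCorrelatedGaussian μ R K) (f : Polynomial ℝ) :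
    ∫ x, normSum f x ^ 2 ∂μ
      = (Fintype.card ι : ℝ)⁻¹ * ∑ k, ∑ j, ∫ x, f.eval (x k) * f.eval (x j) ∂μ := by
  have := hμ.gaussian
  have e : ∀ x : ι → ℝ, normSum f x ^ 2
      = (Fintype.card ι : ℝ)⁻¹ * ∑ k, ∑ j, f.eval (x k) * f.eval (x j) := fun x => by
    rw [normSum, mul_pow, inv_pow, Real.sq_sqrt (Nat.cast_nonneg _), sq (∑ k, _),
      Finset.sum_mul_sum]
  have hI : ∀ k j, AllLp (fun x : ι → ℝ => f.eval (x k) * f.eval (x j)) μ := fun k j =>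
    (hμ.allLp_poly f k).mul (hμ.allLp_poly f j)
  simp_rw [e]
  rw [integral_const_mul, integral_finsetSum _ fun k _ => (AllLp.sum fun j _ => hI k j).integrable]
  congr 1
  refine Finset.sum_congr rfl fun k _ => ?_
  rw [integral_finsetSum _ fun j _ => (hI k j).integrable]

theorem allLp_poly_gaussianReal (p : Polynomial ℝ) : AllLp (fun t => p.eval t) (gaussianReal 0 1) := by
  induction p using Polynomial.induction_on' with
  | add p q hp hq => simpa only [Polynomial.eval_add] using hp.add hq
  | monomial n a =>
    have h : AllLp (fun t : ℝ => t) (gaussianReal 0 1) := fun n => memLp_id_gaussianReal' n (by simp)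
    simpa only [Polynomial.eval_monomial] using (h.pow n).const_mul a

/-- Uniformity in `c` and `d` matters because the coefficients of the linear combination are divided
by standard deviations depending on `N`. -/
theorem exists_fourth_moment_bound (p q : Polynomial ℝ) (B : ℝ) : ∃ A : ℝ, ∀ c d : ℝ, |c| ≤ B →
    |d| ≤ B → ∫ t, (Polynomial.C c * p + Polynomial.C d * q).eval t ^ 4 ∂gaussianReal 0 1 ≤ A := by
  refine ⟨8 * B ^ 4 * (∫ t, p.eval t ^ 4 ∂gaussianReal 0 1 + ∫ t, q.eval t ^ 4 ∂gaussianReal 0 1),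
    fun c d hc hd => ?_⟩
  have ip := ((allLp_poly_gaussianReal p).pow 4).integrable
  have iq := ((allLp_poly_gaussianReal q).pow 4).integrable
  rw [← integral_add ip iq, ← integral_const_mul]
  refine integral_mono ((allLp_poly_gaussianReal _).pow 4).integrable ((ip.add iq).const_mul _)
    fun t => ?_
  simp only [Polynomial.eval_add, Polynomial.eval_mul, Polynomial.eval_C]
  have hc4 : c ^ 4 ≤ B ^ 4 := by
    rw [← (show Even 4 by decide).pow_abs c]; gcongr
  have hd4 : d ^ 4 ≤ B ^ 4 := by
    rw [← (show Even 4 by decide).pow_abs d]; gcongr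
  have h1 : ∀ u v : ℝ, (u + v) ^ 4 ≤ 8 * (u ^ 4 + v ^ 4) := fun u v => by
    nlinarith [sq_nonneg (u - v), sq_nonneg (u + v), sq_nonneg (u ^ 2 - v ^ 2),
      mul_nonneg (sq_nonneg (u - v)) (sq_nonneg (u + v)), sq_nonneg ((u - v) ^ 2)]
  refine (h1 _ _).trans ?_
  rw [mul_pow, mul_pow, mul_assoc 8, mul_add]
  have := mul_le_mul_of_nonneg_right hc4 (show 0 ≤ p.eval t ^ 4 by positivity)
  have := mul_le_mul_of_nonneg_right hd4 (show 0 ≤ q.eval t ^ 4 by positivity)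
  linarith

/-- The variance of the normalised sum of the `x_k³ - 3 x_k`. -/
def skewVariance (R : ι → ι → ℝ) : ℝ := (Fintype.card ι : ℝ)⁻¹ * ∑ k, ∑ j, 6 * R k j ^ 3

/-- The variance of the normalised sum of the `x_k⁴ - 3`. -/
def kurtVariance (R : ι → ι → ℝ) : ℝ :=
  (Fintype.card ι : ℝ)⁻¹ * ∑ k, ∑ j, (24 * R k j ^ 4 + 72 * R k j ^ 2)

/-- A quantitative joint central limit theorem for the empirical skewness and kurtosis. -/
theorem exists_charFun_skew_kurt_bound (B : ℝ) {K : ℝ} (hK : 0 < K) : ∃ D : ℝ,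
    ∀ (ι : Type) [Fintype ι] [Nonempty ι] (μ : Measure (ι → ℝ)) (R : ι → ι → ℝ),
      IsCorrelatedGaussian μ R K → ∀ c d : ℝ, |c| ≤ B → |d| ≤ B →
      ‖∫ x, Complex.exp (Complex.I * ((√(Fintype.card ι))⁻¹ *
          ∑ k, (c * (x k ^ 3 - 3 * x k) + d * (x k ^ 4 - 3)) : ℝ)) ∂μ
        - Complex.exp ((-((c ^ 2 * skewVariance R + d ^ 2 * kurtVariance R) / 2) : ℝ) : ℂ)‖
      ≤ D / √√(Fintype.card ι) := by
  obtain ⟨A1, h1⟩ := exists_fourth_moment_bound skewPoly kurtPoly B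
  obtain ⟨A2, h2⟩ := exists_fourth_moment_bound skewPoly.derivative kurtPoly.derivative B
  obtain ⟨A3, h3⟩ := exists_fourth_moment_bound (steinOp skewPoly).derivative
    (steinOp kurtPoly).derivative B
  obtain ⟨A4, h4⟩ := exists_fourth_moment_bound (steinOp skewPoly).derivative.derivative
    (steinOp kurtPoly).derivative.derivative B
  set A := max (max A1 A2) (max A3 A4)
  refine ⟨1 + 2 * K * A * (1 + K ^ 4), ?_⟩
  intro ι _ _ μ R hμ c d hc hd
  set p := Polynomial.C c * skewPoly + Polynomial.C d * kurtPoly with hp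
  have hs : steinOp p = Polynomial.C c * steinOp skewPoly + Polynomial.C d * steinOp kurtPoly := by
    rw [hp, steinOp_add, steinOp_C_mul, steinOp_C_mul]
  have hb := hμ.norm_charFun_normSum_sub_le hK p (A := A)
    ((h1 c d hc hd).trans (by simp [A]))
    (by
      have := (h2 c d hc hd).trans (show A2 ≤ A by simp [A])
      simpa [hp, Polynomial.derivative_C_mul] using this)
    (by
      have := (h3 c d hc hd).trans (show A3 ≤ A by simp [A])
      simpa [hs, Polynomial.derivative_C_mul] using this)
    (by
      have := (h4 c d hc hd).trans (show A4 ≤ A by simp [A])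
      simpa [hs, Polynomial.derivative_C_mul] using this)
  have e1 : ∫ x, normSum (steinOp p) x ^ 2 ∂μ
      = c ^ 2 * skewVariance R + d ^ 2 * kurtVariance R := by
    rw [hμ.integral_normSum_sq]
    simp_rw [hp, hμ.integral_sq_skew_kurt]
    simp only [skewVariance, kurtVariance, Finset.sum_add_distrib, ← Finset.mul_sum]
    ring
  have e2 : ∀ x : ι → ℝ, normSum (steinOp p) x = (√(Fintype.card ι))⁻¹ *
      ∑ k, (c * (x k ^ 3 - 3 * x k) + d * (x k ^ 4 - 3)) := fun x => by
    rw [normSum, hs]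
    simp [eval_steinOp_skewPoly, eval_steinOp_kurtPoly]
  rw [e1] at hb
  simp_rw [e2] at hb
  exact hb

end IsCorrelatedGaussian

end TorusNeedlet

namespace TorusNeedlet

variable {Ω : Type*} [MeasurableSpace Ω]

/-! ### Square integrable random variables -/

theorem eLpNorm_two_eq {E : Type*} [NormedAddCommGroup E] {P : Measure Ω} {f : Ω → E}
    (hf : MemLp f 2 P) : eLpNorm f 2 P = ENNReal.ofReal √(∫ ω, ‖f ω‖ ^ 2 ∂P) := by
  rw [hf.eLpNorm_eq_integral_rpow_norm (by norm_num) (by norm_num), Real.sqrt_eq_rpow]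
  simp

theorem memLp_fun_sub {E : Type*} [NormedAddCommGroup E] {P : Measure Ω} {f g : Ω → E}
    (hf : MemLp f 2 P) (hg : MemLp g 2 P) : MemLp (fun ω => f ω - g ω) 2 P := hf.sub hg

theorem abs_integral_mul_le {P : Measure Ω} {f g : Ω → ℝ} (hf : MemLp f 2 P) (hg : MemLp g 2 P) :
    |∫ ω, f ω * g ω ∂P| ≤ √(∫ ω, f ω ^ 2 ∂P) * √(∫ ω, g ω ^ 2 ∂P) := by
  have h := integral_mul_norm_le_Lp_mul_Lq (μ := P) (p := 2) (q := 2)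
    Real.HolderConjugate.two_two (by simpa using hf) (by simpa using hg)
  simp only [Real.norm_eq_abs, Real.rpow_two, sq_abs, ← Real.sqrt_eq_rpow] at h
  refine le_trans ?_ h
  rw [← Real.norm_eq_abs]
  refine (norm_integral_le_integral_norm _).trans (le_of_eq ?_)
  simp

theorem integral_norm_sq_le_of_tendsto {E : Type*} [NormedAddCommGroup E] {P : Measure Ω}
    {f : ℕ → Ω → E} {g h : Ω → E} {T : ℝ} (hT : 0 ≤ T) (hf : ∀ n, MemLp (f n) 2 P)
    (hg : MemLp g 2 P) (hh : MemLp h 2 P)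
    (hlim : Tendsto (fun n => eLpNorm (fun ω => g ω - f n ω) 2 P) atTop (𝓝 0))
    (hT' : ∀ᶠ n in atTop, ∫ ω, ‖f n ω - h ω‖ ^ 2 ∂P ≤ T) :
    ∫ ω, ‖g ω - h ω‖ ^ 2 ∂P ≤ T := by
  have key : eLpNorm (fun ω => g ω - h ω) 2 P ≤ ENNReal.ofReal √T := by
    have h1 : ∀ᶠ n in atTop, eLpNorm (fun ω => g ω - h ω) 2 P
        ≤ eLpNorm (fun ω => g ω - f n ω) 2 P + ENNReal.ofReal √T := by
      filter_upwards [hT'] with n hn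
      have e : (fun ω => g ω - h ω) = (fun ω => g ω - f n ω) + (fun ω => f n ω - h ω) := by
        ext ω; simp
      rw [e]
      refine (eLpNorm_add_le (memLp_fun_sub hg (hf n)).1 (memLp_fun_sub (hf n) hh).1 (by norm_num)).trans ?_
      gcongr
      rw [eLpNorm_two_eq (memLp_fun_sub (hf n) hh)]
      exact ENNReal.ofReal_le_ofReal (Real.sqrt_le_sqrt hn)
    have h2 := hlim.add_const (ENNReal.ofReal √T)
    rw [zero_add] at h2
    exact ge_of_tendsto h2 h1
  rw [eLpNorm_two_eq (memLp_fun_sub hg hh), ENNReal.ofReal_le_ofReal_iff (Real.sqrt_nonneg _)] at key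
  exact (Real.sqrt_le_sqrt_iff hT).1 key

theorem sq_integral_norm_le {P : Measure Ω} [IsProbabilityMeasure P] {E : Type*}
    [NormedAddCommGroup E] [NormedSpace ℝ E] {f : Ω → E} (hf : MemLp f 2 P) :
    ‖∫ ω, f ω ∂P‖ ^ 2 ≤ ∫ ω, ‖f ω‖ ^ 2 ∂P := by
  have h := variance_nonneg (fun ω => ‖f ω‖) P
  rw [variance_eq_sub hf.norm] at h
  have h1 := norm_integral_le_integral_norm (μ := P) f
  calc ‖∫ ω, f ω ∂P‖ ^ 2 ≤ (∫ ω, ‖f ω‖ ∂P) ^ 2 := by gcongr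
    _ ≤ ∫ ω, ‖f ω‖ ^ 2 ∂P := by simpa using h

/-- The law of an `L²` limit of Gaussian random variables is Gaussian. -/
theorem hasGaussianLaw_of_tendsto_sq {P : Measure Ω} [IsProbabilityMeasure P] {Y : ℕ → Ω → ℝ}
    {Z : Ω → ℝ} (hY : ∀ n, HasGaussianLaw (Y n) P) (hZ : MemLp Z 2 P)
    (hlim : Tendsto (fun n => ∫ ω, (Y n ω - Z ω) ^ 2 ∂P) atTop (𝓝 0)) : HasGaussianLaw Z P := by
  have hY2 : ∀ n, MemLp (Y n) 2 P := fun n => (hY n).memLp_two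
  have hn : Tendsto (fun n => √(∫ ω, (Y n ω - Z ω) ^ 2 ∂P)) atTop (𝓝 0) := by
    simpa using hlim.sqrt
  have hmean : Tendsto (fun n => ∫ ω, Y n ω ∂P) atTop (𝓝 (∫ ω, Z ω ∂P)) := by
    rw [tendsto_iff_norm_sub_tendsto_zero]
    refine squeeze_zero (fun _ => norm_nonneg _) (fun n => ?_) hn
    rw [← integral_sub ((hY2 n).integrable one_le_two) (hZ.integrable one_le_two)]
    refine Real.le_sqrt_of_sq_le ?_
    simpa using sq_integral_norm_le ((hY2 n).sub hZ)
  have hsq : Tendsto (fun n => ∫ ω, Y n ω ^ 2 ∂P) atTop (𝓝 (∫ ω, Z ω ^ 2 ∂P)) := by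
    have h1 : ∀ n, ∫ ω, Y n ω ^ 2 ∂P = ∫ ω, (Y n ω - Z ω) ^ 2 ∂P
        + 2 * ∫ ω, Z ω * (Y n ω - Z ω) ∂P + ∫ ω, Z ω ^ 2 ∂P := fun n => by
      have i1 := (memLp_fun_sub (hY2 n) hZ).integrable_sq
      have i2 : Integrable (fun ω => 2 * (Z ω * (Y n ω - Z ω))) P :=
        (hZ.integrable_mul (memLp_fun_sub (hY2 n) hZ)).const_mul 2
      have i3 : Integrable (fun ω => (Y n ω - Z ω) ^ 2 + 2 * (Z ω * (Y n ω - Z ω))) P := i1.add i2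
      rw [← integral_const_mul, ← integral_add i1 i2, ← integral_add i3 hZ.integrable_sq]
      congr 1; ext ω; ring
    have h2 : Tendsto (fun n => ∫ ω, Z ω * (Y n ω - Z ω) ∂P) atTop (𝓝 0) := by
      refine squeeze_zero_norm (fun n => abs_integral_mul_le hZ (memLp_fun_sub (hY2 n) hZ)) ?_
      simpa using hn.const_mul √(∫ ω, Z ω ^ 2 ∂P)
    simp_rw [h1]
    simpa using (hlim.add (h2.const_mul 2)).add_const (∫ ω, Z ω ^ 2 ∂P)
  have hvar : Tendsto (fun n => Var[Y n; P]) atTop (𝓝 Var[Z; P]) := by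
    simp_rw [variance_eq_sub (hY2 _), variance_eq_sub hZ]
    exact hsq.sub (hmean.pow 2)
  have hL2 : Tendsto (fun n => eLpNorm (Y n - Z) 2 P) atTop (𝓝 0) := by
    have : ∀ n, eLpNorm (Y n - Z) 2 P
        = ENNReal.ofReal √(∫ ω, (Y n ω - Z ω) ^ 2 ∂P) := fun n => by
      have := eLpNorm_two_eq ((hY2 n).sub hZ)
      simpa using! this
    simp_rw [this]
    simpa using ENNReal.tendsto_ofReal hn
  have hdist := (tendstoInMeasure_of_tendsto_eLpNorm (by norm_num) (fun n => (hY2 n).1) hZ.1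
    hL2).tendstoInDistribution (fun n => (hY2 n).1.aemeasurable)
  have hchar := fun t => (ProbabilityMeasure.tendsto_iff_tendsto_charFun.1 hdist.tendsto) t
  -- The characteristic functions converge both to that of `Z` and, through means and variances, to
  -- a Gaussian one.
  have hlaw : P.map Z = gaussianReal (∫ ω, Z ω ∂P) Var[Z; P].toNNReal := by
    have : IsProbabilityMeasure (P.map Z) := Measure.isProbabilityMeasure_map hZ.1.aemeasurable
    refine Measure.ext_of_charFun (funext fun t => ?_)
    refine tendsto_nhds_unique (hchar t) ?_
    simp only [ProbabilityMeasure.coe_mk]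
    simp_rw [fun n => (hY n).map_eq_gaussianReal, charFun_gaussianReal]
    refine (Complex.continuous_exp.tendsto _).comp ?_
    have hv : Tendsto (fun n => ((Var[Y n; P].toNNReal : ℝ) : ℂ)) atTop
        (𝓝 ((Var[Z; P].toNNReal : ℝ) : ℂ)) := by
      simp only [Real.coe_toNNReal _ (variance_nonneg _ _)]
      exact (Complex.continuous_ofReal.tendsto _).comp hvar
    have hm : Tendsto (fun n => ((∫ ω, Y n ω ∂P : ℝ) : ℂ)) atTop (𝓝 ((∫ ω, Z ω ∂P : ℝ) : ℂ)) :=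
      (Complex.continuous_ofReal.tendsto _).comp hmean
    exact (((hm.const_mul (t : ℂ)).mul_const Complex.I).sub ((hv.mul_const _).div_const _))
  exact ⟨by rw [hlaw]; infer_instance⟩

/-! ### The Fourier coefficients of a stationary field -/

/-- The normalised Haar measure of the torus. -/
abbrev haar : Measure Torus := AddCircle.haarAddCircle

namespace IsTorusField

variable {P : Measure Ω} {X : Torus → Ω → ℝ}

omit [MeasurableSpace Ω] in
theorem w_eq (X : Torus → Ω → ℝ) (l : ℤ) (ω : Ω) :
    w X l ω = ∫ t, fourier (-l) t * (X t ω : ℂ) ∂haar := rfl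

theorem measurable_w (hX : IsTorusField P X) (l : ℤ) : Measurable (w X l) := by
  have h : StronglyMeasurable (fun p : Torus × Ω => fourier (-l) p.1 * ((X p.1 p.2 : ℝ) : ℂ)) :=
    (((fourier (-l)).continuous.measurable.comp measurable_fst).mul
      (Complex.measurable_ofReal.comp hX.measurable)).stronglyMeasurable
  exact h.integral_prod_left'.measurable

theorem integral_sq_eq (hX : IsTorusField P X) (t : Torus) :
    ∫ ω, X t ω ^ 2 ∂P = ∫ ω, X 0 ω ^ 2 ∂P := by
  have := hX.isotropic 0 0 t
  simpa [sq] using this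

variable [IsProbabilityMeasure P]

theorem integrable_sq_prod (hX : IsTorusField P X) :
    Integrable (fun p : Torus × Ω => X p.1 p.2 ^ 2) (haar.prod P) := by
  rw [integrable_prod_iff (hX.measurable.pow_const 2).aestronglyMeasurable]
  refine ⟨ae_of_all _ fun t => (hX.memLp t).integrable_sq, ?_⟩
  simp only [Real.norm_eq_abs, abs_pow, sq_abs, hX.integral_sq_eq]
  exact integrable_const _

theorem memLp_path (hX : IsTorusField P X) : ∀ᵐ ω ∂P, MemLp (fun t => X t ω) 2 haar := by
  filter_upwards [hX.integrable_sq_prod.prod_left_ae] with ω hω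
  rw [memLp_two_iff_integrable_sq]
  · exact hω
  · exact (hX.measurable.comp measurable_prodMk_right).aestronglyMeasurable

theorem fourier_norm_apply (l : ℤ) (t : Torus) : ‖fourier l t‖ = 1 := Circle.norm_coe _

theorem memLp_w (hX : IsTorusField P X) (l : ℤ) : MemLp (w X l) 2 P := by
  rw [memLp_two_iff_integrable_sq_norm (hX.measurable_w l).aestronglyMeasurable]
  refine Integrable.mono' hX.integrable_sq_prod.integral_prod_right
    ((hX.measurable_w l).norm.pow_const 2).aestronglyMeasurable ?_
  filter_upwards [hX.memLp_path] with ω hω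
  rw [Real.norm_eq_abs, abs_of_nonneg (sq_nonneg _), w_eq]
  have h : MemLp (fun t => fourier (-l) t * (X t ω : ℂ)) 2 haar := by
    have hc : MemLp (fun t => (X t ω : ℂ)) 2 haar := hω.ofReal
    refine MemLp.of_le hc
      (((fourier (-l)).continuous.aestronglyMeasurable).mul hc.1) (ae_of_all _ fun t => ?_)
    rw [norm_mul, fourier_norm_apply, one_mul]
  refine (sq_integral_norm_le h).trans (le_of_eq ?_)
  congr 1; ext t
  rw [norm_mul, fourier_norm_apply, one_mul, Complex.norm_real, Real.norm_eq_abs, sq_abs]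

theorem integral_mul_w (hX : IsTorusField P X) {Y : Ω → ℂ} (hY : MemLp Y 2 P) (l : ℤ) :
    ∫ ω, Y ω * w X l ω ∂P = ∫ t, fourier (-l) t * ∫ ω, Y ω * (X t ω : ℂ) ∂P ∂haar := by
  have hint : Integrable (fun p : Torus × Ω => fourier (-l) p.1 * (Y p.2 * (X p.1 p.2 : ℂ)))
      (haar.prod P) := by
    have hb : Integrable (fun p : Torus × Ω => ‖Y p.2‖ ^ 2 + X p.1 p.2 ^ 2) (haar.prod P) :=
      Integrable.add (((memLp_two_iff_integrable_sq_norm hY.1).1 hY).comp_snd haar)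
        hX.integrable_sq_prod
    refine Integrable.mono' hb ?_ (ae_of_all _ fun p => ?_)
    · exact (((fourier (-l)).continuous.measurable.comp measurable_fst).aestronglyMeasurable).mul
        ((hY.1.comp_snd).mul (Complex.measurable_ofReal.comp hX.measurable).aestronglyMeasurable)
    · rw [norm_mul, fourier_norm_apply, one_mul, norm_mul, Complex.norm_real, Real.norm_eq_abs]
      nlinarith [sq_nonneg (‖Y p.2‖ - |X p.1 p.2|), sq_abs (X p.1 p.2), sq_nonneg ‖Y p.2‖,
        sq_nonneg (X p.1 p.2)]
  calc ∫ ω, Y ω * w X l ω ∂P = ∫ ω, ∫ t, fourier (-l) t * (Y ω * (X t ω : ℂ)) ∂haar ∂P := by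
        congr 1; ext ω
        rw [w_eq, ← integral_const_mul]
        congr 1; ext t; ring
    _ = ∫ t, ∫ ω, fourier (-l) t * (Y ω * (X t ω : ℂ)) ∂P ∂haar :=
        (integral_integral_swap hint).symm
    _ = _ := by simp_rw [integral_const_mul]

/-- Stationarity and the invariance of Haar measure: translating the field by `s` multiplies the
correlation with `w_l` by a character. -/
theorem integral_field_mul_w (hX : IsTorusField P X) (s : Torus) (l : ℤ) :
    ∫ ω, (X s ω : ℂ) * w X l ω ∂P = fourier (-l) s * ∫ ω, (X 0 ω : ℂ) * w X l ω ∂P := by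
  have hs : ∀ s, MemLp (fun ω => (X s ω : ℂ)) 2 P := fun s => (hX.memLp s).ofReal
  rw [hX.integral_mul_w (hs s), hX.integral_mul_w (hs 0), ← integral_const_mul]
  have := integral_add_right_eq_self (μ := haar)
    (fun t : Torus => fourier (-l) t * ∫ ω, (X s ω : ℂ) * (X t ω : ℂ) ∂P) s
  rw [← this]
  congr 1; ext t
  have h1 : fourier (-l) (t + s) = fourier (-l) s * fourier (-l) t := by
    simp only [fourier_apply, smul_add, AddCircle.toCircle_add, Circle.coe_mul]
    ring
  rw [h1, mul_assoc]
  congr 2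
  simp only [← Complex.ofReal_mul, integral_complex_ofReal]
  have := hX.isotropic 0 t s
  rw [zero_add] at this
  rw [this]

/-- Translation by half a period of the character changes its sign but not its integral. -/
theorem integral_fourier (n : ℤ) (hn : n ≠ 0) : ∫ t : Torus, fourier n t ∂haar = 0 := by
  have hs := fourier_add_half_inv_index hn Real.two_pi_pos
  have := integral_add_right_eq_self (μ := haar) (fun t : Torus => fourier n t)
    ((2 * π / 2 / n : ℝ) : Torus)
  simp_rw [hs, integral_neg] at this
  have h2 : (2 : ℂ) * ∫ t : Torus, fourier n t ∂haar = 0 := by linear_combination -this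
  simpa using h2

/-- Orthogonality comes from stationarity alone: the correlation of `w_l` with `X_t` is a multiple
of the character `-l`, and integrating it against the character `-m` gives zero. There is no
conjugate, so the exceptional case is `l + m = 0`; in particular `E w_l² = 0` for `l ≠ 0`. -/
theorem integral_w_mul_w (hX : IsTorusField P X) {l m : ℤ} (h : l + m ≠ 0) :
    ∫ ω, w X l ω * w X m ω ∂P = 0 := by
  rw [hX.integral_mul_w (hX.memLp_w l)]
  have h1 : ∀ t : Torus, fourier (-m) t * ∫ ω, w X l ω * (X t ω : ℂ) ∂P
      = fourier (-(l + m)) t * ∫ ω, (X 0 ω : ℂ) * w X l ω ∂P := fun t => by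
    have e : ∀ ω, w X l ω * (X t ω : ℂ) = (X t ω : ℂ) * w X l ω := fun ω => mul_comm _ _
    simp_rw [e]
    rw [hX.integral_field_mul_w t l, neg_add, add_comm, fourier_add]
    ring
  simp_rw [h1]
  rw [integral_mul_const, integral_fourier _ (neg_ne_zero.2 h), zero_mul]

omit [MeasurableSpace Ω] in
theorem w_neg (X : Torus → Ω → ℝ) (l : ℤ) (ω : Ω) : w X (-l) ω = starRingEnd ℂ (w X l ω) := by
  rw [w_eq, w_eq, ← integral_conj]
  congr 1; ext t
  rw [map_mul, ← fourier_neg, Complex.conj_ofReal]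

theorem integral_w_mul_conj_w (hX : IsTorusField P X) {l m : ℤ} (h : l ≠ m) :
    ∫ ω, w X l ω * starRingEnd ℂ (w X m ω) ∂P = 0 := by
  simp_rw [← w_neg]
  exact hX.integral_w_mul_w (by omega)

omit [IsProbabilityMeasure P] in
theorem C_neg (P : Measure Ω) (X : Torus → Ω → ℝ) (l : ℤ) : C P X (-l) = C P X l := by
  simp only [C, w_neg, RCLike.norm_conj]

theorem integral_norm_sum_w_sq (hX : IsTorusField P X) (s : Finset ℤ) :
    ∫ ω, ‖∑ l ∈ s, w X l ω‖ ^ 2 ∂P = ∑ l ∈ s, C P X l := by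
  have e : ∀ ω, ((‖∑ l ∈ s, w X l ω‖ ^ 2 : ℝ) : ℂ)
      = ∑ l ∈ s, ∑ m ∈ s, w X l ω * starRingEnd ℂ (w X m ω) := fun ω => by
    rw [← Finset.sum_mul_sum, ← map_sum, Complex.mul_conj, Complex.normSq_eq_norm_sq]
  have hI : ∀ l m, Integrable (fun ω => w X l ω * starRingEnd ℂ (w X m ω)) P := fun l m => by
    simp_rw [← w_neg]
    exact (hX.memLp_w l).integrable_mul (hX.memLp_w (-m))
  have h : ((∫ ω, ‖∑ l ∈ s, w X l ω‖ ^ 2 ∂P : ℝ) : ℂ) = ((∑ l ∈ s, C P X l : ℝ) : ℂ) := by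
    rw [← integral_complex_ofReal]
    simp_rw [e]
    rw [integral_finsetSum _ fun l _ => integrable_finsetSum _ fun m _ => hI l m,
      Complex.ofReal_sum]
    refine Finset.sum_congr rfl fun l hl => ?_
    rw [integral_finsetSum _ fun m _ => hI l m, Finset.sum_eq_single l]
    · simp_rw [Complex.mul_conj, Complex.normSq_eq_norm_sq, integral_complex_ofReal]
      rfl
    · exact fun m _ hm => hX.integral_w_mul_conj_w (Ne.symm hm)
    · exact fun h => absurd hl h
  exact_mod_cast h

end IsTorusField

end TorusNeedlet

namespace TorusNeedlet

variable {Ω : Type*} [MeasurableSpace Ω]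

/-! ### Sampling of characters and aliasing -/

theorem sum_range_fourier {M : ℕ} (hM : M ≠ 0) (n : ℤ) :
    ∑ m ∈ Finset.range M, fourier n ((2 * π * m / M : ℝ) : Torus)
      = if (M : ℤ) ∣ n then (M : ℂ) else 0 := by
  have hM' : (M : ℂ) ≠ 0 := by exact_mod_cast hM
  set ζ : ℂ := Complex.exp (2 * π * Complex.I / M) with hζ
  have hprim : IsPrimitiveRoot ζ M := Complex.isPrimitiveRoot_exp M hM
  have h1 : ∀ m : ℕ, fourier n ((2 * π * m / M : ℝ) : Torus) = (ζ ^ n) ^ m := fun m => by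
    rw [fourier_torus_coe, hζ, ← Complex.exp_int_mul, ← Complex.exp_nat_mul]
    congr 1
    push_cast
    ring
  simp_rw [h1]
  split_ifs with h
  · rw [(hprim.zpow_eq_one_iff_dvd n).2 h]
    simp
  · have hne : ζ ^ n ≠ 1 := fun h' => h ((hprim.zpow_eq_one_iff_dvd n).1 h')
    have h2 : (ζ ^ n) ^ M = 1 := by
      rw [← zpow_natCast, zpow_comm, zpow_natCast, hprim.pow_eq_one, one_zpow]
    rw [geom_sum_eq hne, h2, sub_self, zero_div]

theorem sum_Icc_fourier {M : ℕ} (hM : M ≠ 0) (n : ℤ) :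
    ∑ m ∈ Finset.Icc 1 M, fourier n ((2 * π * m / M : ℝ) : Torus)
      = if (M : ℤ) ∣ n then (M : ℂ) else 0 := by
  rw [← sum_range_fourier hM n]
  have hM' : (M : ℝ) ≠ 0 := by exact_mod_cast hM
  have h0 : fourier n ((2 * π * M / M : ℝ) : Torus) = fourier n ((2 * π * (0 : ℕ) / M : ℝ) : Torus) := by
    rw [mul_div_assoc, div_self hM', mul_one]
    congr 1
    simp
  have h1 : ∑ m ∈ Finset.Icc 1 M, fourier n ((2 * π * m / M : ℝ) : Torus)
      = ∑ m ∈ Finset.range M, fourier n ((2 * π * (m + 1 : ℕ) / M : ℝ) : Torus) := by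
    rw [Finset.range_eq_Ico, Finset.sum_Ico_add' (fun m : ℕ => fourier n ((2 * π * m / M : ℝ) : Torus)) 0 M 1]
    congr 1
  rw [h1]
  have h2 := Finset.sum_range_succ (fun m : ℕ => fourier n ((2 * π * m / M : ℝ) : Torus)) M
  rw [Finset.sum_range_succ', h0] at h2
  exact add_right_cancel h2

namespace IsTorusField

variable {P : Measure Ω} {X : Torus → Ω → ℝ}

theorem measurable_wTilde (hX : IsTorusField P X) (M : ℕ) (l : ℤ) : Measurable (wTilde X M l) := by
  have h : ∀ t, Measurable (X t) := fun t => hX.measurable.comp measurable_prodMk_left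
  unfold wTilde
  fun_prop

theorem memLp_wTilde (hX : IsTorusField P X) (M : ℕ) (l : ℤ) : MemLp (wTilde X M l) 2 P := by
  have h : ∀ t s : Torus, MemLp (fun ω => (X t ω : ℂ) * fourier (-l) s) 2 P := fun t s =>
    MemLp.mul_const (hX.memLp t).ofReal _
  exact (memLp_finsetSum (Finset.range M) fun m _ => h _ _).const_mul (1 / (M : ℂ))

variable [IsProbabilityMeasure P]

/-- The frequencies `l' ≠ l` that cannot be told from `l` by `M` samples contribute the error. -/
theorem integral_norm_wTilde_sub_sq_le (hX : IsTorusField P X) {M : ℕ} (hM : M ≠ 0) (l : ℤ) {T : ℝ}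
    (hT : ∀ s : Finset ℤ, (∀ l' ∈ s, l' ≠ l ∧ (M : ℤ) ∣ l' - l) → ∑ l' ∈ s, C P X l' ≤ T) :
    ∫ ω, ‖wTilde X M l ω - w X l ω‖ ^ 2 ∂P ≤ T := by
  -- The aliases of `l` within `[-n, n]`. Sampling the `n`-th partial sum of the field gives exactly
  -- the sum of `w_{l'}` over them, so the expansion passes to the limit at the finitely many sample
  -- points.
  set A : ℕ → Finset ℤ := fun n => (Finset.Icc (-(n : ℤ)) n).filter fun l' => (M : ℤ) ∣ l' - l
  have hM' : (M : ℂ) ≠ 0 := by exact_mod_cast hM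
  have hT0 : 0 ≤ T := by simpa using hT ∅ (by simp)
  refine integral_norm_sq_le_of_tendsto (f := fun n ω => ∑ l' ∈ A n, w X l' ω) hT0
    (fun n => memLp_finsetSum _ fun l' _ => hX.memLp_w l') (hX.memLp_wTilde M l) (hX.memLp_w l)
    ?_ ?_
  · set x : ℕ → Torus := fun m => ((2 * π * m / M : ℝ) : Torus)
    set r : ℕ → Torus → Ω → ℂ := fun n t ω =>
      (X t ω : ℂ) - ∑ l ∈ Finset.Icc (-(n : ℤ)) n, w X l ω * fourier l t
    have hr : ∀ n t, MemLp (r n t) 2 P := fun n t =>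
      memLp_fun_sub (hX.memLp t).ofReal
        (memLp_finsetSum _ fun l' _ => (hX.memLp_w l').mul_const _)
    have e : ∀ n, (fun ω => wTilde X M l ω - ∑ l' ∈ A n, w X l' ω)
        = ∑ m ∈ Finset.range M, fun ω => ((1 / (M : ℂ)) * fourier (-l) (x m)) * r n (x m) ω := by
      intro n
      ext ω
      have h1 : ∑ m ∈ Finset.range M, (∑ l' ∈ Finset.Icc (-(n : ℤ)) n, w X l' ω * fourier l' (x m))
          * fourier (-l) (x m) = M * ∑ l' ∈ A n, w X l' ω := by
        simp_rw [Finset.sum_mul]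
        rw [Finset.sum_comm, Finset.sum_filter, Finset.mul_sum]
        refine Finset.sum_congr rfl fun l' _ => ?_
        have h2 : ∀ m : ℕ, w X l' ω * fourier l' (x m) * fourier (-l) (x m)
            = w X l' ω * fourier (l' - l) (x m) := fun m => by
          rw [mul_assoc, ← fourier_add, sub_eq_add_neg]
        simp_rw [h2]
        rw [← Finset.mul_sum, sum_range_fourier hM]
        split_ifs <;> ring
      have h3 : ∑ l' ∈ A n, w X l' ω = 1 / (M : ℂ) * ∑ m ∈ Finset.range M,
          (∑ l' ∈ Finset.Icc (-(n : ℤ)) n, w X l' ω * fourier l' (x m)) * fourier (-l) (x m) := by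
        rw [h1]; field_simp
      rw [h3, wTilde, ← mul_sub, ← Finset.sum_sub_distrib, Finset.sum_apply, Finset.mul_sum]
      refine Finset.sum_congr rfl fun m _ => ?_
      ring
    simp_rw [e]
    have hlim : Tendsto (fun n => ∑ m ∈ Finset.range M, eLpNorm (r n (x m)) 2 P) atTop (𝓝 0) := by
      have := tendsto_finsetSum (Finset.range M) fun m _ => hX.expansion (x m)
      simpa using! this
    refine tendsto_of_tendsto_of_tendsto_of_le_of_le tendsto_const_nhds hlim (fun _ => zero_le)
      fun n => ?_
    refine (eLpNorm_sum_le (fun m _ => ((hr n (x m)).const_mul _).1) (by norm_num)).trans ?_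
    refine Finset.sum_le_sum fun m _ => eLpNorm_mono fun ω => ?_
    rw [norm_mul, norm_mul, fourier_norm_apply, mul_one]
    refine mul_le_of_le_one_left (norm_nonneg _) ?_
    rw [norm_div, norm_one, Complex.norm_natCast]
    exact div_le_one_of_le₀ (by exact_mod_cast Nat.one_le_iff_ne_zero.2 hM) (by positivity)
  · filter_upwards [eventually_ge_atTop l.natAbs] with n hn
    have hl : l ∈ A n := by simp [A]; omega
    have e : ∀ ω, (∑ l' ∈ A n, w X l' ω) - w X l ω = ∑ l' ∈ (A n).erase l, w X l' ω := fun ω => by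
      rw [← Finset.add_sum_erase _ _ hl]; ring
    simp_rw [e]
    rw [hX.integral_norm_sum_w_sq]
    refine hT _ fun l' hl' => ?_
    simp only [A, Finset.mem_erase, Finset.mem_filter] at hl'
    exact ⟨hl'.1, hl'.2.2⟩

omit [IsProbabilityMeasure P] in
theorem C_le_of_assumptionA1 {α : ℝ} (hA : AssumptionA1 P X α) : ∃ c₁ c₂ : ℝ, 0 < c₁ ∧ 0 < c₂ ∧
    ∀ l : ℤ, l ≠ 0 → c₁ * |(l : ℝ)| ^ (-α) ≤ C P X l ∧ C P X l ≤ c₂ * |(l : ℝ)| ^ (-α) := by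
  obtain ⟨-, c₁, c₂, g, hc, hg, hC⟩ := hA
  refine ⟨c₁, c₂, hc, hc.trans_le ((hg 0).1.trans (hg 0).2), fun l hl => ?_⟩
  have h : C P X l = C P X (l.natAbs : ℤ) := by
    rcases Int.natAbs_eq l with h | h
    · rw [← h]
    · conv_lhs => rw [h, C_neg]
  have h2 : |(l : ℝ)| = (l.natAbs : ℝ) := by
    rw [Nat.cast_natAbs, Int.cast_abs]
  rw [h, hC _ (by omega), h2]
  have h3 : 0 ≤ (l.natAbs : ℝ) ^ (-α) := by positivity
  exact ⟨by gcongr; exact (hg _).1, by gcongr; exact (hg _).2⟩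

/-- An alias `l' = l + kM` of a frequency with `2|l| ≤ M` satisfies `|l'| ≥ M|k|/2`, whence the
factor `2^α`. The sum over `k` converges since `α > 1`, and `l' ↦ k` is injective. -/
theorem exists_integral_norm_wTilde_sub_sq_le (hX : IsTorusField P X) {α : ℝ}
    (hA : AssumptionA1 P X α) : ∃ c : ℝ, 0 ≤ c ∧ ∀ (M : ℕ) (l : ℤ), M ≠ 0 → 2 * |l| ≤ M →
      ∫ ω, ‖wTilde X M l ω - w X l ω‖ ^ 2 ∂P ≤ c * (M : ℝ) ^ (-α) := by
  obtain ⟨c₁, c₂, -, hc₂, hC⟩ := C_le_of_assumptionA1 hA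
  have hα := hA.1
  have hs := Real.summable_abs_int_rpow hα
  refine ⟨c₂ * 2 ^ α * ∑' k : ℤ, |(k : ℝ)| ^ (-α), by positivity, fun M l hM hl => ?_⟩
  have hM' : (0 : ℝ) < M := by exact_mod_cast Nat.pos_of_ne_zero hM
  refine hX.integral_norm_wTilde_sub_sq_le hM l fun s hs' => ?_
  have key : ∀ l' ∈ s, C P X l' ≤ c₂ * 2 ^ α * (M : ℝ) ^ (-α) * |(((l' - l) / (M : ℤ) : ℤ) : ℝ)| ^ (-α) := by
    intro l' hl'
    obtain ⟨hne, k, hk⟩ := hs' l' hl'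
    have hk0 : k ≠ 0 := by rintro rfl; exact hne (by linarith)
    have h1 : (l' - l) / (M : ℤ) = k := by
      rw [hk]; exact Int.mul_ediv_cancel_left _ (by exact_mod_cast hM)
    rw [h1]
    have hkabs : 1 ≤ |k| := Int.one_le_abs hk0
    have h2 : (M : ℤ) * |k| ≤ 2 * |l'| := by
      have : |l' - l| = M * |k| := by rw [hk, abs_mul, Nat.abs_cast]
      have h3 := abs_sub l' l
      have h4 : (M : ℤ) ≤ M * |k| := le_mul_of_one_le_right (by positivity) hkabs
      linarith
    have h2' : (M : ℝ) * |(k : ℝ)| ≤ 2 * |(l' : ℝ)| := by exact_mod_cast h2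
    have hkpos : (0 : ℝ) < |(k : ℝ)| := by positivity
    have hl'0 : l' ≠ 0 := by
      rintro rfl
      simp at h2'
      nlinarith
    refine (hC l' hl'0).2.trans ?_
    have h5 : |(l' : ℝ)| ^ (-α) ≤ (M * |(k : ℝ)| / 2) ^ (-α) :=
      Real.rpow_le_rpow_of_nonpos (by positivity) (by linarith) (by linarith)
    have h6 : ((M : ℝ) * |(k : ℝ)| / 2) ^ (-α) = 2 ^ α * (M : ℝ) ^ (-α) * |(k : ℝ)| ^ (-α) := by
      rw [Real.div_rpow (by positivity) (by norm_num), Real.mul_rpow hM'.le hkpos.le,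
        Real.rpow_neg (by norm_num : (0 : ℝ) ≤ 2)]
      field_simp
    calc c₂ * |(l' : ℝ)| ^ (-α) ≤ c₂ * (2 ^ α * (M : ℝ) ^ (-α) * |(k : ℝ)| ^ (-α)) := by
          rw [← h6]; gcongr
      _ = _ := by ring
  have hinj : Set.InjOn (fun l' : ℤ => (l' - l) / (M : ℤ)) s := by
    intro x hx y hy hxy
    obtain ⟨-, k, hk⟩ := hs' x hx
    obtain ⟨-, k', hk'⟩ := hs' y hy
    have hMz : (M : ℤ) ≠ 0 := by exact_mod_cast hM
    simp only [hk, hk', Int.mul_ediv_cancel_left _ hMz] at hxy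
    rw [hxy] at hk
    linarith
  calc ∑ l' ∈ s, C P X l' ≤ ∑ l' ∈ s,
        c₂ * 2 ^ α * (M : ℝ) ^ (-α) * |(((l' - l) / (M : ℤ) : ℤ) : ℝ)| ^ (-α) := Finset.sum_le_sum key
    _ = c₂ * 2 ^ α * (M : ℝ) ^ (-α) * ∑ k ∈ s.image (fun l' => (l' - l) / (M : ℤ)), |(k : ℝ)| ^ (-α) := by
        rw [Finset.sum_image hinj, Finset.mul_sum]
    _ ≤ c₂ * 2 ^ α * (M : ℝ) ^ (-α) * ∑' k : ℤ, |(k : ℝ)| ^ (-α) := by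
        gcongr
        exact hs.sum_le_tsum _ fun _ _ => by positivity
    _ = _ := by ring

/-! ### Joint Gaussianity and independence of the Fourier coefficients -/

/-- The coefficient `w_l` is an integral over uncountably many field values. Gaussianity is obtained
instead from the `wTilde X M l`, finite linear combinations of samples, which converge to it in `L²`
as `M → ∞`; one real functional `L` at a time is enough. -/
theorem isGaussianProcess_w (hX : IsTorusField P X) {α : ℝ} (hA : AssumptionA1 P X α)
    (hB : IsGaussianProcess X P) : IsGaussianProcess (w X) P := by
  have hM : ∀ M : ℕ, IsGaussianProcess (wTilde X M) P := fun M => by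
    classical
    refine hB.of_isGaussianProcess fun l =>
      ⟨(Finset.range M).image fun m : ℕ => ((2 * π * m / M : ℝ) : Torus), ?_⟩
    set I := (Finset.range M).image fun m : ℕ => ((2 * π * m / M : ℝ) : Torus) with hI
    have hmem : ∀ m : Finset.range M, ((2 * π * (m : ℕ) / M : ℝ) : Torus) ∈ I := fun m =>
      Finset.mem_image_of_mem (fun m : ℕ => ((2 * π * m / M : ℝ) : Torus)) m.2
    refine ⟨∑ m : Finset.range M, (ContinuousLinearMap.proj (R := ℝ) (φ := fun _ : I => ℝ)
      ⟨_, hmem m⟩).smulRight (1 / (M : ℂ) * fourier (-l) ((2 * π * (m : ℕ) / M : ℝ) : Torus)), ?_⟩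
    intro ω
    rw [wTilde, Finset.mul_sum, ← Finset.sum_coe_sort, sum_apply]
    refine Finset.sum_congr rfl fun m _ => ?_
    simp only [ContinuousLinearMap.smulRight_apply, ContinuousLinearMap.proj_apply,
      Finset.restrict, Complex.real_smul]
    ring
  obtain ⟨c, hc0, hc⟩ := hX.exists_integral_norm_wTilde_sub_sq_le hA
  refine ⟨fun I => ⟨isGaussian_of_map_eq_gaussianReal fun L => ?_⟩⟩
  have hmeas : Measurable fun ω => I.restrict (w X · ω) :=
    measurable_pi_lambda _ fun l => hX.measurable_w l
  have hZ : MemLp (fun ω => L (I.restrict (w X · ω))) 2 P := by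
    refine L.comp_memLp' (memLp_pi_iff.2 fun l => hX.memLp_w l)
  have hG : HasGaussianLaw (fun ω => L (I.restrict (w X · ω))) P := by
    refine hasGaussianLaw_of_tendsto_sq (fun M => ((hM M).hasGaussianLaw I).map_fun L) hZ ?_
    have hb : ∀ᶠ M : ℕ in atTop, ∫ ω, (L (I.restrict (wTilde X M · ω)) - L (I.restrict (w X · ω))) ^ 2 ∂P
        ≤ ‖L‖ ^ 2 * (I.card * (c * (M : ℝ) ^ (-α))) := by
      have hev : ∀ᶠ M : ℕ in atTop, ∀ l ∈ I, 2 * |l| ≤ (M : ℤ) := by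
        rw [Filter.eventually_all_finset]
        intro l _
        filter_upwards [eventually_ge_atTop (2 * l.natAbs)] with M hM
        rw [Int.abs_eq_natAbs]
        omega
      filter_upwards [hev, eventually_ne_atTop 0] with M hM1 hM0
      have hint : ∀ l, Integrable (fun ω => ‖wTilde X M l ω - w X l ω‖ ^ 2) P := fun l =>
        (memLp_two_iff_integrable_sq_norm
          (memLp_fun_sub (hX.memLp_wTilde M l) (hX.memLp_w l)).1).1
            (memLp_fun_sub (hX.memLp_wTilde M l) (hX.memLp_w l))
      calc ∫ ω, (L (I.restrict (wTilde X M · ω)) - L (I.restrict (w X · ω))) ^ 2 ∂P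
          ≤ ∫ ω, ‖L‖ ^ 2 * ∑ l ∈ I, ‖wTilde X M l ω - w X l ω‖ ^ 2 ∂P := by
            refine integral_mono_of_nonneg (ae_of_all _ fun _ => sq_nonneg _)
              ((integrable_finsetSum _ fun l _ => hint l).const_mul _) (ae_of_all _ fun ω => ?_)
            dsimp only
            rw [← map_sub, ← sq_abs, ← Real.norm_eq_abs]
            calc ‖L (I.restrict (wTilde X M · ω) - I.restrict (w X · ω))‖ ^ 2
                ≤ (‖L‖ * ‖I.restrict (wTilde X M · ω) - I.restrict (w X · ω)‖) ^ 2 := by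
                  gcongr; exact L.le_opNorm _
              _ ≤ _ := by
                  rw [mul_pow]
                  gcongr
                  refine (Real.le_sqrt (norm_nonneg _) (by positivity)).1 ?_
                  refine (pi_norm_le_iff_of_nonneg (Real.sqrt_nonneg _)).2 fun l => ?_
                  refine Real.le_sqrt_of_sq_le ?_
                  exact Finset.single_le_sum (f := fun l => ‖wTilde X M l ω - w X l ω‖ ^ 2)
                    (fun _ _ => sq_nonneg _) l.2
        _ ≤ _ := by
            rw [integral_const_mul, integral_finsetSum _ fun l _ => hint l]
            gcongr
            rw [← nsmul_eq_mul]
            exact Finset.sum_le_card_nsmul _ _ _ fun l hl => hc M l hM0 (hM1 l hl)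
    refine squeeze_zero' (Eventually.of_forall fun M => integral_nonneg fun _ => sq_nonneg _) hb ?_
    have hα := hA.1
    have h0 : Tendsto (fun M : ℕ => (M : ℝ) ^ (-α)) atTop (𝓝 0) :=
      (tendsto_rpow_neg_atTop (by linarith)).comp tendsto_natCast_atTop_atTop
    simpa using ((h0.const_mul c).const_mul (I.card : ℝ)).const_mul (‖L‖ ^ 2)
  refine ⟨∫ ω, L (I.restrict (w X · ω)) ∂P, Var[fun ω => L (I.restrict (w X · ω)); P].toNNReal, ?_⟩
  rw [Measure.map_map L.continuous.measurable hmeas]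
  exact hG.map_eq_gaussianReal

theorem integral_ofReal_smul_re (hX : IsTorusField P X) (u v : ℂ) {l m : ℤ} (h1 : l + m ≠ 0)
    (h2 : l ≠ m) : ∫ ω, (u * w X l ω).re * (v * w X m ω).re ∂P = 0 := by
  have hI : ∀ l m, Integrable (fun ω => w X l ω * w X m ω) P := fun l m =>
    (hX.memLp_w l).integrable_mul (hX.memLp_w m)
  have e : ∀ ω, (u * w X l ω).re * (v * w X m ω).re
      = (u * v / 2 * (w X l ω * w X m ω) + u * starRingEnd ℂ v / 2 * (w X l ω * w X (-m) ω)).re := by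
    intro ω
    rw [w_neg]
    simp only [Complex.mul_re, Complex.add_re, Complex.mul_im, Complex.conj_re, Complex.conj_im,
      Complex.div_ofNat_re, Complex.div_ofNat_im]
    ring
  simp_rw [e]
  have hi : Integrable (fun ω => u * v / 2 * (w X l ω * w X m ω)
      + u * starRingEnd ℂ v / 2 * (w X l ω * w X (-m) ω)) P :=
    ((hI l m).const_mul _).add ((hI l (-m)).const_mul _)
  have hre := integral_re hi
  simp only [RCLike.re_to_complex] at hre
  rw [hre, integral_add ((hI l m).const_mul _) ((hI l (-m)).const_mul _), integral_const_mul,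
    integral_const_mul, hX.integral_w_mul_w h1, hX.integral_w_mul_w (by omega)]
  simp

/-- Jointly Gaussian and uncorrelated in every pair of real directions. Only nonnegative indices can
be independent, as `w_{-n}` is the conjugate of `w_n`; distinct naturals satisfy both `n ≠ m` and `n
+ m ≠ 0`. -/
theorem iIndepFun_w (hX : IsTorusField P X) {α : ℝ} (hA : AssumptionA1 P X α)
    (hB : IsGaussianProcess X P) : iIndepFun (fun n : ℕ => w X n) P := by
  have hG := (hX.isGaussianProcess_w hA hB).comp_right
    (fun p : (_ : ℕ) × Unit => ((p.1 : ℕ) : ℤ))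
  have h := IsGaussianProcess.iIndepFun_of_covariance_inner (T := ℕ) (S := fun _ => Unit)
    (X := fun n _ => w X n) hG (fun n _ => (hX.measurable_w n).aemeasurable) ?_
  · exact h.comp (fun _ f => f ()) fun _ => measurable_pi_apply _
  · intro n m hnm _ _ u v
    have hm : ∀ (u : ℂ) (n : ℤ), MemLp (fun ω => (starRingEnd ℂ u * w X n ω).re) 2 P := fun u n =>
      ((hX.memLp_w n).const_mul _).re
    have hc : ∀ (u : ℂ) (n : ℤ), ∫ ω, (starRingEnd ℂ u * w X n ω).re ∂P = 0 := fun u n => by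
      have hre := integral_re (((hX.memLp_w n).integrable one_le_two).const_mul (starRingEnd ℂ u))
      simp only [RCLike.re_to_complex] at hre
      rw [hre, integral_const_mul, hX.w_centered, mul_zero, Complex.zero_re]
    have e : ∀ (u z : ℂ), inner ℝ u z = (starRingEnd ℂ u * z).re := fun u z => by
      rw [Complex.inner, mul_comm]
    simp_rw [e]
    rw [covariance_eq_sub (hm u n) (hm v m), hc, zero_mul, sub_zero]
    exact hX.integral_ofReal_smul_re _ _ (by omega) (by omega)

end IsTorusField

end TorusNeedlet

namespace TorusNeedlet

variable {Ω : Type*} [MeasurableSpace Ω]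

/-! ### The normalised periodogram -/

/-- The law of `(x² + y²) / 2` for independent standard Gaussians `x` and `y`. -/
def halfChiSq : Measure ℝ :=
  ((gaussianReal 0 1).prod (gaussianReal 0 1)).map fun p => (p.1 ^ 2 + p.2 ^ 2) / 2

theorem measurable_half_sq_add_sq : Measurable fun p : ℝ × ℝ => (p.1 ^ 2 + p.2 ^ 2) / 2 := by
  fun_prop

instance : IsProbabilityMeasure halfChiSq :=
  Measure.isProbabilityMeasure_map measurable_half_sq_add_sq.aemeasurable

theorem allLp_halfChiSq : AllLp (fun x : ℝ => x) halfChiSq := by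
  intro n
  rw [halfChiSq, memLp_map_measure_iff measurable_id'.aestronglyMeasurable
    measurable_half_sq_add_sq.aemeasurable]
  have h1 : AllLp (fun x : ℝ => x ^ 2) (gaussianReal 0 1) := by
    have h : AllLp (fun t : ℝ => t) (gaussianReal 0 1) := fun n => memLp_id_gaussianReal' n (by simp)
    exact h.pow 2
  have h2 : AllLp (fun p : ℝ × ℝ => p.1 ^ 2) ((gaussianReal 0 1).prod (gaussianReal 0 1)) :=
    fun n => (h1 n).comp_fst _
  have h3 : AllLp (fun p : ℝ × ℝ => p.2 ^ 2) ((gaussianReal 0 1).prod (gaussianReal 0 1)) :=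
    fun n => (h1 n).comp_snd _
  have h4 := (h2.add h3).const_mul (1 / 2) n
  refine h4.congr_norm ?_ ?_
  · exact measurable_half_sq_add_sq.aestronglyMeasurable
  · exact ae_of_all _ fun p => by simp only [Function.comp]; congr 1; ring

/-- No atom at zero: this is what later keeps the moments `δ` uniformly positive. -/
theorem halfChiSq_Iic_zero : halfChiSq (Set.Iic 0) = 0 := by
  rw [halfChiSq, Measure.map_apply measurable_half_sq_add_sq measurableSet_Iic]
  have h : (fun p : ℝ × ℝ => (p.1 ^ 2 + p.2 ^ 2) / 2) ⁻¹' Set.Iic 0 ⊆ {0} ×ˢ Set.univ := by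
    rintro ⟨x, y⟩ hp
    simp only [Set.mem_preimage, Set.mem_Iic] at hp
    simp only [Set.mem_prod, Set.mem_singleton_iff, Set.mem_univ, and_true]
    nlinarith [sq_nonneg x, sq_nonneg y]
  refine measure_mono_null h ?_
  have := nullSingletonClass_gaussianReal (μ := 0) (v := 1) one_ne_zero
  rw [Measure.prod_prod, measure_singleton, zero_mul]

theorem exists_halfChiSq_Iic_le {r : ℝ} (hr : 0 < r) : ∃ ε : ℝ, 0 < ε ∧
    halfChiSq.real (Set.Iic ε) ≤ r := by
  have h : Tendsto (fun n : ℕ => halfChiSq (Set.Iic (1 / ((n : ℝ) + 1)))) atTop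
      (𝓝 (halfChiSq (⋂ n : ℕ, Set.Iic (1 / ((n : ℝ) + 1))))) := by
    refine tendsto_measure_iInter_atTop (fun n => measurableSet_Iic.nullMeasurableSet) ?_
      ⟨0, measure_ne_top _ _⟩
    intro n m hnm
    exact Set.Iic_subset_Iic.2 (one_div_le_one_div_of_le (by positivity) (by gcongr))
  have e : (⋂ n : ℕ, Set.Iic (1 / ((n : ℝ) + 1))) = Set.Iic (0 : ℝ) := by
    ext x
    simp only [Set.mem_iInter, Set.mem_Iic]
    refine ⟨fun hx => ge_of_tendsto' tendsto_one_div_add_atTop_nhds_zero_nat hx, fun hx n => hx.trans (by positivity)⟩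
  rw [e, halfChiSq_Iic_zero] at h
  have h2 := (ENNReal.tendsto_toReal ENNReal.zero_ne_top).comp h
  obtain ⟨n, hn⟩ := (h2.eventually_lt_const (u := r) (by simpa using hr)).exists
  exact ⟨1 / ((n : ℝ) + 1), by positivity, hn.le⟩

/-- A family of normalised periodogram ordinates: `u (-l) = u l`, the `u l` with `l ≥ 0` are
independent, and the law of `u l` is `halfChiSq` for `l ≠ 0`. -/
structure IsPowerFamily (P : Measure Ω) (u : ℤ → Ω → ℝ) : Prop where
  measurable : ∀ l, Measurable (u l)
  nonneg : ∀ l ω, 0 ≤ u l ω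
  even : ∀ l, u (-l) = u l
  indep : iIndepFun (fun n : ℕ => u n) P
  map_eq : ∀ l, l ≠ 0 → P.map (u l) = halfChiSq

namespace IsTorusField

variable {P : Measure Ω} {X : Torus → Ω → ℝ} [IsProbabilityMeasure P]

/-- The vanishing of `E w_l²` says that real and imaginary parts are uncorrelated with equal
variances, each being `C_l / 2`; Gaussianity upgrades this to independence. -/
theorem map_re_im_w (hX : IsTorusField P X) {α : ℝ} (hA : AssumptionA1 P X α)
    (hB : IsGaussianProcess X P) {l : ℤ} (hl : l ≠ 0) :
    P.map (fun ω => (√(2 / C P X l) * (w X l ω).re, √(2 / C P X l) * (w X l ω).im))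
      = (gaussianReal 0 1).prod (gaussianReal 0 1) := by
  have hCpos : 0 < C P X l := by
    obtain ⟨c₁, c₂, hc₁, -, hC⟩ := C_le_of_assumptionA1 hA
    refine lt_of_lt_of_le ?_ (hC l hl).1
    have : (0 : ℝ) < |(l : ℝ)| := by positivity
    positivity
  set r := √(2 / C P X l) with hr
  have hr2 : r ^ 2 * C P X l = 2 := by
    rw [hr, Real.sq_sqrt (by positivity)]
    field_simp
  have hw : HasGaussianLaw (w X l) P := (hX.isGaussianProcess_w hA hB).hasGaussianLaw_eval l
  have hpair : HasGaussianLaw (fun ω => (r * (w X l ω).re, r * (w X l ω).im)) P :=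
    hw.map_fun ((r • Complex.reCLM).prod (r • Complex.imCLM))
  have hre : MemLp (fun ω => (w X l ω).re) 2 P := (hX.memLp_w l).re
  have him : MemLp (fun ω => (w X l ω).im) 2 P := (hX.memLp_w l).im
  have hI : Integrable (w X l) P := (hX.memLp_w l).integrable one_le_two
  have mre : ∫ ω, (w X l ω).re ∂P = 0 := by
    have := integral_re hI
    simp only [RCLike.re_to_complex] at this
    rw [this, hX.w_centered, Complex.zero_re]
  have mim : ∫ ω, (w X l ω).im ∂P = 0 := by
    have := integral_im hI
    simp only [RCLike.im_to_complex] at this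
    rw [this, hX.w_centered, Complex.zero_im]
  have hww : Integrable (fun ω => w X l ω * w X l ω) P := (hX.memLp_w l).integrable_mul (hX.memLp_w l)
  have h0 := hX.integral_w_mul_w (l := l) (m := l) (by omega)
  have hd : ∫ ω, (w X l ω).re ^ 2 ∂P - ∫ ω, (w X l ω).im ^ 2 ∂P = 0 := by
    have := integral_re hww
    simp only [RCLike.re_to_complex, h0, Complex.mul_re, Complex.zero_re] at this
    rw [← integral_sub hre.integrable_sq him.integrable_sq]
    simpa only [sq] using this
  have hs : ∫ ω, (w X l ω).re ^ 2 ∂P + ∫ ω, (w X l ω).im ^ 2 ∂P = C P X l := by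
    rw [← integral_add hre.integrable_sq him.integrable_sq, C]
    congr 1; ext ω
    rw [← Complex.normSq_eq_norm_sq, Complex.normSq_apply]
    ring
  have hc : ∫ ω, (w X l ω).re * (w X l ω).im ∂P = 0 := by
    have := integral_im hww
    simp only [RCLike.im_to_complex, h0, Complex.mul_im, Complex.zero_im] at this
    have e : ∀ ω, (w X l ω).re * (w X l ω).im + (w X l ω).im * (w X l ω).re
        = 2 * ((w X l ω).re * (w X l ω).im) := fun ω => by ring
    simp_rw [e] at this
    rw [integral_const_mul] at this
    linarith
  have hcov : cov[fun ω => r * (w X l ω).re, fun ω => r * (w X l ω).im; P] = 0 := by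
    rw [covariance_const_mul_left, covariance_const_mul_right, covariance_eq_sub hre him]
    simp [mre, hc]
  have hind := hpair.indepFun_of_covariance_eq_zero hcov
  have h1 : P.map (fun ω => r * (w X l ω).re) = gaussianReal 0 1 := by
    rw [hpair.fst.map_eq_gaussianReal, integral_const_mul, mre, mul_zero, variance_const_mul,
      variance_eq_sub hre, mre]
    congr 1
    rw [Real.toNNReal_eq_one]
    simp only [Pi.pow_apply]
    nlinarith
  have h2 : P.map (fun ω => r * (w X l ω).im) = gaussianReal 0 1 := by
    rw [hpair.snd.map_eq_gaussianReal, integral_const_mul, mim, mul_zero, variance_const_mul,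
      variance_eq_sub him, mim]
    congr 1
    rw [Real.toNNReal_eq_one]
    simp only [Pi.pow_apply]
    nlinarith
  rw [(indepFun_iff_map_prod_eq_prod_map_map hpair.fst.aemeasurable hpair.snd.aemeasurable).1 hind,
    h1, h2]

theorem isPowerFamily (hX : IsTorusField P X) {α : ℝ} (hA : AssumptionA1 P X α)
    (hB : IsGaussianProcess X P) : IsPowerFamily P fun l ω => ‖w X l ω‖ ^ 2 / C P X l := by
  refine ⟨fun l => ((hX.measurable_w l).norm.pow_const 2).div_const _, fun l ω => ?_, fun l => ?_,
    ?_, fun l hl => ?_⟩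
  · exact div_nonneg (sq_nonneg _) (integral_nonneg fun _ => sq_nonneg _)
  · ext ω
    rw [w_neg, RCLike.norm_conj, C_neg]
  · exact (hX.iIndepFun_w hA hB).comp (fun (n : ℕ) z => ‖z‖ ^ 2 / C P X n)
      fun n => (measurable_norm.pow_const 2).div_const _
  · have hm : Measurable (fun ω => (√(2 / C P X l) * (w X l ω).re, √(2 / C P X l) * (w X l ω).im)) :=
      ((Complex.measurable_re.comp (hX.measurable_w l)).const_mul _).prodMk
        ((Complex.measurable_im.comp (hX.measurable_w l)).const_mul _)
    rw [halfChiSq, ← hX.map_re_im_w hA hB hl, Measure.map_map measurable_half_sq_add_sq hm]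
    congr 1
    ext ω
    have hC0 : 0 ≤ C P X l := integral_nonneg fun _ => sq_nonneg _
    simp only [Function.comp, mul_pow, Real.sq_sqrt (div_nonneg two_pos.le hC0)]
    rw [← Complex.normSq_eq_norm_sq, Complex.normSq_apply]
    ring

end IsTorusField

namespace IsPowerFamily

variable {P : Measure Ω} {u : ℤ → Ω → ℝ}

theorem natAbs_eq (hu : IsPowerFamily P u) (l : ℤ) : u l = u (l.natAbs : ℤ) := by
  rcases Int.natAbs_eq l with h | h
  · rw [← h]
  · conv_lhs => rw [h, hu.even]

theorem allLp (hu : IsPowerFamily P u) {l : ℤ} (hl : l ≠ 0) : AllLp (u l) P := fun n => by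
  have h := allLp_halfChiSq n
  rw [← hu.map_eq l hl] at h
  exact (memLp_map_measure_iff measurable_id'.aestronglyMeasurable (hu.measurable l).aemeasurable).1 h

theorem integral_comp (hu : IsPowerFamily P u) {l : ℤ} (hl : l ≠ 0) {f : ℝ → ℝ}
    (hf : Measurable f) : ∫ ω, f (u l ω) ∂P = ∫ x, f x ∂halfChiSq := by
  rw [← hu.map_eq l hl, integral_map (hu.measurable l).aemeasurable hf.aestronglyMeasurable]

end IsPowerFamily

/-- Bounds moments of products by one-dimensional moments without independence, so repeated and
opposite frequencies need no separate treatment. -/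
theorem prod_le_sum_pow {ι : Type*} [Fintype ι] [Nonempty ι] (x : ι → ℝ) (hx : ∀ i, 0 ≤ x i) :
    ∏ i, x i ≤ ∑ i, x i ^ Fintype.card ι := by
  obtain ⟨i, -, hi⟩ := Finset.exists_max_image Finset.univ x Finset.univ_nonempty
  calc ∏ j, x j ≤ ∏ _j : ι, x i := Finset.prod_le_prod (fun j _ => hx j) fun j hj => hi j hj
    _ = x i ^ Fintype.card ι := by simp
    _ ≤ _ := Finset.single_le_sum (f := fun i => x i ^ Fintype.card ι)
      (fun j _ => pow_nonneg (hx j) _) (Finset.mem_univ i)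

namespace IsPowerFamily

variable {P : Measure Ω} {u : ℤ → Ω → ℝ} [IsProbabilityMeasure P]

theorem allLp_prod (hu : IsPowerFamily P u) {ι : Type*} [Fintype ι] {l : ι → ℤ}
    (hl : ∀ i, l i ≠ 0) : AllLp (fun ω => ∏ i, u (l i) ω) P := by
  classical
  have : ∀ s : Finset ι, AllLp (fun ω => ∏ i ∈ s, u (l i) ω) P := fun s => by
    induction s using Finset.induction_on with
    | empty => simpa using AllLp.const (μ := P) (1 : ℝ)
    | insert i s hi ih =>
      simp_rw [Finset.prod_insert hi]
      exact (hu.allLp (hl i)).mul ih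
  exact this _

/-- Moments of products of normalised periodogram ordinates are bounded uniformly in the
frequencies. -/
theorem integral_prod_one_add_pow_le (hu : IsPowerFamily P u) {ι : Type*} [Fintype ι] [Nonempty ι]
    {l : ι → ℤ} (hl : ∀ i, l i ≠ 0) (k : ℕ) :
    ∫ ω, (∏ i, (1 + u (l i) ω)) ^ k ∂P
      ≤ Fintype.card ι * ∫ x, (1 + x) ^ (k * Fintype.card ι) ∂halfChiSq := by
  have h1 : ∀ i, AllLp (fun ω => 1 + u (l i) ω) P := fun i =>
    (AllLp.const (μ := P) (1 : ℝ)).add (hu.allLp (hl i))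
  calc ∫ ω, (∏ i, (1 + u (l i) ω)) ^ k ∂P
      ≤ ∫ ω, ∑ i, (1 + u (l i) ω) ^ (k * Fintype.card ι) ∂P := by
        refine integral_mono_of_nonneg (ae_of_all _ fun ω => ?_)
          (integrable_finsetSum _ fun i _ => ((h1 i).pow _).integrable) (ae_of_all _ fun ω => ?_)
        · exact pow_nonneg (Finset.prod_nonneg fun i _ => by have := hu.nonneg (l i) ω; positivity) _
        · simp_rw [pow_mul, ← Finset.prod_pow]
          exact prod_le_sum_pow _ fun i => by have := hu.nonneg (l i) ω; positivity
    _ = _ := by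
        rw [integral_finsetSum _ fun i _ => ((h1 i).pow _).integrable]
        have h2 : ∀ i, ∫ ω, (1 + u (l i) ω) ^ (k * Fintype.card ι) ∂P
            = ∫ x, (1 + x) ^ (k * Fintype.card ι) ∂halfChiSq := fun i =>
          hu.integral_comp (hl i) (f := fun x => (1 + x) ^ (k * Fintype.card ι)) (by fun_prop)
        simp [h2]

/-- A lower bound for `δ` uniform in the frequencies. Choose `ε` so that each factor is at most `ε`
with probability at most `1/(2(p+1))`; by the union bound all factors exceed `ε` with probability at
least `1/2`, whatever their dependence. -/
theorem exists_le_integral_prod (p : ℕ) : ∃ c : ℝ, 0 < c ∧ ∀ {Ω : Type _} [MeasurableSpace Ω]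
    {P : Measure Ω} [IsProbabilityMeasure P] {u : ℤ → Ω → ℝ}, IsPowerFamily P u →
    ∀ l : Fin p → ℤ, (∀ i, l i ≠ 0) → c ≤ ∫ ω, ∏ i, u (l i) ω ∂P := by
  obtain ⟨ε, hε, h⟩ := exists_halfChiSq_Iic_le (r := 1 / (2 * (p + 1))) (by positivity)
  refine ⟨ε ^ p / 2, by positivity, fun {Ω} _ {P} _ {u} hu l hl => ?_⟩
  set B : Set Ω := ⋃ i, u (l i) ⁻¹' Set.Iic ε with hB
  have hBm : MeasurableSet B := MeasurableSet.iUnion fun i => hu.measurable _ measurableSet_Iic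
  have hBle : P.real B ≤ 1 / 2 := by
    calc P.real B ≤ ∑ i, P.real (u (l i) ⁻¹' Set.Iic ε) := measureReal_iUnion_fintype_le _
      _ ≤ ∑ _i : Fin p, 1 / (2 * ((p : ℝ) + 1)) := by
          refine Finset.sum_le_sum fun i _ => ?_
          rw [← hu.map_eq (l i) (hl i), measureReal_def,
            Measure.map_apply (hu.measurable _) measurableSet_Iic] at h
          exact h
      _ ≤ 1 / 2 := by
          simp only [Finset.sum_const, Finset.card_univ, Fintype.card_fin, nsmul_eq_mul]
          rw [mul_one_div, div_le_div_iff₀ (by positivity) (by norm_num)]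
          linarith
  have hint := (hu.allLp_prod hl).integrable
  have hBc : 1 / 2 ≤ P.real Bᶜ := by
    rw [probReal_compl_eq_one_sub hBm]
    linarith
  calc ε ^ p / 2 ≤ ε ^ p * P.real Bᶜ := by nlinarith [pow_pos hε p]
    _ ≤ ∫ ω in Bᶜ, ∏ i, u (l i) ω ∂P := by
        have := setIntegral_ge_of_const_le_real (μ := P) (s := Bᶜ) (c := ε ^ p) (f := fun ω => ∏ i, u (l i) ω)
          hBm.compl (measure_ne_top _ _) (fun ω hω => ?_) hint.integrableOn
        · exact this
        · have hω' : ∀ i, ε ≤ u (l i) ω := fun i => by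
            simp only [hB, Set.mem_compl_iff, Set.mem_iUnion, Set.mem_preimage, Set.mem_Iic,
              not_exists, not_le] at hω
            exact (hω i).le
          calc ε ^ p = ∏ _i : Fin p, ε := by simp
            _ ≤ _ := Finset.prod_le_prod (fun _ _ => hε.le) fun i _ => hω' i
    _ ≤ ∫ ω, ∏ i, u (l i) ω ∂P :=
        setIntegral_le_integral hint (ae_of_all _ fun ω => Finset.prod_nonneg fun i _ => hu.nonneg _ _)

omit [IsProbabilityMeasure P] in
theorem integral_prod_mul_prod (hu : IsPowerFamily P u) {ι κ : Type*} [Fintype ι] [Fintype κ]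
    {l : ι → ℤ} {m : κ → ℤ} (h : ∀ i j, |l i| ≠ |m j|) :
    ∫ ω, (∏ i, u (l i) ω) * ∏ j, u (m j) ω ∂P
      = (∫ ω, ∏ i, u (l i) ω ∂P) * ∫ ω, ∏ j, u (m j) ω ∂P := by
  classical
  set s : Finset ℕ := Finset.univ.image fun i => (l i).natAbs
  set t : Finset ℕ := Finset.univ.image fun j => (m j).natAbs
  have hst : Disjoint s t := by
    rw [Finset.disjoint_left]
    intro n hn hn'
    obtain ⟨i, -, hi⟩ := Finset.mem_image.1 hn
    obtain ⟨j, -, hj⟩ := Finset.mem_image.1 hn'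
    apply h i j
    rw [Int.abs_eq_natAbs, Int.abs_eq_natAbs, hi, hj]
  have hind := hu.indep.indepFun_finset s t hst fun n => hu.measurable n
  have hs : ∀ i, (l i).natAbs ∈ s := fun i => Finset.mem_image_of_mem _ (Finset.mem_univ i)
  have ht : ∀ j, (m j).natAbs ∈ t := fun j => Finset.mem_image_of_mem _ (Finset.mem_univ j)
  have hind2 := hind.comp (φ := fun f => ∏ i, f ⟨_, hs i⟩) (ψ := fun f => ∏ j, f ⟨_, ht j⟩)
    (by fun_prop) (by fun_prop)
  have e1 : (fun f : s → ℝ => ∏ i, f ⟨_, hs i⟩) ∘ (fun ω (n : s) => u ((n : ℕ) : ℤ) ω)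
      = fun ω => ∏ i, u (l i) ω := by
    ext ω
    exact Finset.prod_congr rfl fun i _ => (congrFun (hu.natAbs_eq (l i)) ω).symm
  have e2 : (fun f : t → ℝ => ∏ j, f ⟨_, ht j⟩) ∘ (fun ω (n : t) => u ((n : ℕ) : ℤ) ω)
      = fun ω => ∏ j, u (m j) ω := by
    ext ω
    exact Finset.prod_congr rfl fun j _ => (congrFun (hu.natAbs_eq (m j)) ω).symm
  rw [e1, e2] at hind2
  exact hind2.integral_fun_mul_eq_mul_integral
    (Finset.measurable_prod _ fun i _ => hu.measurable _).aestronglyMeasurable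
    (Finset.measurable_prod _ fun i _ => hu.measurable _).aestronglyMeasurable

end IsPowerFamily

end TorusNeedlet

namespace TorusNeedlet

variable {Ω : Type*} [MeasurableSpace Ω]

/-! ### Weights on resonant tuples of frequencies -/

theorem abs_le_of_mem_band {N : ℕ} {l : ℤ} (hl : l ∈ band N) : 2 * |l| ≤ N := by
  simp only [band, Finset.mem_filter] at hl
  exact hl.2.2

theorem ne_zero_of_mem_band {N : ℕ} (hN : N ≠ 0) {l : ℤ} (hl : l ∈ band N) : l ≠ 0 := by
  simp only [band, Finset.mem_filter] at hl
  rintro rfl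
  simp at hl
  omega

theorem neg_mem_band {N : ℕ} {l : ℤ} : -l ∈ band N ↔ l ∈ band N := by
  simp only [band, Finset.mem_filter, Finset.mem_Icc, abs_neg]
  constructor <;> rintro ⟨h, h'⟩ <;> exact ⟨by omega, h'⟩

/-- Two frequencies of the band differ by at most `N`, so those in one residue class are among `l₀ -
N`, `l₀`, `l₀ + N`. -/
theorem card_filter_dvd_le {N : ℕ} (r : ℤ) :
    ((band N).filter fun l => (N : ℤ) ∣ r + l).card ≤ 3 := by
  rcases ((band N).filter fun l => (N : ℤ) ∣ r + l).eq_empty_or_nonempty with h | ⟨l₀, h₀⟩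
  · simp [h]
  · have hsub : ((band N).filter fun l => (N : ℤ) ∣ r + l) ⊆ {l₀ - N, l₀, l₀ + N} := by
      intro l hl
      rw [Finset.mem_filter] at h₀ hl
      obtain ⟨k, hk⟩ : (N : ℤ) ∣ l - l₀ := by
        have := dvd_sub hl.2 h₀.2
        rwa [add_sub_add_left_eq_sub] at this
      have h1 : |l - l₀| ≤ N := by
        have := abs_sub l l₀
        have h2 := abs_le_of_mem_band hl.1
        have h3 := abs_le_of_mem_band h₀.1
        linarith
      simp only [Finset.mem_insert, Finset.mem_singleton]
      rcases Nat.eq_zero_or_pos N with h0 | hpos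
      · subst h0
        right; left
        simp at hk
        omega
      · have hk1 : |k| ≤ 1 := by
          rw [hk, abs_mul, Nat.abs_cast] at h1
          have : (0 : ℤ) < N := by exact_mod_cast hpos
          nlinarith
        rw [abs_le] at hk1
        have : k = -1 ∨ k = 0 ∨ k = 1 := by omega
        rcases this with rfl | rfl | rfl
        · left; linarith
        · right; left; linarith
        · right; right; linarith
    exact (Finset.card_le_card hsub).trans Finset.card_le_three

theorem sum_piFinset_insertNth {R : Type*} [AddCommMonoid R] {n : ℕ} (i : Fin (n + 1)) (s : Finset ℤ)
    (f : (Fin (n + 1) → ℤ) → R) :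
    ∑ l ∈ Fintype.piFinset (fun _ : Fin (n + 1) => s), f l
      = ∑ m ∈ s, ∑ l ∈ Fintype.piFinset (fun _ : Fin n => s), f (i.insertNth m l) := by
  rw [← Finset.sum_product']
  refine Finset.sum_nbij' (fun l => (l i, i.removeNth l)) (fun q => i.insertNth q.1 q.2) ?_ ?_ ?_ ?_ ?_
  · intro l hl
    simp only [Fintype.mem_piFinset, Finset.mem_product] at hl ⊢
    exact ⟨hl _, fun j => hl _⟩
  · rintro ⟨m, l⟩ hl
    simp only [Fintype.mem_piFinset, Finset.mem_product] at hl ⊢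
    intro j
    refine Fin.succAboveCases i ?_ (fun k => ?_) j
    · simpa using hl.1
    · simpa using hl.2 k
  · intro l _
    simp
  · rintro ⟨m, l⟩ _
    simp
  · intro l _
    simp

/-- Nonnegative weights of total mass one on the frequency band, none of them above `K / N`. -/
structure IsBandWeight (N : ℕ) (h : ℤ → ℝ) (K : ℝ) : Prop where
  pos : 0 < N
  nonneg : ∀ l, 0 ≤ h l
  le : ∀ l ∈ band N, h l ≤ K / N
  sum_eq : ∑ l ∈ band N, h l = 1

/-- The weight `N ∏ᵢ h(lᵢ)` of a tuple whose frequencies add up to a multiple of `N`. -/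
def resWeight (N : ℕ) (h : ℤ → ℝ) {p : ℕ} (l : Fin p → ℤ) : ℝ :=
  (if (N : ℤ) ∣ ∑ i, l i then (N : ℝ) else 0) * ∏ i, h (l i)

/-- All tuples of length `p` in the frequency band. -/
abbrev bandTuples (p N : ℕ) : Finset (Fin p → ℤ) := Fintype.piFinset fun _ : Fin p => band N

namespace IsBandWeight

variable {N : ℕ} {h : ℤ → ℝ} {K : ℝ}

theorem K_nonneg (hh : IsBandWeight N h K) : 0 ≤ K := by
  have hne : (band N).Nonempty := by
    by_contra h0
    have := hh.sum_eq
    rw [Finset.not_nonempty_iff_eq_empty.1 h0] at this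
    simp at this
  obtain ⟨l, hl⟩ := hne
  have h1 := (hh.nonneg l).trans (hh.le l hl)
  have h2 : (0 : ℝ) < N := by exact_mod_cast hh.pos
  by_contra h3
  exact absurd h1 (not_le.2 (div_neg_of_neg_of_pos (not_le.1 h3) h2))

theorem resWeight_nonneg (hh : IsBandWeight N h K) {p : ℕ} (l : Fin p → ℤ) : 0 ≤ resWeight N h l :=
  mul_nonneg (by split_ifs <;> positivity) (Finset.prod_nonneg fun i _ => hh.nonneg _)

/-- Given the other coordinates, the last one lies in a residue class modulo `N`, hence takes at
most three values, each of weight at most `K/N`; the other coordinates sum to one. The shift `r`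
absorbs the coordinates removed by the induction. -/
theorem sum_dvd_le (hh : IsBandWeight N h K) (n : ℕ) (r : ℤ) :
    ∑ l ∈ bandTuples (n + 1) N, (if (N : ℤ) ∣ r + ∑ i, l i then (N : ℝ) else 0) * ∏ i, h (l i)
      ≤ 3 * K := by
  have hN : (0 : ℝ) < N := by exact_mod_cast hh.pos
  induction n generalizing r with
  | zero =>
    rw [sum_piFinset_insertNth 0]
    have e : ∀ m : ℤ, ∑ l ∈ bandTuples 0 N,
        (if (N : ℤ) ∣ r + ∑ i, (Fin.insertNth (α := fun _ : Fin 1 => ℤ) 0 m l) i then (N : ℝ) else 0) *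
          ∏ i, h ((Fin.insertNth (α := fun _ : Fin 1 => ℤ) 0 m l) i)
        = if (N : ℤ) ∣ r + m then N * h m else 0 := fun m => by
      rw [bandTuples, Fintype.piFinset_of_isEmpty, Finset.univ_unique, Finset.sum_singleton, Fin.sum_univ_one,
        Fin.prod_univ_one, Fin.insertNth_apply_same, ite_mul, zero_mul]
    rw [Finset.sum_congr rfl fun m _ => e m, ← Finset.sum_filter]
    calc ∑ l ∈ (band N).filter (fun l => (N : ℤ) ∣ r + l), N * h l
        ≤ ((band N).filter fun l => (N : ℤ) ∣ r + l).card • K := by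
          refine Finset.sum_le_card_nsmul _ _ _ fun l hl => ?_
          have := hh.le l (Finset.mem_filter.1 hl).1
          rw [le_div_iff₀ hN] at this
          linarith
      _ ≤ 3 * K := by
          rw [nsmul_eq_mul]
          gcongr
          · exact hh.K_nonneg
          · exact_mod_cast card_filter_dvd_le r
  | succ n ih =>
    rw [sum_piFinset_insertNth 0]
    simp only [Fin.sum_univ_succAbove _ (0 : Fin (n + 1 + 1)), Fin.insertNth_apply_same,
      Fin.insertNth_apply_succAbove, Fin.prod_univ_succAbove _ (0 : Fin (n + 1 + 1))]
    calc _ = ∑ m ∈ band N, h m * ∑ l ∈ bandTuples (n + 1) N,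
            (if (N : ℤ) ∣ (r + m) + ∑ i, l i then (N : ℝ) else 0) * ∏ i, h (l i) := by
          refine Finset.sum_congr rfl fun m _ => ?_
          rw [Finset.mul_sum]
          refine Finset.sum_congr rfl fun l _ => ?_
          rw [add_assoc]
          ring
      _ ≤ ∑ m ∈ band N, h m * (3 * K) := by
          gcongr with m _
          · exact hh.nonneg m
          · exact ih (r + m)
      _ = 3 * K := by rw [← Finset.sum_mul, hh.sum_eq, one_mul]

theorem sum_resWeight_le (hh : IsBandWeight N h K) (p : ℕ) (hp : p ≠ 0) :
    ∑ l ∈ bandTuples p N, resWeight N h l ≤ 3 * K := by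
  obtain ⟨n, rfl⟩ := Nat.exists_eq_succ_of_ne_zero hp
  simpa [resWeight] using hh.sum_dvd_le n 0

/-- The fixed coordinate contributes at most `K/N`, and the remaining ones still satisfy a shifted
congruence. This requires another coordinate to be left, hence length `n + 2`. -/
theorem sum_resWeight_filter_le (hh : IsBandWeight N h K) (n : ℕ) (i : Fin (n + 2)) (m : ℤ) :
    ∑ l ∈ (bandTuples (n + 2) N).filter (fun l => l i = m), resWeight N h l ≤ 3 * K ^ 2 / N := by
  rw [Finset.sum_filter, sum_piFinset_insertNth i]
  simp only [Fin.insertNth_apply_same]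
  have hN : (0 : ℝ) < N := by exact_mod_cast hh.pos
  have e : ∀ m' ∈ band N, ∑ l ∈ bandTuples (n + 1) N,
      (if m' = m then resWeight N h (i.insertNth m' l) else 0) ≤ if m' = m then 3 * K ^ 2 / N else 0 := by
    intro m' hm'
    split_ifs with hmm
    · simp only [resWeight, Fin.sum_univ_succAbove _ i, Fin.insertNth_apply_same,
        Fin.insertNth_apply_succAbove, Fin.prod_univ_succAbove _ i]
      calc _ = h m' * ∑ l ∈ bandTuples (n + 1) N,
            (if (N : ℤ) ∣ m' + ∑ i, l i then (N : ℝ) else 0) * ∏ i, h (l i) := by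
            rw [Finset.mul_sum]
            refine Finset.sum_congr rfl fun l _ => ?_
            ring
        _ ≤ K / N * (3 * K) := by
            have h3 := hh.sum_dvd_le n m'
            have hK := hh.K_nonneg
            have := hh.le m' hm'
            gcongr
            · exact Finset.sum_nonneg fun l _ => mul_nonneg (by split_ifs <;> positivity) (Finset.prod_nonneg fun i _ => hh.nonneg _)
        _ = 3 * K ^ 2 / N := by ring
    · simp
  refine (Finset.sum_le_sum e).trans ?_
  rw [Finset.sum_ite_eq' ]
  split_ifs
  · exact le_rfl
  · positivity

/-- Tuples sharing a frequency, up to sign, with a given one carry little weight. -/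
theorem sum_resWeight_share_le (hh : IsBandWeight N h K) (n : ℕ) (l : Fin (n + 2) → ℤ) :
    ∑ l' ∈ (bandTuples (n + 2) N).filter (fun l' => ∃ i j, |l i| = |l' j|), resWeight N h l'
      ≤ 2 * (n + 2) ^ 2 * (3 * K ^ 2 / N) := by
  have hle : ∀ l', (if ∃ i j, |l i| = |l' j| then resWeight N h l' else 0)
      ≤ ∑ q : (Fin (n + 2) × Fin (n + 2)) × Bool,
          if l' q.1.2 = if q.2 then l q.1.1 else -l q.1.1 then resWeight N h l' else 0 := by
    intro l'
    have h0 : ∀ q ∈ (Finset.univ : Finset ((Fin (n + 2) × Fin (n + 2)) × Bool)),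
        0 ≤ if l' q.1.2 = if q.2 then l q.1.1 else -l q.1.1 then resWeight N h l' else 0 :=
      fun q _ => by
        split_ifs
        exacts [hh.resWeight_nonneg l', le_rfl, hh.resWeight_nonneg l', le_rfl]
    split_ifs with hs
    · obtain ⟨i, j, hij⟩ := hs
      rcases abs_eq_abs.1 hij with h1 | h1
      · have := Finset.single_le_sum h0 (Finset.mem_univ ((i, j), true))
        simpa [h1] using this
      · have := Finset.single_le_sum h0 (Finset.mem_univ ((i, j), false))
        simpa [h1] using this
    · exact Finset.sum_nonneg h0
  rw [Finset.sum_filter]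
  calc _ ≤ ∑ l' ∈ bandTuples (n + 2) N, ∑ q : (Fin (n + 2) × Fin (n + 2)) × Bool,
          (if l' q.1.2 = if q.2 then l q.1.1 else -l q.1.1 then resWeight N h l' else 0) :=
        Finset.sum_le_sum fun l' _ => hle l'
    _ = ∑ q : (Fin (n + 2) × Fin (n + 2)) × Bool, ∑ l' ∈ (bandTuples (n + 2) N).filter
          fun l' => l' q.1.2 = if q.2 then l q.1.1 else -l q.1.1, resWeight N h l' := by
        rw [Finset.sum_comm]
        exact Finset.sum_congr rfl fun q _ => (Finset.sum_filter _ _).symm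
    _ ≤ ∑ _q : (Fin (n + 2) × Fin (n + 2)) × Bool, 3 * K ^ 2 / N :=
        Finset.sum_le_sum fun q _ => hh.sum_resWeight_filter_le n _ _
    _ = _ := by
        rw [Finset.sum_const, nsmul_eq_mul]
        simp only [Finset.card_univ, Fintype.card_prod, Fintype.card_fin, Fintype.card_bool]
        push_cast
        ring

end IsBandWeight

/-! ### Polynomial forms in the periodogram -/

/-- The form `∑_l κ_l ∏ᵢ x(lᵢ) / E ∏ᵢ u(lᵢ)`. -/
def powerForm (P : Measure Ω) (u : ℤ → Ω → ℝ) {p : ℕ} (T : Finset (Fin p → ℤ))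
    (κ : (Fin p → ℤ) → ℝ) (x : ℤ → ℝ) : ℝ :=
  ∑ l ∈ T, κ l * ((∏ i, x (l i)) / ∫ ω, ∏ i, u (l i) ω ∂P)

/-- The error is measured against `1 + x_i` rather than `x_i`, since `|w̃_l|²` need not be close to
`|w_l|²` in relative terms when the latter is small. -/
theorem abs_prod_sub_prod_le {ι : Type*} (s : Finset ι) {x y : ι → ℝ} {t : ℝ} (ht : 0 ≤ t)
    (hx : ∀ i ∈ s, 0 ≤ x i) (hxy : ∀ i ∈ s, |y i - x i| ≤ t * (1 + x i)) :
    |∏ i ∈ s, y i - ∏ i ∈ s, x i| ≤ ((1 + t) ^ s.card - 1) * ∏ i ∈ s, (1 + x i) := by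
  classical
  induction s using Finset.induction_on with
  | empty => simp
  | insert i s hi ih =>
    have hx' : ∀ i ∈ s, 0 ≤ x i := fun j hj => hx j (Finset.mem_insert_of_mem hj)
    have ih := ih hx' fun j hj => hxy j (Finset.mem_insert_of_mem hj)
    have hxi := hx i (Finset.mem_insert_self _ _)
    have hyi := hxy i (Finset.mem_insert_self _ _)
    rw [Finset.prod_insert hi, Finset.prod_insert hi, Finset.prod_insert hi,
      Finset.card_insert_of_notMem hi]
    have hle : ∏ j ∈ s, x j ≤ ∏ j ∈ s, (1 + x j) :=
      Finset.prod_le_prod hx' fun j _ => by linarith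
    have h0 : 0 ≤ ∏ j ∈ s, x j := Finset.prod_nonneg hx'
    set A := ∏ j ∈ s, (1 + x j)
    have hy : |∏ j ∈ s, y j| ≤ (1 + t) ^ s.card * A := by
      calc |∏ j ∈ s, y j| = |(∏ j ∈ s, y j - ∏ j ∈ s, x j) + ∏ j ∈ s, x j| := by ring_nf
        _ ≤ |∏ j ∈ s, y j - ∏ j ∈ s, x j| + |∏ j ∈ s, x j| := abs_add_le _ _
        _ ≤ ((1 + t) ^ s.card - 1) * A + A := by
            rw [abs_of_nonneg h0]
            exact add_le_add ih hle
        _ = _ := by ring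
    calc |y i * ∏ j ∈ s, y j - x i * ∏ j ∈ s, x j|
        = |(y i - x i) * ∏ j ∈ s, y j + x i * (∏ j ∈ s, y j - ∏ j ∈ s, x j)| := by ring_nf
      _ ≤ |y i - x i| * |∏ j ∈ s, y j| + x i * |∏ j ∈ s, y j - ∏ j ∈ s, x j| := by
          refine (abs_add_le _ _).trans (le_of_eq ?_)
          rw [abs_mul, abs_mul, abs_of_nonneg hxi]
      _ ≤ (t * (1 + x i)) * ((1 + t) ^ s.card * A) + (1 + x i) * (((1 + t) ^ s.card - 1) * A) := by
          have : 0 ≤ ((1 + t) ^ s.card - 1) * A := (abs_nonneg _).trans ih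
          gcongr
          linarith
      _ = _ := by ring

theorem one_add_pow_sub_one_le {t : ℝ} (ht : 0 ≤ t) (ht' : t ≤ 2) (p : ℕ) :
    (1 + t) ^ p - 1 ≤ t * (p * 3 ^ p) := by
  induction p with
  | zero => simp
  | succ p ih =>
    have h1 : (1 + t) ^ p ≤ 3 ^ p := by gcongr; linarith
    have h3 : (0 : ℝ) ≤ 3 ^ p := by positivity
    have h2 : (0 : ℝ) ≤ t * (p * 3 ^ p) := by positivity
    push_cast
    calc (1 + t) ^ (p + 1) - 1 = ((1 + t) ^ p - 1) + t * (1 + t) ^ p := by ring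
      _ ≤ t * (p * 3 ^ p) + t * 3 ^ p := by gcongr
      _ ≤ _ := by rw [pow_succ]; nlinarith [mul_nonneg ht h3]

namespace IsPowerFamily

variable {P : Measure Ω} {u : ℤ → Ω → ℝ} [IsProbabilityMeasure P]

/-- The normalised products have mean one, so the form has mean `∑ κ`. Its variance involves only
pairs of tuples sharing a frequency up to sign, the others being independent; shared pairs are
bounded by Cauchy-Schwarz. Here `A` bounds the total weight and `ε` the weight meeting a given
tuple, while `B` depends on neither. -/
theorem exists_powerForm_bounds (hu : IsPowerFamily P u) {p : ℕ} (hp : p ≠ 0) : ∃ B : ℝ, 0 ≤ B ∧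
    ∀ (T : Finset (Fin p → ℤ)) (κ : (Fin p → ℤ) → ℝ) (A ε : ℝ), 0 ≤ ε → (∀ l ∈ T, ∀ i, l i ≠ 0) →
      (∀ l, 0 ≤ κ l) → ∑ l ∈ T, κ l ≤ A →
      (∀ l ∈ T, ∑ l' ∈ T.filter (fun l' => ∃ i j, |l i| = |l' j|), κ l' ≤ ε) →
      ∫ ω, (powerForm P u T κ (fun l => u l ω) - ∑ l ∈ T, κ l) ^ 2 ∂P ≤ B * (A * ε) ∧
      ∫ ω, powerForm P u T κ (fun l => 1 + u l ω) ∂P ≤ B * A ∧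
      Integrable (fun ω => powerForm P u T κ (fun l => 1 + u l ω)) P ∧
      Integrable (fun ω => (powerForm P u T κ (fun l => u l ω) - ∑ l ∈ T, κ l) ^ 2) P := by
  have hne : Nonempty (Fin p) := ⟨⟨0, Nat.pos_of_ne_zero hp⟩⟩
  obtain ⟨c, hc, hcu⟩ := exists_le_integral_prod p
  set m : ℕ → ℝ := fun k => p * ∫ x, (1 + x) ^ (k * p) ∂halfChiSq with hm
  have hone : ∀ l : ℤ, l ≠ 0 → AllLp (fun ω => 1 + u l ω) P := fun l hl =>
    (AllLp.const (μ := P) (1 : ℝ)).add (hu.allLp hl)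
  have hprod1 : ∀ l : Fin p → ℤ, (∀ i, l i ≠ 0) → AllLp (fun ω => ∏ i, (1 + u (l i) ω)) P := by
    classical
    intro l hl
    have : ∀ s : Finset (Fin p), AllLp (fun ω => ∏ i ∈ s, (1 + u (l i) ω)) P := fun s => by
      induction s using Finset.induction_on with
      | empty => simpa using AllLp.const (μ := P) (1 : ℝ)
      | insert i s hi ih =>
        simp_rw [Finset.prod_insert hi]
        exact (hone _ (hl i)).mul ih
    exact this _
  have hmom : ∀ (l : Fin p → ℤ), (∀ i, l i ≠ 0) → ∀ k, ∫ ω, (∏ i, (1 + u (l i) ω)) ^ k ∂P ≤ m k :=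
    fun l hl k => by simpa [hm] using hu.integral_prod_one_add_pow_le hl k
  have hl1 : ∀ i : Fin p, (fun _ : Fin p => (1 : ℤ)) i ≠ 0 := fun _ => one_ne_zero
  have hm0 : ∀ k, 0 ≤ m k := fun k => le_trans (integral_nonneg fun ω => pow_nonneg
    (Finset.prod_nonneg fun i _ => by have := hu.nonneg 1 ω; positivity) _) (hmom _ hl1 k)
  refine ⟨m 2 / c ^ 2 + m 1 / c, add_nonneg (div_nonneg (hm0 2) (by positivity))
    (div_nonneg (hm0 1) hc.le), fun T κ A ε hε0 hT hκ hA hε => ?_⟩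
  set δ : (Fin p → ℤ) → ℝ := fun l => ∫ ω, ∏ i, u (l i) ω ∂P with hδ
  have hδc : ∀ l ∈ T, c ≤ δ l := fun l hl => hcu hu l (hT l hl)
  have hA0 : 0 ≤ A := (Finset.sum_nonneg fun l _ => hκ l).trans hA
  set ξ : (Fin p → ℤ) → Ω → ℝ := fun l ω => (∏ i, u (l i) ω) / δ l with hξ
  have hξL : ∀ l ∈ T, AllLp (ξ l) P := fun l hl => by
    have := (hu.allLp_prod (hT l hl)).const_mul (δ l)⁻¹
    simpa only [hξ, div_eq_inv_mul] using this
  have hξ1 : ∀ l ∈ T, ∫ ω, ξ l ω ∂P = 1 := fun l hl => by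
    simp only [hξ]
    rw [integral_div]
    exact div_self (hc.trans_le (hδc l hl)).ne'
  have hξ2 : ∀ l ∈ T, ∫ ω, ξ l ω ^ 2 ∂P ≤ m 2 / c ^ 2 := fun l hl => by
    simp only [hξ, div_pow]
    rw [integral_div]
    have h1 : ∫ ω, (∏ i, u (l i) ω) ^ 2 ∂P ≤ m 2 := by
      refine le_trans ?_ (hmom l (hT l hl) 2)
      refine integral_mono_of_nonneg (ae_of_all _ fun _ => sq_nonneg _)
        ((hprod1 l (hT l hl)).pow 2).integrable (ae_of_all _ fun ω => ?_)
      dsimp only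
      gcongr with i _
      · exact Finset.prod_nonneg fun i _ => hu.nonneg _ _
      · exact fun i _ => hu.nonneg _ _
      · linarith
    have h2 := hδc l hl
    gcongr
    exact hm0 2
  have hlin : ∀ ω, powerForm P u T κ (fun l => u l ω) = ∑ l ∈ T, κ l * ξ l ω := fun ω => rfl
  have hmem : ∀ l ∈ T, MemLp (fun ω => κ l * ξ l ω) 2 P := fun l hl =>
    ((hξL l hl).const_mul (κ l)).memLp_two
  have hF : AllLp (fun ω => ∑ l ∈ T, κ l * ξ l ω) P := AllLp.sum fun l hl => (hξL l hl).const_mul (κ l)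
  have hmean : ∫ ω, ∑ l ∈ T, κ l * ξ l ω ∂P = ∑ l ∈ T, κ l := by
    rw [integral_finsetSum _ fun l hl => ((hξL l hl).const_mul (κ l)).integrable]
    refine Finset.sum_congr rfl fun l hl => ?_
    rw [integral_const_mul, hξ1 l hl, mul_one]
  refine ⟨?_, ?_, ?_, ?_⟩
  · have hvar : ∫ ω, (powerForm P u T κ (fun l => u l ω) - ∑ l ∈ T, κ l) ^ 2 ∂P
        = Var[fun ω => ∑ l ∈ T, κ l * ξ l ω; P] := by
      rw [variance_eq_integral hF.aestronglyMeasurable.aemeasurable, hmean]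
      rfl
    rw [hvar, ← covariance_self hF.aestronglyMeasurable.aemeasurable,
      covariance_fun_sum_fun_sum' hmem hmem]
    have hcov : ∀ l ∈ T, ∀ l' ∈ T, cov[fun ω => κ l * ξ l ω, fun ω => κ l' * ξ l' ω; P]
        ≤ if ∃ i j, |l i| = |l' j| then m 2 / c ^ 2 * (κ l * κ l') else 0 := by
      intro l hl l' hl'
      rw [covariance_const_mul_left, covariance_const_mul_right,
        covariance_eq_sub (hξL l hl).memLp_two (hξL l' hl').memLp_two, hξ1 l hl, hξ1 l' hl']
      simp only [Pi.mul_apply]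
      split_ifs with hs
      · have h1 : ∫ ω, ξ l ω * ξ l' ω ∂P ≤ m 2 / c ^ 2 := by
          refine (le_abs_self _).trans ((abs_integral_mul_le (hξL l hl).memLp_two
            (hξL l' hl').memLp_two).trans ?_)
          have hpos : 0 ≤ m 2 / c ^ 2 := div_nonneg (hm0 2) (by positivity)
          calc _ ≤ √(m 2 / c ^ 2) * √(m 2 / c ^ 2) := by
                gcongr
                · exact hξ2 l hl
                · exact hξ2 l' hl'
            _ = _ := Real.mul_self_sqrt hpos
        have hk := mul_nonneg (hκ l) (hκ l')
        nlinarith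
      · push Not at hs
        have h1 : ∫ ω, ξ l ω * ξ l' ω ∂P = 1 := by
          have e : ∀ ω, ξ l ω * ξ l' ω
              = ((∏ i, u (l i) ω) * ∏ i, u (l' i) ω) / (δ l * δ l') := fun ω => by
            simp only [hξ]; rw [div_mul_div_comm]
          simp_rw [e]
          rw [integral_div, hu.integral_prod_mul_prod hs]
          exact div_self (mul_pos (hc.trans_le (hδc l hl)) (hc.trans_le (hδc l' hl'))).ne'
        rw [h1]
        simp
    calc _ ≤ ∑ l ∈ T, ∑ l' ∈ T, if ∃ i j, |l i| = |l' j| then m 2 / c ^ 2 * (κ l * κ l') else 0 :=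
          Finset.sum_le_sum fun l hl => Finset.sum_le_sum fun l' hl' => hcov l hl l' hl'
      _ = ∑ l ∈ T, m 2 / c ^ 2 * κ l * ∑ l' ∈ T.filter (fun l' => ∃ i j, |l i| = |l' j|), κ l' := by
          refine Finset.sum_congr rfl fun l _ => ?_
          rw [← Finset.sum_filter, Finset.mul_sum]
          exact Finset.sum_congr rfl fun l' _ => by ring
      _ ≤ ∑ l ∈ T, m 2 / c ^ 2 * κ l * ε := by
          gcongr with l hl
          · exact mul_nonneg (div_nonneg (hm0 2) (by positivity)) (hκ l)
          · exact hε l hl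
      _ = m 2 / c ^ 2 * ((∑ l ∈ T, κ l) * ε) := by
          rw [← Finset.sum_mul, ← Finset.mul_sum]; ring
      _ ≤ _ := by
          have h1 := hm0 1
          have h2 := hm0 2
          have hS : 0 ≤ ∑ l ∈ T, κ l := Finset.sum_nonneg fun l _ => hκ l
          gcongr
          exact le_add_of_nonneg_right (div_nonneg h1 hc.le)
  · have hi : ∀ l ∈ T, Integrable (fun ω => κ l * ((∏ i, (1 + u (l i) ω)) / δ l)) P := fun l hl =>
      (((hprod1 l (hT l hl)).integrable).div_const _).const_mul _
    unfold powerForm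
    rw [integral_finsetSum _ hi]
    calc _ ≤ ∑ l ∈ T, κ l * (m 1 / c) := by
          refine Finset.sum_le_sum fun l hl => ?_
          rw [integral_const_mul, integral_div]
          have h1 := hmom l (hT l hl) 1
          have h2 := hδc l hl
          simp only [pow_one] at h1
          have h3 := hκ l
          have h4 := hm0 1
          gcongr
      _ = (m 1 / c) * ∑ l ∈ T, κ l := by rw [← Finset.sum_mul, mul_comm]
      _ ≤ _ := by
          have h1 := hm0 1
          have h2 := hm0 2
          have hS : 0 ≤ ∑ l ∈ T, κ l := Finset.sum_nonneg fun l _ => hκ l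
          gcongr
          exact le_add_of_nonneg_left (div_nonneg h2 (by positivity))
  · unfold powerForm
    exact integrable_finsetSum _ fun l hl =>
      (((hprod1 l (hT l hl)).integrable).div_const _).const_mul _
  · exact (hF.sub (AllLp.const _)).memLp_two.integrable_sq

omit [IsProbabilityMeasure P] in
theorem abs_powerForm_sub_le (hu : IsPowerFamily P u) {p : ℕ} (T : Finset (Fin p → ℤ))
    {κ : (Fin p → ℤ) → ℝ} (hκ : ∀ l, 0 ≤ κ l) {x : ℤ → ℝ} {ω : Ω} {η : ℝ} (hη : 0 ≤ η) (hη' : η ≤ 1)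
    (hx : ∀ l ∈ T, ∀ i, |x (l i) - u (l i) ω| ≤ 2 * η * (1 + u (l i) ω)) :
    |powerForm P u T κ x - powerForm P u T κ (fun l => u l ω)|
      ≤ 2 * η * (p * 3 ^ p) * powerForm P u T κ (fun l => 1 + u l ω) := by
  unfold powerForm
  rw [← Finset.sum_sub_distrib, Finset.mul_sum]
  refine (Finset.abs_sum_le_sum_abs _ _).trans (Finset.sum_le_sum fun l hl => ?_)
  have hδ : 0 ≤ ∫ ω, ∏ i, u (l i) ω ∂P :=
    integral_nonneg fun ω => Finset.prod_nonneg fun i _ => hu.nonneg _ _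
  have h1 := abs_prod_sub_prod_le Finset.univ (x := fun i => u (l i) ω) (y := fun i => x (l i))
    (t := 2 * η) (by positivity) (fun i _ => hu.nonneg _ _) (fun i _ => hx l hl i)
  have h2 := one_add_pow_sub_one_le (t := 2 * η) (by positivity) (by linarith) p
  have h3 : 0 ≤ ∏ i, (1 + u (l i) ω) := Finset.prod_nonneg fun i _ => by
    have := hu.nonneg (l i) ω; positivity
  rw [Finset.card_univ, Fintype.card_fin] at h1
  have h4 := h1.trans (mul_le_mul_of_nonneg_right h2 h3)
  rw [← mul_sub, ← sub_div, abs_mul, abs_of_nonneg (hκ l), abs_div, abs_of_nonneg hδ]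
  have := hκ l
  calc _ ≤ κ l * ((2 * η * (p * 3 ^ p) * ∏ i, (1 + u (l i) ω)) / ∫ ω, ∏ i, u (l i) ω ∂P) := by gcongr
    _ = _ := by ring

end IsPowerFamily

end TorusNeedlet

namespace TorusNeedlet

variable {Ω : Type*} [MeasurableSpace Ω]

/-! ### The variance estimators as polynomial forms -/

theorem fourier_grid (n : ℤ) (N k : ℕ) :
    Complex.exp (Complex.I * ((2 * π / N * n : ℝ) : ℂ) * k)
      = fourier n ((2 * π * k / N : ℝ) : Torus) := by
  rw [fourier_torus_coe]
  congr 1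
  push_cast
  ring

/-- At these points the exponential sum runs over `N`-th roots of unity, so it is `N` or `0`. -/
theorem two_pi_mul_fejer {N : ℕ} (hN : N ≠ 0) (n : ℤ) :
    2 * π * fejer N (2 * π / N * n) = if (N : ℤ) ∣ n then (N : ℝ) else 0 := by
  have hN' : (N : ℝ) ≠ 0 := by exact_mod_cast hN
  unfold fejer
  simp_rw [fourier_grid]
  rw [sum_Icc_fourier hN]
  split_ifs
  · rw [Complex.norm_natCast]
    field_simp
  · simp

/-- The share of the frequency `l` in the variance of the wavelet coefficients. -/
def specWeight (a : ℝ → ℝ) (P : Measure Ω) (X : Torus → Ω → ℝ) (N : ℕ) (l : ℤ) : ℝ :=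
  C P X l * a (4 * l / N) ^ 2 / (N * sigmaSq a P X N)

/-- Dividing `|v_l|²` by `C_l` and moving `C_l a²` into the spectral weights isolates the power of
`N σ_N²`, which cancels against the prefactors of the variance estimators. -/
theorem two_pi_mul_polySum {a : ℝ → ℝ} {P : Measure Ω} {X : Torus → Ω → ℝ} {N : ℕ} (hN : N ≠ 0)
    (hσ : sigmaSq a P X N ≠ 0) (hC : ∀ l ∈ band N, C P X l ≠ 0) (p : ℕ) (v : ℤ → ℂ) :
    2 * π * polySum a P X p N v = (N * sigmaSq a P X N) ^ p *
      powerForm P (fun l ω => ‖w X l ω‖ ^ 2 / C P X l) (bandTuples p N)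
        (resWeight N (specWeight a P X N)) (fun l => ‖v l‖ ^ 2 / C P X l) := by
  have hN' : (N : ℝ) ≠ 0 := by exact_mod_cast hN
  unfold polySum powerForm
  rw [Finset.mul_sum, Finset.mul_sum]
  refine Finset.sum_congr rfl fun l hl => ?_
  have hprod : ∏ i, ‖v (l i)‖ ^ 2 * a (4 * l i / N) ^ 2
      = (N * sigmaSq a P X N) ^ p * ((∏ i, specWeight a P X N (l i)) *
        ∏ i, ‖v (l i)‖ ^ 2 / C P X (l i)) := by
    have hp : (N * sigmaSq a P X N) ^ p = ∏ _i : Fin p, (N * sigmaSq a P X N) := by simp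
    rw [hp, ← Finset.prod_mul_distrib, ← Finset.prod_mul_distrib]
    refine Finset.prod_congr rfl fun i _ => ?_
    have := hC (l i) (Fintype.mem_piFinset.1 hl i)
    unfold specWeight
    field_simp
  have hcast : ∑ i, (l i : ℝ) = ((∑ i, l i : ℤ) : ℝ) := by push_cast; rfl
  have hK := two_pi_mul_fejer hN (∑ i, l i)
  rw [hprod, hcast]
  have hd : delta P X l = ∫ ω, ∏ i, ‖w X (l i) ω‖ ^ 2 / C P X (l i) ∂P := rfl
  rw [hd]
  unfold resWeight
  rw [← hK]
  ring

theorem skewVar_eq {a : ℝ → ℝ} {P : Measure Ω} {X : Torus → Ω → ℝ} {N : ℕ} (hN : N ≠ 0)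
    (hσ : sigmaSq a P X N ≠ 0) (hC : ∀ l ∈ band N, C P X l ≠ 0) (s : ℝ) (v : ℤ → ℂ) :
    skewVar a P X N s v = 6 * (s / sigmaSq a P X N)⁻¹ ^ 3 *
      powerForm P (fun l ω => ‖w X l ω‖ ^ 2 / C P X l) (bandTuples 3 N)
        (resWeight N (specWeight a P X N)) (fun l => ‖v l‖ ^ 2 / C P X l) := by
  have hN' : (N : ℝ) ≠ 0 := by exact_mod_cast hN
  have h := two_pi_mul_polySum hN hσ hC 3 v
  have e : skewVar a P X N s v = 6 / (N ^ 3 * s ^ 3) * (2 * π * polySum a P X 3 N v) := by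
    unfold skewVar; ring
  rw [e, h, inv_div]
  field_simp

theorem kurtVar_eq {a : ℝ → ℝ} {P : Measure Ω} {X : Torus → Ω → ℝ} {N : ℕ} (hN : N ≠ 0)
    (hσ : sigmaSq a P X N ≠ 0) (hC : ∀ l ∈ band N, C P X l ≠ 0) (s : ℝ) (v : ℤ → ℂ) :
    kurtVar a P X N s v = 72 * (s / sigmaSq a P X N)⁻¹ ^ 2 *
      powerForm P (fun l ω => ‖w X l ω‖ ^ 2 / C P X l) (bandTuples 2 N)
        (resWeight N (specWeight a P X N)) (fun l => ‖v l‖ ^ 2 / C P X l)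
      + 24 * (s / sigmaSq a P X N)⁻¹ ^ 4 *
      powerForm P (fun l ω => ‖w X l ω‖ ^ 2 / C P X l) (bandTuples 4 N)
        (resWeight N (specWeight a P X N)) (fun l => ‖v l‖ ^ 2 / C P X l) := by
  have hN' : (N : ℝ) ≠ 0 := by exact_mod_cast hN
  have h2 := two_pi_mul_polySum hN hσ hC 2 v
  have h4 := two_pi_mul_polySum hN hσ hC 4 v
  have e : kurtVar a P X N s v = 72 / (N ^ 2 * s ^ 2) * (2 * π * polySum a P X 2 N v)
      + 24 / (N ^ 4 * s ^ 4) * (2 * π * polySum a P X 4 N v) := by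
    unfold kurtVar; ring
  rw [e, h2, h4, inv_div]
  field_simp

/-- The positive frequencies of the band, as tuples of length one. -/
abbrev posBand (N : ℕ) : Finset (Fin 1 → ℤ) :=
  Fintype.piFinset fun _ : Fin 1 => (band N).filter (0 < ·)

theorem sum_posBand {N : ℕ} (f : ℤ → ℝ) :
    ∑ l ∈ posBand N, f (l 0) = ∑ l ∈ (band N).filter (0 < ·), f l := by
  rw [posBand, sum_piFinset_insertNth 0]
  simp

theorem sum_band_eq {N : ℕ} (hN : N ≠ 0) {f : ℤ → ℝ} (hf : ∀ l, f (-l) = f l) :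
    ∑ l ∈ band N, f l = 2 * ∑ l ∈ (band N).filter (0 < ·), f l := by
  rw [← Finset.sum_filter_add_sum_filter_not (band N) (0 < ·), two_mul]
  congr 1
  refine Finset.sum_nbij' (fun l => -l) (fun l => -l) ?_ ?_ ?_ ?_ ?_
  · intro l hl
    rw [Finset.mem_filter] at hl ⊢
    have := ne_zero_of_mem_band hN hl.1
    exact ⟨neg_mem_band.2 hl.1, by omega⟩
  · intro l hl
    rw [Finset.mem_filter] at hl ⊢
    exact ⟨neg_mem_band.2 hl.1, by omega⟩
  · intro l _; simp
  · intro l _; simp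
  · intro l _; exact (hf l).symm

/-- This makes the estimators of `σ_N²` forms of degree one, to which the same concentration result
applies. Restricting to positive frequencies ensures that distinct tuples share nothing. -/
theorem bandMean_div_eq {a : ℝ → ℝ} {P : Measure Ω} [IsProbabilityMeasure P] {X : Torus → Ω → ℝ}
    {N : ℕ} (hN : N ≠ 0)
    (hσ : sigmaSq a P X N ≠ 0) (hC : ∀ l ∈ band N, C P X l ≠ 0) (v : ℤ → ℂ) :
    bandMean a N (fun l => ‖v l‖ ^ 2) / sigmaSq a P X N =
      powerForm P (fun l ω => ‖w X l ω‖ ^ 2 / C P X l) (posBand N)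
        (fun l => 2 * specWeight a P X N (l 0)) (fun l => ‖v l‖ ^ 2 / C P X l) := by
  have hN' : (N : ℝ) ≠ 0 := by exact_mod_cast hN
  unfold powerForm
  simp only [Finset.univ_unique, Fin.default_eq_zero, Finset.prod_singleton]
  rw [sum_posBand (fun l => 2 * specWeight a P X N l * ((‖v l‖ ^ 2 / C P X l) /
    ∫ ω, ‖w X l ω‖ ^ 2 / C P X l ∂P))]
  unfold bandMean
  rw [mul_div_right_comm, Finset.mul_sum]
  refine Finset.sum_congr rfl fun l hl => ?_
  have hc := hC l (Finset.mem_filter.1 hl).1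
  have hd : ∫ ω, ‖w X l ω‖ ^ 2 / C P X l ∂P = 1 := by
    rw [integral_div]
    exact div_self hc
  rw [hd]
  unfold specWeight
  field_simp

/-! ### The window and the power spectrum on the frequency band -/

namespace IsNeedletWindow

variable {a : ℝ → ℝ}

theorem sq_le_one (ha : IsNeedletWindow a) (ξ : ℝ) : a ξ ^ 2 ≤ 1 := by
  obtain ⟨φ, -, h01, -, -, hφ⟩ := ha.cutoff
  have h1 := h01 (ξ / 2)
  have h2 := h01 ξ
  rw [hφ]
  linarith

/-- Take `φ ξ = 1/2` with `1/2 < ξ < 1`. Then `φ (ξ/2) = 1` and `φ (2ξ) = 0`, so the same value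
`1/2` decides both `a ξ` and `a (2ξ)`. -/
theorem exists_sq_eq_half (ha : IsNeedletWindow a) :
    ∃ ξ, 1 / 2 < ξ ∧ ξ < 1 ∧ a ξ ^ 2 = 1 / 2 ∧ a (2 * ξ) ^ 2 = 1 / 2 := by
  obtain ⟨φ, hsm, h01, h1, h0, hφ⟩ := ha.cutoff
  have hc : Continuous φ := hsm.continuous
  have hφ1 : φ 1 = 0 := by
    have h : Tendsto φ (𝓝[>] 1) (𝓝 (φ 1)) := (hc.tendsto 1).mono_left nhdsWithin_le_nhds
    refine tendsto_nhds_unique h ?_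
    refine tendsto_const_nhds.congr' ?_
    filter_upwards [self_mem_nhdsWithin] with x hx
    have hx' : (1 : ℝ) < x := hx
    rw [h0 x (hx'.trans_le (le_abs_self x))]
  have hφh : φ (1 / 2) = 1 := h1 _ (by norm_num)
  obtain ⟨ξ, hξ, hξ2⟩ := intermediate_value_Icc' (by norm_num : (1 / 2 : ℝ) ≤ 1) hc.continuousOn
    (show (1 / 2 : ℝ) ∈ Set.Icc (φ 1) (φ (1 / 2)) by rw [hφ1, hφh]; norm_num)
  have hl : 1 / 2 < ξ := lt_of_le_of_ne hξ.1 (by rintro rfl; rw [hφh] at hξ2; norm_num at hξ2)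
  have hr : ξ < 1 := lt_of_le_of_ne hξ.2 (by rintro rfl; rw [hφ1] at hξ2; norm_num at hξ2)
  refine ⟨ξ, hl, hr, ?_, ?_⟩
  · rw [hφ, hξ2, h1 (ξ / 2) (by rw [abs_of_pos (by linarith)]; linarith)]
    norm_num
  · rw [hφ, h0 (2 * ξ) (by rw [abs_of_pos (by linarith)]; linarith)]
    rw [mul_div_cancel_left₀ ξ two_ne_zero, hξ2]
    norm_num

/-- A positive proportion of the frequencies `l` carry weight, and so do their pairwise sums. -/
theorem exists_window (ha : IsNeedletWindow a) : ∃ ρ : ℝ, 0 < ρ ∧ ∀ᶠ N : ℕ in atTop,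
    ∃ W : Finset ℤ, ρ * N ≤ W.card ∧ (∀ l ∈ W, 0 < l ∧ l ∈ band N ∧ 1 / 4 ≤ a (4 * l / N) ^ 2) ∧
      ∀ l ∈ W, ∀ m ∈ W, l + m ∈ band N ∧ 1 / 4 ≤ a (4 * (l + m : ℤ) / N) ^ 2 := by
  obtain ⟨ξ, hξ1, hξ2, h1, h2⟩ := ha.exists_sq_eq_half
  have hc : Continuous fun x => a x ^ 2 := ha.smooth.continuous.pow 2
  obtain ⟨η₁, hη₁, hη₁'⟩ := Metric.eventually_nhds_iff.1
    ((hc.tendsto ξ).eventually (lt_mem_nhds (b := a ξ ^ 2) (a := 1 / 4) (by rw [h1]; norm_num)))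
  obtain ⟨η₂, hη₂, hη₂'⟩ := Metric.eventually_nhds_iff.1
    ((hc.tendsto (2 * ξ)).eventually
      (lt_mem_nhds (b := a (2 * ξ) ^ 2) (a := 1 / 4) (by rw [h2]; norm_num)))
  -- Frequencies will satisfy `|4l/N - ξ| ≤ η`, and their sums lie within `2η` of `2ξ`. The first
  -- two conditions keep `a²` above `1/4` at both places; the last two keep frequencies and sums in
  -- the band.
  obtain ⟨η, hη, hηle⟩ : ∃ η : ℝ, 0 < η ∧ (η < η₁ ∧ 2 * η < η₂ ∧ η < ξ - 1 / 2 ∧ η < 1 - ξ) := by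
    refine ⟨min (min η₁ (η₂ / 2)) (min (ξ - 1 / 2) (1 - ξ)) / 2, ?_, ?_, ?_, ?_, ?_⟩
    · have : 0 < min (min η₁ (η₂ / 2)) (min (ξ - 1 / 2) (1 - ξ)) := by
        refine lt_min (lt_min hη₁ (by linarith)) (lt_min ?_ ?_) <;> linarith
      linarith
    all_goals
      have e0 : 0 < min (min η₁ (η₂ / 2)) (min (ξ - 1 / 2) (1 - ξ)) := by
        refine lt_min (lt_min hη₁ (by linarith)) (lt_min ?_ ?_) <;> linarith
      have e1 := min_le_left (min η₁ (η₂ / 2)) (min (ξ - 1 / 2) (1 - ξ))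
      have e2 := min_le_right (min η₁ (η₂ / 2)) (min (ξ - 1 / 2) (1 - ξ))
      have e3 := min_le_left η₁ (η₂ / 2)
      have e4 := min_le_right η₁ (η₂ / 2)
      have e5 := min_le_left (ξ - 1 / 2) (1 - ξ)
      have e6 := min_le_right (ξ - 1 / 2) (1 - ξ)
      linarith
  obtain ⟨hη1, hη2, hη3, hη4⟩ := hηle
  -- The interval of frequencies has length `ηN/2`; rounding costs at most one, which is at most
  -- `ηN/4` once `ηN ≥ 4`.
  refine ⟨η / 4, by positivity, ?_⟩
  have hev : ∀ᶠ N : ℕ in atTop, 4 / η ≤ (N : ℝ) :=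
    tendsto_natCast_atTop_atTop.eventually_ge_atTop _
  filter_upwards [hev] with N hN
  have hNpos : (0 : ℝ) < N := lt_of_lt_of_le (by positivity) hN
  have hN4 : 4 ≤ η * N := by
    rw [div_le_iff₀ hη] at hN
    linarith
  have hband : ∀ l : ℤ, 1 / 2 ≤ 4 * (l : ℝ) / N → 4 * (l : ℝ) / N ≤ 2 → l ∈ band N := by
    intro l hl1 hl2
    rw [le_div_iff₀ hNpos] at hl1
    rw [div_le_iff₀ hNpos] at hl2
    have e1 : (N : ℤ) ≤ 8 * l := by
      have : (N : ℝ) ≤ 8 * l := by linarith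
      exact_mod_cast this
    have e2 : 2 * l ≤ N := by
      have : 2 * (l : ℝ) ≤ N := by linarith
      exact_mod_cast this
    have h0 : 0 ≤ l := by omega
    simp only [band, Finset.mem_filter, Finset.mem_Icc, abs_of_nonneg h0]
    omega
  have hW : ∀ l ∈ Finset.Icc ⌈N * (ξ - η) / 4⌉ ⌊N * (ξ + η) / 4⌋,
      |4 * (l : ℝ) / N - ξ| ≤ η := by
    intro l hl
    rw [Finset.mem_Icc, Int.ceil_le, Int.le_floor] at hl
    have e1 : ξ - η ≤ 4 * (l : ℝ) / N := by rw [le_div_iff₀ hNpos]; linarith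
    have e2 : 4 * (l : ℝ) / N ≤ ξ + η := by rw [div_le_iff₀ hNpos]; linarith
    rw [abs_le]
    constructor <;> linarith
  refine ⟨Finset.Icc ⌈N * (ξ - η) / 4⌉ ⌊N * (ξ + η) / 4⌋, ?_, fun l hl => ?_, fun l hl m hm => ?_⟩
  · rw [Int.card_Icc]
    have e1 := Int.lt_floor_add_one (N * (ξ + η) / 4)
    have e2 := Int.ceil_lt_add_one (N * (ξ - η) / 4)
    have e3 : ((⌊N * (ξ + η) / 4⌋ + 1 - ⌈N * (ξ - η) / 4⌉ : ℤ) : ℝ)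
        ≤ ((⌊N * (ξ + η) / 4⌋ + 1 - ⌈N * (ξ - η) / 4⌉).toNat : ℝ) := by
      exact_mod_cast Int.self_le_toNat _
    push_cast at e3
    refine le_trans ?_ e3
    nlinarith
  · have h := hW l hl
    have h' := abs_le.1 h
    refine ⟨?_, hband l (by linarith) (by linarith), (hη₁' (lt_of_le_of_lt h hη1)).le⟩
    have : 0 < 4 * (l : ℝ) / N := by linarith
    rw [lt_div_iff₀ hNpos] at this
    have : (0 : ℝ) < l := by linarith
    exact_mod_cast this
  · have e : 4 * ((l + m : ℤ) : ℝ) / N = 4 * (l : ℝ) / N + 4 * (m : ℝ) / N := by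
      push_cast; ring
    have hl' := abs_le.1 (hW l hl)
    have hm' := abs_le.1 (hW m hm)
    have hd : |4 * ((l + m : ℤ) : ℝ) / N - 2 * ξ| ≤ 2 * η := by
      rw [e, abs_le]
      constructor <;> linarith
    refine ⟨hband _ (by rw [e]; linarith) (by rw [e]; linarith), (hη₂' (lt_of_le_of_lt hd hη2)).le⟩

end IsNeedletWindow

/-- On the band `N/8 ≤ |l| ≤ N/2`, whence the factors `2^α` and `8^α`. -/
theorem exists_C_bounds_band {P : Measure Ω} {X : Torus → Ω → ℝ} {α : ℝ} (hA : AssumptionA1 P X α) :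
    ∃ c₁ c₂ : ℝ, 0 < c₁ ∧ 0 < c₂ ∧ ∀ N : ℕ, N ≠ 0 → ∀ l ∈ band N,
      c₁ * (N : ℝ) ^ (-α) ≤ C P X l ∧ C P X l ≤ c₂ * (N : ℝ) ^ (-α) := by
  obtain ⟨c₁, c₂, hc₁, hc₂, hC⟩ := IsTorusField.C_le_of_assumptionA1 hA
  have hα : 0 < α := by linarith [hA.1]
  refine ⟨c₁ * 2 ^ α, c₂ * 8 ^ α, by positivity, by positivity, fun N hN l hl => ?_⟩
  have hNpos : (0 : ℝ) < N := by exact_mod_cast Nat.pos_of_ne_zero hN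
  have hl0 := ne_zero_of_mem_band hN hl
  have hlpos : (0 : ℝ) < |(l : ℝ)| := by positivity
  simp only [band, Finset.mem_filter] at hl
  have e1 : (N : ℝ) / 8 ≤ |(l : ℝ)| := by
    have : (N : ℝ) ≤ 8 * |(l : ℝ)| := by exact_mod_cast hl.2.1
    linarith
  have e2 : |(l : ℝ)| ≤ N / 2 := by
    have : 2 * |(l : ℝ)| ≤ N := by exact_mod_cast hl.2.2
    linarith
  have hp : ∀ r : ℝ, 0 < r → ((N : ℝ) / r) ^ (-α) = r ^ α * (N : ℝ) ^ (-α) := fun r hr => by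
    rw [Real.div_rpow hNpos.le hr.le, Real.rpow_neg hr.le]
    field_simp
  obtain ⟨h1, h2⟩ := hC l hl0
  constructor
  · refine le_trans ?_ h1
    rw [mul_assoc, ← hp 2 two_pos]
    gcongr ?_ * ?_
    exact Real.rpow_le_rpow_of_nonpos hlpos e2 (by linarith)
  · refine h2.trans ?_
    rw [mul_assoc, ← hp 8 (by norm_num)]
    gcongr ?_ * ?_
    exact Real.rpow_le_rpow_of_nonpos (by positivity) e1 (by linarith)

theorem card_band_le (N : ℕ) : (band N).card ≤ 2 * N + 1 := by
  refine (Finset.card_filter_le _ _).trans (le_of_eq ?_)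
  rw [Int.card_Icc]
  omega

theorem specWeight_neg {a : ℝ → ℝ} (ha : IsNeedletWindow a) (P : Measure Ω) (X : Torus → Ω → ℝ)
    (N : ℕ) (l : ℤ) : specWeight a P X N (-l) = specWeight a P X N l := by
  unfold specWeight
  have e : (4 * ((-l : ℤ) : ℝ) / N) = -(4 * (l : ℝ) / N) := by push_cast; ring
  rw [IsTorusField.C_neg, e, ha.even]

theorem sum_band_specWeight {a : ℝ → ℝ} (ha : IsNeedletWindow a) (P : Measure Ω)
    (X : Torus → Ω → ℝ) {N : ℕ} (hN : N ≠ 0) (hσ : sigmaSq a P X N ≠ 0) :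
    ∑ l ∈ band N, specWeight a P X N l = 1 := by
  have hN' : (N : ℝ) ≠ 0 := by exact_mod_cast hN
  rw [sum_band_eq hN (specWeight_neg ha P X N)]
  unfold specWeight
  rw [← Finset.sum_div]
  have : ∑ l ∈ (band N).filter (0 < ·), C P X l * a (4 * l / N) ^ 2 = N * sigmaSq a P X N / 2 := by
    unfold sigmaSq bandMean
    field_simp
  rw [this]
  field_simp

/-- The spectral weights are of order `1/N` at most, and at least `k/N` where `a² ≥ 1/4`. The pairs
`(l, -l)` then give `ρN · N(k/N)² = ρk²` and the triples `(l, m, -(l+m))` give `(ρN)² · N(k/N)³ =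
ρ²k³`. Quadruples need no lower bound, as pairs already keep the variance of `U_N` positive. -/
theorem exists_spectral_bounds {a : ℝ → ℝ} (ha : IsNeedletWindow a) {P : Measure Ω}
    {X : Torus → Ω → ℝ} {α : ℝ} (hA : AssumptionA1 P X α) : ∃ K c : ℝ, 0 < K ∧ 0 < c ∧
    ∀ᶠ N : ℕ in atTop, IsBandWeight N (specWeight a P X N) K ∧ 0 < sigmaSq a P X N ∧
      (∀ l ∈ band N, c * (N : ℝ) ^ (-α) ≤ C P X l) ∧
      c ≤ ∑ l ∈ bandTuples 2 N, resWeight N (specWeight a P X N) l ∧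
      c ≤ ∑ l ∈ bandTuples 3 N, resWeight N (specWeight a P X N) l := by
  obtain ⟨c₁, c₂, hc₁, hc₂, hC⟩ := exists_C_bounds_band hA
  obtain ⟨ρ, hρ, hW⟩ := ha.exists_window
  -- The factor `24` is `4` from `a² ≥ 1/4` times `6` from the upper bound on `σ_N²` in `hup`.
  set k : ℝ := c₁ / (24 * c₂) with hk
  have hkpos : 0 < k := by positivity
  refine ⟨2 * c₂ / (ρ * c₁), min c₁ (min (ρ * k ^ 2) (ρ ^ 2 * k ^ 3)), by positivity,
    lt_min hc₁ (lt_min (by positivity) (by positivity)), ?_⟩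
  filter_upwards [hW, eventually_ge_atTop 1] with N hWN hN1
  obtain ⟨W, hcard, hW1, hW2⟩ := hWN
  have hN : N ≠ 0 := by omega
  have hNpos : (0 : ℝ) < N := by exact_mod_cast Nat.pos_of_ne_zero hN
  set D : ℝ := (N : ℝ) ^ (-α) with hD
  have hDpos : 0 < D := by positivity
  have hC0 : ∀ l, 0 ≤ C P X l := fun l => integral_nonneg fun _ => sq_nonneg _
  have hlow : ρ * c₁ / 2 * D ≤ sigmaSq a P X N := by
    unfold sigmaSq bandMean
    have h1 : ∑ _l ∈ W, c₁ * D * (1 / 4)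
        ≤ ∑ l ∈ (band N).filter (0 < ·), C P X l * a (4 * l / N) ^ 2 := by
      calc _ ≤ ∑ l ∈ W, C P X l * a (4 * l / N) ^ 2 := by
            refine Finset.sum_le_sum fun l hl => ?_
            have h2 := (hC N hN l (hW1 l hl).2.1).1
            have h3 := (hW1 l hl).2.2
            have h4 := hC0 l
            gcongr
        _ ≤ _ := by
            refine Finset.sum_le_sum_of_subset_of_nonneg (fun l hl => ?_) fun l _ _ => ?_
            · exact Finset.mem_filter.2 ⟨(hW1 l hl).2.1, (hW1 l hl).1⟩
            · exact mul_nonneg (hC0 l) (sq_nonneg _)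
    rw [Finset.sum_const, nsmul_eq_mul] at h1
    calc ρ * c₁ / 2 * D = 2 / N * (ρ * N * (c₁ * D * (1 / 4))) := by field_simp; norm_num
      _ ≤ 2 / N * (W.card * (c₁ * D * (1 / 4))) := by gcongr
      _ ≤ _ := by gcongr
  have hσ : 0 < sigmaSq a P X N := lt_of_lt_of_le (by positivity) hlow
  have hup : sigmaSq a P X N ≤ 6 * c₂ * D := by
    unfold sigmaSq bandMean
    have h1 : ∑ l ∈ (band N).filter (0 < ·), C P X l * a (4 * l / N) ^ 2
        ≤ (3 * N : ℕ) * (c₂ * D) := by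
      calc _ ≤ ((band N).filter (0 < ·)).card • (c₂ * D) := by
            refine Finset.sum_le_card_nsmul _ _ _ fun l hl => ?_
            have h2 := (hC N hN l (Finset.mem_filter.1 hl).1).2
            have h3 := ha.sq_le_one (4 * l / N)
            calc _ ≤ C P X l * 1 := by gcongr; exact hC0 l
              _ ≤ _ := by linarith
        _ ≤ _ := by
            rw [nsmul_eq_mul]
            gcongr
            refine (Finset.card_filter_le _ _).trans ((card_band_le N).trans ?_)
            omega
    calc _ ≤ 2 / N * ((3 * N : ℕ) * (c₂ * D)) := by gcongr
      _ = _ := by push_cast; field_simp; norm_num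
  have hband : IsBandWeight N (specWeight a P X N) (2 * c₂ / (ρ * c₁)) := by
    refine ⟨Nat.pos_of_ne_zero hN, fun l => ?_, fun l hl => ?_, sum_band_specWeight ha P X hN hσ.ne'⟩
    · exact div_nonneg (mul_nonneg (hC0 l) (sq_nonneg _)) (by positivity)
    · unfold specWeight
      have h2 := (hC N hN l hl).2
      have h3 := ha.sq_le_one (4 * l / N)
      have h4 := hC0 l
      calc C P X l * a (4 * l / N) ^ 2 / (N * sigmaSq a P X N)
          ≤ c₂ * D * 1 / (N * (ρ * c₁ / 2 * D)) := by gcongr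
        _ = _ := by field_simp
  have hw : ∀ l ∈ band N, 1 / 4 ≤ a (4 * l / N) ^ 2 → k / N ≤ specWeight a P X N l := by
    intro l hl h3
    unfold specWeight
    have h2 := (hC N hN l hl).1
    have h4 := hC0 l
    calc k / N = c₁ * D * (1 / 4) / (N * (6 * c₂ * D)) := by
          rw [hk]; field_simp; norm_num
      _ ≤ _ := by gcongr
  have hcard' : 0 ≤ ρ * N := by positivity
  refine ⟨hband, hσ, fun l hl => ?_, ?_, ?_⟩
  · refine le_trans ?_ (hC N hN l hl).1
    gcongr
    exact min_le_left _ _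
  · refine (min_le_right _ _).trans ((min_le_left _ _).trans ?_)
    have hinj : Set.InjOn (fun l : ℤ => (![l, -l] : Fin 2 → ℤ)) W := fun l _ m _ h => by
      simpa using congrFun h 0
    calc ρ * k ^ 2 = ρ * N * (N * (k / N) ^ 2) := by field_simp
      _ ≤ W.card * (N * (k / N) ^ 2) := by gcongr
      _ = ∑ _l ∈ W, N * (k / N) ^ 2 := by rw [Finset.sum_const, nsmul_eq_mul]
      _ ≤ ∑ l ∈ W, resWeight N (specWeight a P X N) ![l, -l] := by
          refine Finset.sum_le_sum fun l hl => ?_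
          have h1 := hw l (hW1 l hl).2.1 (hW1 l hl).2.2
          simp only [resWeight, Fin.sum_univ_two, Fin.prod_univ_two, Matrix.cons_val_zero,
            Matrix.cons_val_one, add_neg_cancel, dvd_zero, if_true, specWeight_neg ha, ← sq]
          gcongr
      _ = ∑ l ∈ W.image fun l : ℤ => (![l, -l] : Fin 2 → ℤ), resWeight N (specWeight a P X N) l :=
          (Finset.sum_image hinj).symm
      _ ≤ _ := by
          refine Finset.sum_le_sum_of_subset_of_nonneg (fun l hl => ?_)
            fun l _ _ => hband.resWeight_nonneg l
          obtain ⟨m, hm, rfl⟩ := Finset.mem_image.1 hl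
          rw [Fintype.mem_piFinset, Fin.forall_fin_two]
          exact ⟨(hW1 m hm).2.1, neg_mem_band.2 (hW1 m hm).2.1⟩
  · refine (min_le_right _ _).trans ((min_le_right _ _).trans ?_)
    have hinj : Set.InjOn (fun q : ℤ × ℤ => (![q.1, q.2, -(q.1 + q.2)] : Fin 3 → ℤ)) (W ×ˢ W : Finset _) :=
      fun q _ r _ h => by
        have h0 := congrFun h 0
        have h1 := congrFun h 1
        exact Prod.ext (by simpa using h0) (by simpa using h1)
    calc ρ ^ 2 * k ^ 3 = (ρ * N) * (ρ * N) * (N * (k / N) ^ 3) := by field_simp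
      _ ≤ W.card * W.card * (N * (k / N) ^ 3) := by gcongr
      _ = ∑ _q ∈ W ×ˢ W, N * (k / N) ^ 3 := by
          rw [Finset.sum_const, nsmul_eq_mul, Finset.card_product]; push_cast; rfl
      _ ≤ ∑ q ∈ W ×ˢ W, resWeight N (specWeight a P X N) ![q.1, q.2, -(q.1 + q.2)] := by
          refine Finset.sum_le_sum fun q hq => ?_
          obtain ⟨hq1, hq2⟩ := Finset.mem_product.1 hq
          have h1 := hw _ (hW1 _ hq1).2.1 (hW1 _ hq1).2.2
          have h2 := hw _ (hW1 _ hq2).2.1 (hW1 _ hq2).2.2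
          have h3 := hw _ (hW2 _ hq1 _ hq2).1 (hW2 _ hq1 _ hq2).2
          have hd : q.1 + q.2 + -(q.1 + q.2) = 0 := by ring
          have hk0 : 0 ≤ k / N := by positivity
          have e : resWeight N (specWeight a P X N) ![q.1, q.2, -(q.1 + q.2)]
              = N * (specWeight a P X N q.1 * specWeight a P X N q.2
                * specWeight a P X N (q.1 + q.2)) := by
            rw [← specWeight_neg ha P X N (q.1 + q.2)]
            simp [resWeight, Fin.sum_univ_three, Fin.prod_univ_three]
          rw [e, pow_three']
          gcongr
          · exact mul_nonneg (hk0.trans h1) (hk0.trans h2)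
          · exact hk0.trans h1
      _ = ∑ l ∈ (W ×ˢ W).image fun q : ℤ × ℤ => (![q.1, q.2, -(q.1 + q.2)] : Fin 3 → ℤ),
            resWeight N (specWeight a P X N) l := (Finset.sum_image hinj).symm
      _ ≤ _ := by
          refine Finset.sum_le_sum_of_subset_of_nonneg (fun l hl => ?_)
            fun l _ _ => hband.resWeight_nonneg l
          obtain ⟨q, hq, rfl⟩ := Finset.mem_image.1 hl
          obtain ⟨hq1, hq2⟩ := Finset.mem_product.1 hq
          rw [Fintype.mem_piFinset]
          intro i
          fin_cases i
          · exact (hW1 _ hq1).2.1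
          · exact (hW1 _ hq2).2.1
          · exact neg_mem_band.2 (hW2 _ hq1 _ hq2).1

end TorusNeedlet

namespace TorusNeedlet

variable {Ω : Type*} [MeasurableSpace Ω]

/-! ### The correlations of the wavelet coefficients -/

/-- The grid point `2πk/N`. -/
def grid (N k : ℕ) : Torus := ((2 * π * k / N : ℝ) : Torus)

theorem fourier_prod {p : ℕ} (l : Fin p → ℤ) (t : Torus) :
    ∏ i, fourier (l i) t = fourier (∑ i, l i) t := by
  induction p with
  | zero => simp
  | succ p ih => rw [Fin.prod_univ_succ, Fin.sum_univ_succ, fourier_add, ih]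

theorem fourier_sub_apply (l : ℤ) (t s : Torus) :
    fourier l (t - s) = fourier l t * fourier (-l) s := by
  rw [fourier_apply, fourier_apply, fourier_apply, zsmul_sub, sub_eq_add_neg, ← neg_zsmul,
    AddCircle.toCircle_add, Circle.coe_mul]

/-- The correlation `∑_l h_l exp(i l 2π(k - j)/N)`. -/
def gridCorr (N : ℕ) (h : ℤ → ℝ) (k j : Finset.Icc 1 N) : ℝ :=
  ∑ l ∈ band N, h l * (fourier l (grid N k - grid N j)).re

theorem sum_band_neg {M : Type*} [AddCommMonoid M] (N : ℕ) (f : ℤ → M) :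
    ∑ l ∈ band N, f (-l) = ∑ l ∈ band N, f l :=
  Finset.sum_nbij' (fun l => -l) (fun l => -l) (fun _ h => neg_mem_band.2 h)
    (fun _ h => neg_mem_band.2 h) (fun _ _ => neg_neg _) (fun _ _ => neg_neg _) fun _ _ => rfl

theorem ofReal_gridCorr {N : ℕ} {h : ℤ → ℝ} (heven : ∀ l, h (-l) = h l) (k j : Finset.Icc 1 N) :
    (gridCorr N h k j : ℂ)
      = ∑ l ∈ band N, (h l : ℂ) * (fourier l (grid N k) * fourier (-l) (grid N j)) := by
  set Z : ℂ := ∑ l ∈ band N, (h l : ℂ) * fourier l (grid N k - grid N j) with hZ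
  have hc : starRingEnd ℂ Z = Z := by
    rw [hZ, map_sum, ← sum_band_neg]
    refine Finset.sum_congr rfl fun l _ => ?_
    rw [map_mul, Complex.conj_ofReal, heven, ← fourier_neg, neg_neg]
  have hre : Z.re = gridCorr N h k j := by
    rw [hZ, Complex.re_sum]
    exact Finset.sum_congr rfl fun l _ => Complex.re_ofReal_mul _ _
  rw [← hre, Complex.conj_eq_iff_re.1 hc, hZ]
  exact Finset.sum_congr rfl fun l _ => by rw [fourier_sub_apply]

theorem sum_grid_fourier {N : ℕ} (hN : N ≠ 0) (n : ℤ) :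
    ∑ k : Finset.Icc 1 N, fourier n (grid N k) = if (N : ℤ) ∣ n then (N : ℂ) else 0 := by
  rw [← sum_Icc_fourier hN n]
  exact Finset.sum_coe_sort (Finset.Icc 1 N) fun k => fourier n (grid N k)

/-- Expanding the power gives tuples; the sums over `k` and over `j` each give `N` on resonant
tuples and `0` otherwise, and the prefactor leaves one `N`. This identifies the variances of `S_N`
and `U_N` with the limits of their estimators. -/
theorem sum_gridCorr_pow {N : ℕ} (hN : N ≠ 0) {h : ℤ → ℝ} (heven : ∀ l, h (-l) = h l) (p : ℕ) :
    (N : ℝ)⁻¹ * ∑ k, ∑ j, gridCorr N h k j ^ p = ∑ l ∈ bandTuples p N, resWeight N h l := by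
  have hN' : (N : ℂ) ≠ 0 := by exact_mod_cast hN
  have e : (((N : ℝ)⁻¹ * ∑ k, ∑ j, gridCorr N h k j ^ p : ℝ) : ℂ)
      = ((∑ l ∈ bandTuples p N, resWeight N h l : ℝ) : ℂ) := by
    push_cast
    simp_rw [ofReal_gridCorr heven, Finset.sum_pow']
    have e1 : ∀ (l : Fin p → ℤ) (k j : Finset.Icc 1 N),
        ∏ i, ((h (l i) : ℂ) * (fourier (l i) (grid N k) * fourier (-l i) (grid N j)))
        = (∏ i, (h (l i) : ℂ)) *
          (fourier (∑ i, l i) (grid N k) * fourier (-∑ i, l i) (grid N j)) := fun l k j => by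
      rw [Finset.prod_mul_distrib, Finset.prod_mul_distrib, fourier_prod, fourier_prod,
        Finset.sum_neg_distrib]
    simp_rw [e1]
    have e2 : ∑ k : Finset.Icc 1 N, ∑ j : Finset.Icc 1 N, ∑ l ∈ bandTuples p N,
        (∏ i, (h (l i) : ℂ)) * (fourier (∑ i, l i) (grid N k) * fourier (-∑ i, l i) (grid N j))
        = ∑ l ∈ bandTuples p N, (∏ i, (h (l i) : ℂ)) *
          ((∑ k : Finset.Icc 1 N, fourier (∑ i, l i) (grid N k)) *
            ∑ j : Finset.Icc 1 N, fourier (-∑ i, l i) (grid N j)) := by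
      simp_rw [Finset.sum_mul_sum, Finset.mul_sum]
      simp_rw [Finset.sum_comm (t := bandTuples p N)]
    rw [e2, Finset.mul_sum]
    refine Finset.sum_congr rfl fun l _ => ?_
    rw [sum_grid_fourier hN, sum_grid_fourier hN]
    simp only [dvd_neg]
    unfold resWeight
    split_ifs
    · push_cast
      field_simp
    · simp
  exact_mod_cast e

/-- Parseval's identity for the discrete Fourier transform on `N` points. -/
theorem sum_range_norm_sq {N : ℕ} (hN : N ≠ 0) (v : Finset.Icc 1 N → ℝ) :
    ∑ l ∈ Finset.range N, ‖∑ k, (v k : ℂ) * fourier (l : ℤ) (grid N k)‖ ^ 2 = N * ∑ k, v k ^ 2 := by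
  have hswap : ∀ (l : ℕ) (k j : Finset.Icc 1 N),
      fourier (l : ℤ) (grid N k) * fourier (-(l : ℤ)) (grid N j)
        = fourier ((k : ℤ) - (j : ℤ)) ((2 * π * l / N : ℝ) : Torus) := fun l k j => by
    unfold grid
    rw [fourier_torus_coe, fourier_torus_coe, fourier_torus_coe, ← Complex.exp_add]
    congr 1
    push_cast
    ring
  have e : ((∑ l ∈ Finset.range N, ‖∑ k, (v k : ℂ) * fourier (l : ℤ) (grid N k)‖ ^ 2 : ℝ) : ℂ)
      = ((N * ∑ k, v k ^ 2 : ℝ) : ℂ) := by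
    push_cast
    have e1 : ∀ l : ℕ, ((‖∑ k, (v k : ℂ) * fourier (l : ℤ) (grid N k)‖ : ℂ)) ^ 2
        = ∑ k, ∑ j, (v k : ℂ) * (v j) * fourier ((k : ℤ) - (j : ℤ)) ((2 * π * l / N : ℝ) : Torus) := by
      intro l
      rw [← Complex.mul_conj', map_sum, Finset.sum_mul_sum]
      refine Finset.sum_congr rfl fun k _ => Finset.sum_congr rfl fun j _ => ?_
      rw [map_mul, Complex.conj_ofReal, ← fourier_neg, ← hswap]
      ring
    simp_rw [e1]
    rw [Finset.sum_comm, Finset.mul_sum]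
    refine Finset.sum_congr rfl fun k _ => ?_
    rw [Finset.sum_comm, Finset.sum_eq_single k]
    · rw [← Finset.mul_sum, sum_range_fourier hN, sub_self, if_pos (dvd_zero _)]
      ring
    · intro j _ hjk
      rw [← Finset.mul_sum, sum_range_fourier hN, if_neg, mul_zero]
      intro hdvd
      have hk := Finset.mem_Icc.1 k.2
      have hj := Finset.mem_Icc.1 j.2
      have h0 := Int.eq_zero_of_abs_lt_dvd hdvd (by rw [abs_lt]; omega)
      exact hjk (Subtype.ext (by omega))
    · simp
  exact_mod_cast e

/-- The transform has period `N` in `l`, and the band fits into two periods. -/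
theorem sum_band_norm_sq_le {N : ℕ} (hN : N ≠ 0) (v : Finset.Icc 1 N → ℝ) :
    ∑ l ∈ band N, ‖∑ k, (v k : ℂ) * fourier l (grid N k)‖ ^ 2 ≤ 2 * N * ∑ k, v k ^ 2 := by
  set F : ℤ → ℝ := fun l => ‖∑ k, (v k : ℂ) * fourier l (grid N k)‖ ^ 2 with hF
  have hper : ∀ l : ℤ, F (l - N) = F l := by
    intro l
    have hN' : (N : ℂ) ≠ 0 := by exact_mod_cast hN
    have h1 : ∀ k : Finset.Icc 1 N, fourier (l - N) (grid N k) = fourier l (grid N k) := fun k => by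
      have h2 : fourier (-(N : ℤ)) (grid N k) = 1 := by
        unfold grid
        rw [fourier_torus_coe, Complex.exp_eq_one_iff]
        refine ⟨-(k : ℤ), ?_⟩
        push_cast
        field_simp
      rw [sub_eq_add_neg, fourier_add, h2, mul_one]
    simp only [hF, h1]
  have hsub : band N ⊆ (Finset.range (N + N)).image fun n : ℕ => (n : ℤ) - N := by
    intro l hl
    have h1 := abs_le.1 (show |l| ≤ N by have := abs_le_of_mem_band hl; have := abs_nonneg l; linarith)
    have h2 := abs_le_of_mem_band hl
    refine Finset.mem_image.2 ⟨(l + N).toNat, Finset.mem_range.2 ?_, by omega⟩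
    have h4 := le_abs_self l
    omega
  have hinj : Set.InjOn (fun n : ℕ => (n : ℤ) - N) (Finset.range (N + N)) := fun a _ b _ h => by
    simpa using h
  calc ∑ l ∈ band N, F l ≤ ∑ l ∈ (Finset.range (N + N)).image fun n : ℕ => (n : ℤ) - N, F l :=
        Finset.sum_le_sum_of_subset_of_nonneg hsub fun _ _ _ => sq_nonneg _
    _ = ∑ n ∈ Finset.range (N + N), F ((n : ℤ) - N) := Finset.sum_image hinj
    _ = ∑ n ∈ Finset.range N, F n + ∑ n ∈ Finset.range N, F n := by
        rw [Finset.sum_range_add]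
        congr 1
        · exact Finset.sum_congr rfl fun n _ => hper n
        · exact Finset.sum_congr rfl fun n _ => by congr 1; push_cast; ring
    _ = _ := by rw [sum_range_norm_sq hN]; ring

/-- The quadratic form is the spectral weight integrated against the squared discrete transform of
`v`; weights at most `K/N` therefore bound the norm of the correlation matrix. -/
theorem sum_gridCorr_le {N : ℕ} {h : ℤ → ℝ} {K : ℝ} (hh : IsBandWeight N h K)
    (heven : ∀ l, h (-l) = h l) (v : Finset.Icc 1 N → ℝ) :
    ∑ k, ∑ j, v k * v j * gridCorr N h k j ≤ 2 * K * ∑ k, v k ^ 2 := by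
  have hN : N ≠ 0 := hh.pos.ne'
  have hNpos : (0 : ℝ) < N := by exact_mod_cast hh.pos
  have e : ((∑ k, ∑ j, v k * v j * gridCorr N h k j : ℝ) : ℂ)
      = ((∑ l ∈ band N, h l * ‖∑ k, (v k : ℂ) * fourier l (grid N k)‖ ^ 2 : ℝ) : ℂ) := by
    push_cast
    simp_rw [ofReal_gridCorr heven, Finset.mul_sum]
    simp_rw [Finset.sum_comm (t := band N)]
    refine Finset.sum_congr rfl fun l _ => ?_
    rw [← Complex.mul_conj', map_sum, Finset.sum_mul_sum, Finset.mul_sum]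
    refine Finset.sum_congr rfl fun k _ => ?_
    rw [Finset.mul_sum]
    refine Finset.sum_congr rfl fun j _ => ?_
    rw [map_mul, Complex.conj_ofReal, ← fourier_neg]
    ring
  have e' : ∑ k, ∑ j, v k * v j * gridCorr N h k j
      = ∑ l ∈ band N, h l * ‖∑ k, (v k : ℂ) * fourier l (grid N k)‖ ^ 2 := by exact_mod_cast e
  rw [e']
  calc _ ≤ ∑ l ∈ band N, K / N * ‖∑ k, (v k : ℂ) * fourier l (grid N k)‖ ^ 2 := by
        gcongr with l hl
        exact hh.le l hl
    _ = K / N * ∑ l ∈ band N, ‖∑ k, (v k : ℂ) * fourier l (grid N k)‖ ^ 2 := by rw [Finset.mul_sum]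
    _ ≤ K / N * (2 * N * ∑ k, v k ^ 2) := by
        have := hh.K_nonneg
        gcongr
        exact sum_band_norm_sq_le hN v
    _ = _ := by field_simp

theorem gridCorr_self {N : ℕ} {h : ℤ → ℝ} {K : ℝ} (hh : IsBandWeight N h K) (k : Finset.Icc 1 N) :
    gridCorr N h k k = 1 := by
  unfold gridCorr
  rw [sub_self, ← hh.sum_eq]
  refine Finset.sum_congr rfl fun l _ => ?_
  simp

theorem skewVariance_gridCorr {N : ℕ} (hN : N ≠ 0) {h : ℤ → ℝ} (heven : ∀ l, h (-l) = h l) :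
    IsCorrelatedGaussian.skewVariance (gridCorr N h)
      = 6 * ∑ l ∈ bandTuples 3 N, resWeight N h l := by
  rw [← sum_gridCorr_pow hN heven, IsCorrelatedGaussian.skewVariance]
  simp only [← Finset.mul_sum, Fintype.card_coe, Nat.card_Icc, Nat.add_sub_cancel]
  ring

theorem kurtVariance_gridCorr {N : ℕ} (hN : N ≠ 0) {h : ℤ → ℝ} (heven : ∀ l, h (-l) = h l) :
    IsCorrelatedGaussian.kurtVariance (gridCorr N h)
      = 72 * ∑ l ∈ bandTuples 2 N, resWeight N h l + 24 * ∑ l ∈ bandTuples 4 N, resWeight N h l := by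
  rw [← sum_gridCorr_pow hN heven, ← sum_gridCorr_pow hN heven, IsCorrelatedGaussian.kurtVariance]
  simp only [← Finset.mul_sum, Finset.sum_add_distrib, Fintype.card_coe, Nat.card_Icc,
    Nat.add_sub_cancel]
  ring

/-! ### The law of the wavelet coefficients -/

namespace IsTorusField

variable {P : Measure Ω} {X : Torus → Ω → ℝ} [IsProbabilityMeasure P]

theorem ofReal_beta_eq (hX : IsTorusField P X) {a : ℝ → ℝ} (ha : ∀ ξ, a (-ξ) = a ξ) (N : ℕ) :
    ∀ᵐ ω ∂P, ∀ k, (beta a X N k ω : ℂ)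
      = ((1 / √(N : ℝ) : ℝ) : ℂ) * ∑ l ∈ band N, ((a (4 * l / N) : ℝ) : ℂ) * (fourier l (grid N k) * w X l ω) := by
  filter_upwards [hX.memLp_path] with ω hω k
  have hc : MemLp (fun t => (X t ω : ℂ)) 2 haar := hω.ofReal
  have hint : ∀ l : ℤ, Integrable (fun t => fourier l t * (X t ω : ℂ)) haar := fun l => by
    refine (hc.integrable one_le_two).bdd_mul (c := 1)
      (fourier l).continuous.aestronglyMeasurable (ae_of_all _ fun t => ?_)
    rw [fourier_norm_apply]
  have e1 : ∀ t : Torus, ((X t ω * psi a N (t - grid N k) : ℝ) : ℂ)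
      = ∑ l ∈ band N, ((1 / √(N : ℝ) : ℝ) : ℂ) * ((a (4 * l / N) : ℝ) : ℂ) * fourier (-l) (grid N k)
        * (fourier l t * (X t ω : ℂ)) := fun t => by
    rw [Complex.ofReal_mul, ← psiC_eq_psi ha, psiC, Finset.mul_sum, Finset.mul_sum]
    refine Finset.sum_congr rfl fun l _ => ?_
    rw [fourier_sub_apply]
    ring
  have e2 : (beta a X N k ω : ℂ) = ∫ t : Torus, ((X t ω * psi a N (t - grid N k) : ℝ) : ℂ) ∂haar := by
    rw [integral_complex_ofReal]
    rfl
  rw [e2]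
  simp_rw [e1]
  rw [integral_finsetSum _ fun l _ => (hint l).const_mul _, Finset.mul_sum, ← sum_band_neg]
  refine Finset.sum_congr rfl fun l _ => ?_
  rw [integral_const_mul, w_eq]
  have e3 : (4 * ((-l : ℤ) : ℝ) / N) = -(4 * (l : ℝ) / N) := by push_cast; ring
  rw [e3, ha, neg_neg]
  ring

theorem integral_sum_w_mul_sum_w (hX : IsTorusField P X) (N : ℕ) (c d : ℤ → ℂ) :
    ∫ ω, (∑ l ∈ band N, c l * w X l ω) * ∑ m ∈ band N, d m * w X m ω ∂P
      = ∑ l ∈ band N, c l * d (-l) * (C P X l : ℂ) := by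
  have hI : ∀ l m, Integrable (fun ω => c l * w X l ω * (d m * w X m ω)) P := fun l m =>
    ((hX.memLp_w l).const_mul _).integrable_mul ((hX.memLp_w m).const_mul _)
  simp_rw [Finset.sum_mul_sum]
  rw [integral_finsetSum _ fun l _ => integrable_finsetSum _ fun m _ => hI l m]
  refine Finset.sum_congr rfl fun l hl => ?_
  have e : ∀ m, ∫ ω, c l * w X l ω * (d m * w X m ω) ∂P
      = c l * d m * ∫ ω, w X l ω * w X m ω ∂P := fun m => by
    rw [← integral_const_mul]
    congr 1; ext ω; ring
  rw [integral_finsetSum _ fun m _ => hI l m, Finset.sum_eq_single (-l)]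
  · rw [e]
    congr 1
    simp_rw [w_neg, Complex.mul_conj, Complex.normSq_eq_norm_sq, integral_complex_ofReal]
    rfl
  · intro m _ hm
    rw [e, hX.integral_w_mul_w (by omega), mul_zero]
  · exact fun h => absurd (neg_mem_band.2 hl) h

theorem hasGaussianLaw_betaHat (hX : IsTorusField P X) {α : ℝ} (hA : AssumptionA1 P X α)
    (hB : IsGaussianProcess X P) {a : ℝ → ℝ} (ha : ∀ ξ, a (-ξ) = a ξ) (N : ℕ) :
    HasGaussianLaw (fun ω (k : Finset.Icc 1 N) => betaHat a P X N k ω) P := by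
  set r : ℝ := 1 / √(N : ℝ) / √(sigmaSq a P X N) with hr
  set L : (band N → ℂ) →L[ℝ] (Finset.Icc 1 N → ℝ) :=
    ContinuousLinearMap.pi fun k => r • ∑ l : band N, Complex.reCLM.comp
      ((ContinuousLinearMap.mul ℝ ℂ (((a (4 * (l : ℤ) / N) : ℝ) : ℂ) * fourier (l : ℤ) (grid N k))).comp
        (ContinuousLinearMap.proj (R := ℝ) (φ := fun _ : band N => ℂ) l)) with hL
  refine (((hX.isGaussianProcess_w hA hB).hasGaussianLaw (band N)).map_fun L).congr ?_
  filter_upwards [hX.ofReal_beta_eq ha N] with ω hω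
  ext k
  have h1 : beta a X N k ω = 1 / √(N : ℝ) * ∑ l ∈ band N, (((a (4 * l / N) : ℝ) : ℂ) * (fourier l (grid N k) * w X l ω)).re := by
    rw [← Complex.re_sum, ← Complex.re_ofReal_mul, ← hω k, Complex.ofReal_re]
  rw [betaHat, h1, ← Finset.sum_coe_sort]
  simp only [hL, ContinuousLinearMap.pi_apply, smul_apply, sum_apply, smul_eq_mul,
    ContinuousLinearMap.comp_apply, ContinuousLinearMap.proj_apply, Finset.restrict,
    ContinuousLinearMap.mul_apply', Complex.reCLM_apply, hr, mul_assoc]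
  ring

/-- Links the field to the abstract central limit theorem: only the pairs `(l, -l)` contribute to
covariances, so they are the Fourier sums `gridCorr`, with constant `2K` from `sum_gridCorr_le`. -/
theorem isCorrelatedGaussian_betaHat (hX : IsTorusField P X) {α : ℝ} (hA : AssumptionA1 P X α)
    (hB : IsGaussianProcess X P) {a : ℝ → ℝ} (ha : IsNeedletWindow a) {N : ℕ} {K : ℝ}
    (hh : IsBandWeight N (specWeight a P X N) K) (hσ : 0 < sigmaSq a P X N) :
    IsCorrelatedGaussian (P.map fun ω (k : Finset.Icc 1 N) => betaHat a P X N k ω)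
      (gridCorr N (specWeight a P X N)) (2 * K) := by
  have hG := hX.hasGaussianLaw_betaHat hA hB ha.even N
  have hm := hG.aemeasurable
  have hNpos : (0 : ℝ) < N := by exact_mod_cast hh.pos
  set s : ℂ := ((1 / √(N : ℝ) / √(sigmaSq a P X N) : ℝ) : ℂ) with hs
  have hs2 : s * s = ((1 / (N * sigmaSq a P X N) : ℝ) : ℂ) := by
    rw [hs, ← Complex.ofReal_mul]
    congr 1
    rw [div_div, div_mul_div_comm, one_mul, mul_mul_mul_comm, Real.mul_self_sqrt hNpos.le,
      Real.mul_self_sqrt hσ.le]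
  have hβ : ∀ᵐ ω ∂P, ∀ k, (betaHat a P X N k ω : ℂ)
      = ∑ l ∈ band N, (s * ((a (4 * l / N) : ℝ) : ℂ) * fourier l (grid N k)) * w X l ω := by
    filter_upwards [hX.ofReal_beta_eq ha.even N] with ω hω k
    rw [betaHat, Complex.ofReal_div, hω k, hs, Finset.mul_sum, Finset.sum_div]
    refine Finset.sum_congr rfl fun l _ => ?_
    push_cast
    ring
  have hcov : ∀ i j : Finset.Icc 1 N, ∫ ω, betaHat a P X N i ω * betaHat a P X N j ω ∂P
      = gridCorr N (specWeight a P X N) i j := by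
    intro i j
    have e : ((∫ ω, betaHat a P X N i ω * betaHat a P X N j ω ∂P : ℝ) : ℂ)
        = (gridCorr N (specWeight a P X N) i j : ℂ) := by
      rw [← integral_complex_ofReal, ofReal_gridCorr (specWeight_neg ha P X N)]
      have e1 : ∫ ω, ((betaHat a P X N i ω * betaHat a P X N j ω : ℝ) : ℂ) ∂P
          = ∫ ω, (∑ l ∈ band N, (s * ((a (4 * l / N) : ℝ) : ℂ) * fourier l (grid N i)) * w X l ω)
            * ∑ l ∈ band N, (s * ((a (4 * l / N) : ℝ) : ℂ) * fourier l (grid N j)) * w X l ω ∂P := by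
        refine integral_congr_ae ?_
        filter_upwards [hβ] with ω hω
        rw [Complex.ofReal_mul, hω, hω]
      rw [e1, hX.integral_sum_w_mul_sum_w N
        (fun l => s * ((a (4 * l / N) : ℝ) : ℂ) * fourier l (grid N i))
        (fun l => s * ((a (4 * l / N) : ℝ) : ℂ) * fourier l (grid N j))]
      refine Finset.sum_congr rfl fun l _ => ?_
      have e3 : (4 * ((-l : ℤ) : ℝ) / N) = -(4 * (l : ℝ) / N) := by push_cast; ring
      rw [e3, ha.even]
      have e4 : (specWeight a P X N l : ℂ)
          = s * s * ((a (4 * l / N) : ℝ) : ℂ) ^ 2 * (C P X l : ℂ) := by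
        rw [hs2, specWeight]
        push_cast
        ring
      rw [e4]
      ring
    exact_mod_cast e
  have hmeas : ∀ f : (Finset.Icc 1 N → ℝ) → ℝ, Continuous f →
      ∫ x, f x ∂(P.map fun ω (k : Finset.Icc 1 N) => betaHat a P X N k ω)
        = ∫ ω, f (fun k => betaHat a P X N k ω) ∂P := fun f hf =>
    integral_map hm hf.aestronglyMeasurable
  refine ⟨hG.isGaussian_map, fun i => ?_, fun i j => ?_, fun i => gridCorr_self hh i, fun v => ?_⟩
  · rw [hmeas _ (continuous_apply i)]
    have e : ((∫ ω, betaHat a P X N i ω ∂P : ℝ) : ℂ) = 0 := by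
      rw [← integral_complex_ofReal]
      rw [integral_congr_ae (hβ.mono fun ω hω => hω i),
        integral_finsetSum _ fun l _ => ((hX.memLp_w l).integrable one_le_two).const_mul _]
      refine Finset.sum_eq_zero fun l _ => ?_
      rw [integral_const_mul, hX.w_centered, mul_zero]
    exact_mod_cast e
  · rw [hmeas (fun x => x i * x j) (by fun_prop)]
    exact hcov i j
  · rw [hmeas (fun x => (∑ i, v i * x i) ^ 2) (by fun_prop)]
    have hL2 : ∀ i : Finset.Icc 1 N, MemLp (fun ω => betaHat a P X N i ω) 2 P := fun i =>
      (hG.eval i).memLp_two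
    have hI : ∀ i j : Finset.Icc 1 N, Integrable (fun ω => v i * v j *
        (betaHat a P X N i ω * betaHat a P X N j ω)) P := fun i j =>
      ((hL2 i).integrable_mul (hL2 j)).const_mul _
    have e : ∀ ω, (∑ i : Finset.Icc 1 N, v i * betaHat a P X N i ω) ^ 2
        = ∑ i : Finset.Icc 1 N, ∑ j : Finset.Icc 1 N,
          v i * v j * (betaHat a P X N i ω * betaHat a P X N j ω) := fun ω => by
      rw [sq, Finset.sum_mul_sum]
      exact Finset.sum_congr rfl fun i _ => Finset.sum_congr rfl fun j _ => by ring
    simp_rw [e]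
    rw [integral_finsetSum _ fun i _ => integrable_finsetSum _ fun j _ => hI i j]
    refine le_trans (le_of_eq ?_) (sum_gridCorr_le hh (specWeight_neg ha P X N) v)
    refine Finset.sum_congr rfl fun i _ => ?_
    rw [integral_finsetSum _ fun j _ => hI i j]
    exact Finset.sum_congr rfl fun j _ => by rw [integral_const_mul, hcov]

/-- The wavelet coefficients of one resolution sum up to zero. -/
theorem sum_betaHat (hX : IsTorusField P X) {a : ℝ → ℝ} (ha : ∀ ξ, a (-ξ) = a ξ) {N : ℕ}
    (hN : N ≠ 0) : ∀ᵐ ω ∂P, ∑ k : Finset.Icc 1 N, betaHat a P X N k ω = 0 := by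
  filter_upwards [hX.ofReal_beta_eq ha N] with ω hω
  have e : ((∑ k : Finset.Icc 1 N, beta a X N k ω : ℝ) : ℂ) = 0 := by
    rw [Complex.ofReal_sum]
    simp_rw [hω]
    rw [← Finset.mul_sum, Finset.sum_comm]
    refine mul_eq_zero_of_right _ (Finset.sum_eq_zero fun l hl => ?_)
    rw [← Finset.mul_sum, ← Finset.sum_mul, sum_grid_fourier hN, if_neg, zero_mul, mul_zero]
    -- A frequency of the band is nonzero with `2|l| ≤ N`, hence not a multiple of `N`, and its
    -- character sums to zero over the grid.
    intro hdvd
    have h1 := abs_le_of_mem_band hl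
    have h2 := ne_zero_of_mem_band hN hl
    have h3 : 0 < |l| := abs_pos.2 h2
    exact h2 (Int.eq_zero_of_abs_lt_dvd hdvd (by omega))
  have e' : ∑ k : Finset.Icc 1 N, beta a X N k ω = 0 := by exact_mod_cast e
  simp only [betaHat, ← Finset.sum_div, e', zero_div]

end IsTorusField

end TorusNeedlet

namespace TorusNeedlet

variable {Ω : Type*} [MeasurableSpace Ω]

/-! ### Convergence in probability to constants -/

section InMeasure

variable {P : Measure Ω} {f g : ℕ → Ω → ℝ} {a b : ℝ}

/-- Continuity at the limit point alone suffices, which allows inverses and quotients. -/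
theorem tendstoInMeasure_map₂ {E : Type*} [PseudoMetricSpace E] {F : ℝ × ℝ → E} (hF : ContinuousAt F (a, b))
    (hf : TendstoInMeasure P f atTop fun _ => a) (hg : TendstoInMeasure P g atTop fun _ => b) :
    TendstoInMeasure P (fun n ω => F (f n ω, g n ω)) atTop fun _ => F (a, b) := by
  rw [tendstoInMeasure_iff_dist] at hf hg ⊢
  intro ε hε
  obtain ⟨δ, hδ, h⟩ := Metric.continuousAt_iff.1 hF ε hε
  have h0 := (hf δ hδ).add (hg δ hδ)
  rw [add_zero] at h0
  refine tendsto_of_tendsto_of_tendsto_of_le_of_le tendsto_const_nhds h0 (fun _ => zero_le)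
    fun n => ?_
  refine (measure_mono fun ω hω => ?_).trans (measure_union_le _ _)
  by_contra hcon
  simp only [Set.mem_union, Set.mem_ofPred_eq, not_or, not_le] at hcon
  have := h (x := (f n ω, g n ω)) (by rw [Prod.dist_eq]; exact max_lt hcon.1 hcon.2)
  exact absurd this (not_lt.2 hω)

theorem tendstoInMeasure_comp {F : ℝ → ℝ} (hF : ContinuousAt F a)
    (hf : TendstoInMeasure P f atTop fun _ => a) :
    TendstoInMeasure P (fun n ω => F (f n ω)) atTop fun _ => F a :=
  tendstoInMeasure_map₂ (F := fun p => F p.1) (b := a) (hF.comp_of_eq continuousAt_fst rfl) hf hf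

theorem tendstoInMeasure_add (hf : TendstoInMeasure P f atTop fun _ => a)
    (hg : TendstoInMeasure P g atTop fun _ => b) :
    TendstoInMeasure P (fun n ω => f n ω + g n ω) atTop fun _ => a + b :=
  tendstoInMeasure_map₂ (F := fun p => p.1 + p.2) (by fun_prop) hf hg

theorem tendstoInMeasure_mul (hf : TendstoInMeasure P f atTop fun _ => a)
    (hg : TendstoInMeasure P g atTop fun _ => b) :
    TendstoInMeasure P (fun n ω => f n ω * g n ω) atTop fun _ => a * b :=
  tendstoInMeasure_map₂ (F := fun p => p.1 * p.2) (by fun_prop) hf hg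

theorem tendstoInMeasure_bounded_mul {c : ℕ → ℝ} {B : ℝ} (hc : ∀ᶠ n in atTop, |c n| ≤ B)
    (hf : TendstoInMeasure P f atTop fun _ => 0) :
    TendstoInMeasure P (fun n ω => c n * f n ω) atTop fun _ => 0 := by
  rw [tendstoInMeasure_iff_dist] at hf ⊢
  intro ε hε
  have h0 := hf (ε / (|B| + 1)) (by positivity)
  refine tendsto_of_tendsto_of_tendsto_of_le_of_le' tendsto_const_nhds h0
    (Eventually.of_forall fun _ => zero_le) ?_
  filter_upwards [hc] with n hn
  refine measure_mono fun ω hω => ?_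
  simp only [Set.mem_ofPred_eq, Real.dist_eq, sub_zero, abs_mul] at hω ⊢
  rw [div_le_iff₀ (by positivity), mul_comm]
  refine hω.trans (mul_le_mul_of_nonneg_right ?_ (abs_nonneg _))
  exact hn.trans ((le_abs_self B).trans (by linarith))

theorem tendstoInMeasure_of_eventuallyEq (h : ∀ᶠ n in atTop, ∀ ω, f n ω = g n ω)
    (hf : TendstoInMeasure P f atTop fun _ => a) : TendstoInMeasure P g atTop fun _ => a :=
  hf.congr' (h.mono fun _ hn => ae_of_all _ hn) (ae_eq_refl _)

/-- A variable is small in probability when it is bounded, where `η ≤ 1`, by a product `η Z` with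
`η` small in mean square and `Z` bounded in mean. -/
theorem tendstoInMeasure_of_le_mul [IsProbabilityMeasure P] {η Z : ℕ → Ω → ℝ} {e : ℕ → ℝ} {B : ℝ}
    (he : Tendsto e atTop (𝓝 0))
    (hη : ∀ᶠ n in atTop, (∀ ω, 0 ≤ η n ω) ∧ Integrable (fun ω => η n ω ^ 2) P ∧
      ∫ ω, η n ω ^ 2 ∂P ≤ e n)
    (hZ : ∀ᶠ n in atTop, (∀ ω, 0 ≤ Z n ω) ∧ Integrable (Z n) P ∧ ∫ ω, Z n ω ∂P ≤ B)
    (hf : ∀ᶠ n in atTop, ∀ ω, η n ω ≤ 1 → |f n ω| ≤ η n ω * Z n ω) :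
    TendstoInMeasure P f atTop fun _ => 0 := by
  rw [tendstoInMeasure_iff_measureReal_dist]
  intro ε hε
  rw [Metric.tendsto_nhds]
  intro r hr
  -- Off the events `η ≥ δ` and `Z ≥ ε/δ` the product is below `ε`. By Markov their probabilities
  -- are at most `e/δ²` and `δB/ε`; `δ` settles the second, and then `n` large settles the first.
  obtain ⟨δ, hδ, hδ1, hδ2⟩ : ∃ δ : ℝ, 0 < δ ∧ δ ≤ 1 ∧ δ * |B| / ε ≤ r / 4 := by
    refine ⟨min 1 (r * ε / (4 * (|B| + 1))), lt_min one_pos (by positivity), min_le_left _ _, ?_⟩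
    rw [div_le_iff₀ hε]
    calc min 1 (r * ε / (4 * (|B| + 1))) * |B| ≤ r * ε / (4 * (|B| + 1)) * (|B| + 1) := by
          gcongr
          · exact min_le_right _ _
          · linarith
      _ = r / 4 * ε := by field_simp
  have hδe : ∀ᶠ n in atTop, e n < δ ^ 2 * (r / 4) := he.eventually_lt_const (by positivity)
  filter_upwards [hη, hZ, hf, hδe] with n ⟨hη0, hηi, hηe⟩ ⟨hZ0, hZi, hZB⟩ hfn hen
  rw [Real.dist_0_eq_abs, abs_of_nonneg measureReal_nonneg]
  have hsub : {ω | ε ≤ dist (f n ω) 0} ⊆ {ω | δ ^ 2 ≤ η n ω ^ 2} ∪ {ω | ε / δ ≤ Z n ω} := by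
    intro ω hω
    by_contra hcon
    simp only [Set.mem_union, Set.mem_ofPred_eq, not_or, not_le] at hcon
    have h1 : η n ω < δ := lt_of_pow_lt_pow_left₀ 2 hδ.le hcon.1
    have h2 := hfn ω (h1.le.trans hδ1)
    simp only [Set.mem_ofPred_eq, Real.dist_0_eq_abs] at hω
    have h3 : Z n ω * δ < ε := by
      have := hcon.2
      rwa [lt_div_iff₀ hδ] at this
    have h4 : η n ω * Z n ω ≤ δ * Z n ω := mul_le_mul_of_nonneg_right h1.le (hZ0 ω)
    linarith
  have m1 : δ ^ 2 * P.real {ω | δ ^ 2 ≤ η n ω ^ 2} ≤ ∫ ω, η n ω ^ 2 ∂P :=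
    mul_meas_ge_le_integral_of_nonneg (ae_of_all _ fun _ => sq_nonneg _) hηi _
  have m2 : ε / δ * P.real {ω | ε / δ ≤ Z n ω} ≤ ∫ ω, Z n ω ∂P :=
    mul_meas_ge_le_integral_of_nonneg (ae_of_all _ hZ0) hZi _
  have b1 : P.real {ω | δ ^ 2 ≤ η n ω ^ 2} ≤ r / 4 := by
    have : 0 < δ ^ 2 := by positivity
    nlinarith
  have b2 : P.real {ω | ε / δ ≤ Z n ω} ≤ r / 4 := by
    refine le_trans ?_ hδ2
    rw [le_div_iff₀ hε]
    have h1 := (m2.trans hZB).trans (le_abs_self B)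
    rw [div_mul_eq_mul_div, div_le_iff₀ hδ] at h1
    linarith
  calc P.real {ω | ε ≤ dist (f n ω) 0}
      ≤ P.real {ω | δ ^ 2 ≤ η n ω ^ 2} + P.real {ω | ε / δ ≤ Z n ω} :=
        (measureReal_mono hsub).trans (measureReal_union_le _ _)
    _ < r := by linarith

theorem tendstoInMeasure_of_integral_sq [IsProbabilityMeasure P] {e : ℕ → ℝ}
    (he : Tendsto e atTop (𝓝 0))
    (hf : ∀ᶠ n in atTop, Integrable (fun ω => f n ω ^ 2) P ∧ ∫ ω, f n ω ^ 2 ∂P ≤ e n) :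
    TendstoInMeasure P f atTop fun _ => 0 := by
  refine tendstoInMeasure_of_le_mul (η := fun n ω => |f n ω|) (Z := fun _ _ => 1) (B := 1) he ?_
    (Eventually.of_forall fun n => ⟨fun _ => zero_le_one, integrable_const _, by simp⟩)
    (Eventually.of_forall fun n ω _ => by simp)
  filter_upwards [hf] with n hn
  simpa only [sq_abs] using ⟨fun ω => abs_nonneg _, hn⟩

end InMeasure

/-! ### Sampling rates -/

namespace AssumptionD

variable {α : ℝ} {j M : ℕ → ℕ}

theorem res_pos (j : ℕ) : 0 < res j := pow_pos two_pos _

theorem tendsto_res (hD : AssumptionD α j M) : Tendsto (fun n => res (j n)) atTop atTop := by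
  have h1 : Tendsto (fun n => 1 / (res (j n) : ℝ)) atTop (𝓝 0) :=
    squeeze_zero (fun n => by positivity) (fun n => le_add_of_nonneg_right (by positivity)) hD.2
  have h2 : Tendsto (fun n => (res (j n) : ℝ)) atTop atTop := by
    have h3 : Tendsto (fun n => 1 / (res (j n) : ℝ)) atTop (𝓝[>] 0) :=
      tendsto_nhdsWithin_iff.2 ⟨h1, Eventually.of_forall fun n => by
        have := res_pos (j n)
        have : (0 : ℝ) < res (j n) := by exact_mod_cast this
        exact one_div_pos.2 this⟩
    refine h3.inv_tendsto_nhdsGT_zero.congr fun n => ?_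
    simp
  exact tendsto_natCast_atTop_iff.1 h2

theorem tendsto_ratio (hD : AssumptionD α j M) :
    Tendsto (fun n => (res (j n) : ℝ) / (M n : ℝ) ^ (α / (α + 1))) atTop (𝓝 0) :=
  squeeze_zero (fun n => by positivity) (fun n => le_add_of_nonneg_left (by positivity)) hD.2

theorem eventually_res_le (hD : AssumptionD α j M) (hα : 1 < α) :
    ∀ᶠ n in atTop, M n ≠ 0 ∧ res (j n) ≤ M n := by
  filter_upwards [hD.tendsto_ratio.eventually_lt_const zero_lt_one,
    hD.1.eventually_ge_atTop 1] with n h1 h2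
  have hM : (1 : ℝ) ≤ M n := by exact_mod_cast h2
  have hM0 : (0 : ℝ) < (M n : ℝ) ^ (α / (α + 1)) := by positivity
  rw [div_lt_one hM0] at h1
  have h3 : (M n : ℝ) ^ (α / (α + 1)) ≤ (M n : ℝ) ^ (1 : ℝ) :=
    Real.rpow_le_rpow_of_exponent_le hM (by rw [div_le_one (by linarith)]; linarith)
  rw [Real.rpow_one] at h3
  exact ⟨by omega, by exact_mod_cast (h1.le.trans h3)⟩

/-- `N^(α+1) M^(-α)` is the power `α + 1` of `N / M^(α/(α+1))`. -/
theorem tendsto_rate (hD : AssumptionD α j M) (hα : 1 < α) :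
    Tendsto (fun n => (res (j n) : ℝ) * (res (j n) : ℝ) ^ α * (M n : ℝ) ^ (-α)) atTop (𝓝 0) := by
  have h := hD.tendsto_ratio.rpow_const (p := α + 1) (Or.inr (by linarith))
  rw [Real.zero_rpow (by linarith)] at h
  refine h.congr fun n => ?_
  have hN : (0 : ℝ) < res (j n) := by exact_mod_cast res_pos (j n)
  rw [Real.div_rpow hN.le (by positivity), ← Real.rpow_mul (by positivity),
    div_mul_cancel₀ _ (by linarith), Real.rpow_add hN, Real.rpow_one, Real.rpow_neg (by positivity)]
  rw [div_eq_mul_inv]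
  ring

end AssumptionD

/-! ### Consistency of the polynomial forms -/

/-- The relative sampling error of the Fourier coefficients in the band. -/
def samplingError (P : Measure Ω) (X : Torus → Ω → ℝ) (N M : ℕ) (ω : Ω) : ℝ :=
  √(∑ l ∈ band N, ‖wTilde X M l ω - w X l ω‖ ^ 2 / C P X l)

/-- With `A`, `B` the normalised moduli, `|A² - B²| ≤ η(A + B) ≤ η(2B + 1) ≤ 2η(1 + B²)`. -/
theorem abs_sq_norm_sub_le {z y : ℂ} {c η : ℝ} (hc : 0 < c) (hη : 0 ≤ η) (hη1 : η ≤ 1)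
    (h : ‖y - z‖ ^ 2 / c ≤ η ^ 2) : |‖y‖ ^ 2 / c - ‖z‖ ^ 2 / c| ≤ 2 * η * (1 + ‖z‖ ^ 2 / c) := by
  set s := √c with hs
  have hs0 : 0 < s := Real.sqrt_pos.2 hc
  have hcs : c = s ^ 2 := (Real.sq_sqrt hc.le).symm
  have h1 : ‖y - z‖ / s ≤ η := by
    rw [hcs, ← div_pow] at h
    exact le_of_sq_le_sq h hη
  rw [hcs, ← div_pow, ← div_pow]
  set A := ‖y‖ / s
  set B := ‖z‖ / s
  have hA : 0 ≤ A := by positivity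
  have hB : 0 ≤ B := by positivity
  have h2 : |A - B| ≤ η := by
    refine le_trans ?_ h1
    simp only [A, B]
    rw [← sub_div, abs_div, abs_of_pos hs0]
    gcongr
    exact abs_norm_sub_norm_le y z
  have h3 : |A ^ 2 - B ^ 2| = |A - B| * (A + B) := by
    rw [sq_sub_sq, abs_mul, abs_of_nonneg (add_nonneg hA hB), mul_comm]
  have h4 : A ≤ B + η := by linarith [(abs_le.1 h2).2]
  rw [h3]
  calc |A - B| * (A + B) ≤ η * (2 * B + 1) :=
        mul_le_mul h2 (by linarith) (add_nonneg hA hB) hη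
    _ ≤ 2 * η * (1 + B ^ 2) := by
        nlinarith [mul_nonneg hη (sq_nonneg (B - 1)), mul_nonneg hη (sq_nonneg B)]

namespace IsTorusField

variable {P : Measure Ω} {X : Torus → Ω → ℝ} [IsProbabilityMeasure P]

/-- At most `3N` frequencies, each with aliasing error `O(M^(-α))` divided by `C_l ≥ c₁ N^(-α)`; the
aliasing bound applies as `2|l| ≤ N ≤ M`. -/
theorem exists_integral_samplingError_sq_le (hX : IsTorusField P X) {α : ℝ}
    (hA : AssumptionA1 P X α) : ∃ c : ℝ, ∀ N M : ℕ, N ≠ 0 → M ≠ 0 → N ≤ M →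
      Integrable (fun ω => samplingError P X N M ω ^ 2) P ∧
      ∫ ω, samplingError P X N M ω ^ 2 ∂P ≤ c * ((N : ℝ) * (N : ℝ) ^ α * (M : ℝ) ^ (-α)) := by
  obtain ⟨c₁, c₂, hc₁, -, hC⟩ := exists_C_bounds_band hA
  obtain ⟨c, hc0, hc⟩ := hX.exists_integral_norm_wTilde_sub_sq_le hA
  refine ⟨3 * (c / c₁), fun N M hN hM hNM => ?_⟩
  have hNpos : (0 : ℝ) < N := by exact_mod_cast Nat.pos_of_ne_zero hN
  have hC0 : ∀ l, 0 ≤ C P X l := fun l => integral_nonneg fun _ => sq_nonneg _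
  have e : ∀ ω, samplingError P X N M ω ^ 2
      = ∑ l ∈ band N, ‖wTilde X M l ω - w X l ω‖ ^ 2 / C P X l := fun ω =>
    Real.sq_sqrt (Finset.sum_nonneg fun l _ => div_nonneg (sq_nonneg _) (hC0 l))
  have hint : ∀ l, Integrable (fun ω => ‖wTilde X M l ω - w X l ω‖ ^ 2 / C P X l) P := fun l =>
    ((memLp_two_iff_integrable_sq_norm
      (memLp_fun_sub (hX.memLp_wTilde M l) (hX.memLp_w l)).1).1
        (memLp_fun_sub (hX.memLp_wTilde M l) (hX.memLp_w l))).div_const _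
  simp_rw [e]
  refine ⟨integrable_finsetSum _ fun l _ => hint l, ?_⟩
  rw [integral_finsetSum _ fun l _ => hint l]
  calc _ ≤ (band N).card • (c * (M : ℝ) ^ (-α) / (c₁ * (N : ℝ) ^ (-α))) := by
        refine Finset.sum_le_card_nsmul _ _ _ fun l hl => ?_
        rw [integral_div]
        have h1 := hc M l hM (by have := abs_le_of_mem_band hl; omega)
        have h2 := (hC N hN l hl).1
        gcongr
    _ ≤ (3 * N) * (c * (M : ℝ) ^ (-α) / (c₁ * (N : ℝ) ^ (-α))) := by
        rw [nsmul_eq_mul]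
        gcongr
        have h1 := card_band_le N
        have h2 : 1 ≤ N := Nat.one_le_iff_ne_zero.2 hN
        have : (band N).card ≤ 3 * N := by omega
        exact_mod_cast this
    _ = _ := by
        rw [Real.rpow_neg hNpos.le]
        field_simp

/-- Consistency of the polynomial forms in the periodogram and in its discrete version. -/
theorem tendstoInMeasure_powerForm (hX : IsTorusField P X) {α : ℝ} (hA : AssumptionA1 P X α)
    (hB : IsGaussianProcess X P) {j M : ℕ → ℕ} (hD : AssumptionD α j M) {p : ℕ} (hp : p ≠ 0)
    {T : ℕ → Finset (Fin p → ℤ)} {κ : ℕ → (Fin p → ℤ) → ℝ} {A : ℝ}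
    (hT : ∀ n, ∀ l ∈ T n, ∀ i, l i ∈ band (res (j n)))
    (hκ : ∀ᶠ n in atTop, (∀ l, 0 ≤ κ n l) ∧ ∑ l ∈ T n, κ n l ≤ A ∧
      ∀ l ∈ T n, ∑ l' ∈ (T n).filter (fun l' => ∃ i j, |l i| = |l' j|), κ n l' ≤ A / res (j n)) :
    TendstoInMeasure P (fun n ω => powerForm P (fun l ω => ‖w X l ω‖ ^ 2 / C P X l) (T n) (κ n)
        (fun l => ‖w X l ω‖ ^ 2 / C P X l) - ∑ l ∈ T n, κ n l) atTop (fun _ => 0) ∧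
    TendstoInMeasure P (fun n ω => powerForm P (fun l ω => ‖w X l ω‖ ^ 2 / C P X l) (T n) (κ n)
        (fun l => ‖wTilde X (M n) l ω‖ ^ 2 / C P X l) - ∑ l ∈ T n, κ n l) atTop (fun _ => 0) := by
  have hu := hX.isPowerFamily hA hB
  set u : ℤ → Ω → ℝ := fun l ω => ‖w X l ω‖ ^ 2 / C P X l with hudef
  obtain ⟨B, hB0, hbd⟩ := hu.exists_powerForm_bounds hp
  obtain ⟨c₁, c₂, hc₁, -, hC⟩ := exists_C_bounds_band hA
  obtain ⟨c, hc⟩ := hX.exists_integral_samplingError_sq_le hA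
  have hN : ∀ n, res (j n) ≠ 0 := fun n => (AssumptionD.res_pos (j n)).ne'
  have hbd' := fun n (h : (∀ l, 0 ≤ κ n l) ∧ ∑ l ∈ T n, κ n l ≤ A ∧
      ∀ l ∈ T n, ∑ l' ∈ (T n).filter (fun l' => ∃ i j, |l i| = |l' j|), κ n l' ≤ A / res (j n)) =>
    hbd (T n) (κ n) A (A / res (j n))
      (div_nonneg ((Finset.sum_nonneg fun l _ => h.1 l).trans h.2.1) (Nat.cast_nonneg _))
      (fun l hl i => ne_zero_of_mem_band (hN n) (hT n l hl i)) h.1 h.2.1 h.2.2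
  have h1 : TendstoInMeasure P (fun n ω => powerForm P u (T n) (κ n) (fun l => u l ω)
      - ∑ l ∈ T n, κ n l) atTop (fun _ => 0) := by
    refine tendstoInMeasure_of_integral_sq (e := fun n => B * (A * (A / res (j n)))) ?_ ?_
    · have h0 : Tendsto (fun n => A / (res (j n) : ℝ)) atTop (𝓝 0) :=
        tendsto_const_nhds.div_atTop (tendsto_natCast_atTop_atTop.comp hD.tendsto_res)
      simpa using (h0.const_mul A).const_mul B
    · filter_upwards [hκ] with n hn
      exact ⟨(hbd' n hn).2.2.2, (hbd' n hn).1⟩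
  refine ⟨h1, ?_⟩
  have h2 : TendstoInMeasure P (fun n ω =>
      powerForm P u (T n) (κ n) (fun l => ‖wTilde X (M n) l ω‖ ^ 2 / C P X l)
        - powerForm P u (T n) (κ n) (fun l => u l ω)) atTop (fun _ => 0) := by
    have hκ0 : ∀ᶠ n in atTop, ∀ l, 0 ≤ κ n l := hκ.mono fun n hn => hn.1
    refine tendstoInMeasure_of_le_mul (η := fun n => samplingError P X (res (j n)) (M n))
      (Z := fun n ω => 2 * (p * 3 ^ p) * powerForm P u (T n) (κ n) (fun l => 1 + u l ω))
      (e := fun n => c * ((res (j n) : ℝ) * (res (j n) : ℝ) ^ α * (M n : ℝ) ^ (-α)))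
      (B := 2 * (p * 3 ^ p) * (B * A)) ?_ ?_ ?_ ?_
    · simpa using (hD.tendsto_rate hA.1).const_mul c
    · filter_upwards [hD.eventually_res_le hA.1] with n hn
      exact ⟨fun ω => Real.sqrt_nonneg _, hc _ _ (hN n) hn.1 hn.2⟩
    · filter_upwards [hκ] with n hn
      refine ⟨fun ω => mul_nonneg (by positivity) (Finset.sum_nonneg fun l _ => mul_nonneg (hn.1 l)
        (div_nonneg (Finset.prod_nonneg fun i _ => ?_) (integral_nonneg fun ω =>
          Finset.prod_nonneg fun i _ => hu.nonneg _ _))), (hbd' n hn).2.2.1.const_mul _, ?_⟩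
      · have := hu.nonneg (l i) ω
        positivity
      · rw [integral_const_mul]
        gcongr
        exact (hbd' n hn).2.1
    · filter_upwards [hκ0] with n hn ω hη
      have hη0 : 0 ≤ samplingError P X (res (j n)) (M n) ω := Real.sqrt_nonneg _
      refine (hu.abs_powerForm_sub_le (T n) hn hη0 hη fun l hl i => ?_).trans (le_of_eq (by ring))
      have hli := hT n l hl i
      have hCpos : 0 < C P X (l i) := by
        refine lt_of_lt_of_le ?_ (hC _ (hN n) _ hli).1
        have : (0 : ℝ) < res (j n) := by exact_mod_cast AssumptionD.res_pos (j n)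
        positivity
      refine abs_sq_norm_sub_le hCpos hη0 hη ?_
      have hC0 : ∀ l, 0 ≤ C P X l := fun l => integral_nonneg fun _ => sq_nonneg _
      rw [samplingError, Real.sq_sqrt (Finset.sum_nonneg fun l _ => div_nonneg (sq_nonneg _) (hC0 l))]
      -- Each relative error is one term of the sum defining `samplingError`, so the same `η` serves
      -- every frequency and every tuple.
      exact Finset.single_le_sum (f := fun l => ‖wTilde X (M n) l ω - w X l ω‖ ^ 2 / C P X l)
        (fun l _ => div_nonneg (sq_nonneg _) (hC0 l)) hli
  have h3 := tendstoInMeasure_add h2 h1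
  rw [add_zero] at h3
  exact tendstoInMeasure_of_eventuallyEq (Eventually.of_forall fun n ω => by ring) h3

end IsTorusField

end TorusNeedlet

/-! ### Consistency of the variance estimators and the joint limit law -/

namespace TorusNeedlet

variable {Ω : Type*} [MeasurableSpace Ω]

namespace IsTorusField

variable {P : Measure Ω} {X : Torus → Ω → ℝ} [IsProbabilityMeasure P]

/-- The sum of the weights of the resonant `p`-tuples. -/
def resSum (a : ℝ → ℝ) (P : Measure Ω) (X : Torus → Ω → ℝ) (p N : ℕ) : ℝ :=
  ∑ l ∈ bandTuples p N, resWeight N (specWeight a P X N) l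

/-- The form in the squared moduli of the coefficients `v` with the weights of the resonant
`p`-tuples. -/
def resForm (a : ℝ → ℝ) (P : Measure Ω) (X : Torus → Ω → ℝ) (p N : ℕ) (v : ℤ → ℂ) : ℝ :=
  powerForm P (fun l ω => ‖w X l ω‖ ^ 2 / C P X l) (bandTuples p N)
    (resWeight N (specWeight a P X N)) (fun l => ‖v l‖ ^ 2 / C P X l)

variable {α : ℝ} {a : ℝ → ℝ} {j M : ℕ → ℕ}

theorem tendstoInMeasure_resForm (hX : IsTorusField P X) (ha : IsNeedletWindow a)
    (hA : AssumptionA1 P X α) (hB : IsGaussianProcess X P) (hD : AssumptionD α j M) (p : ℕ) :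
    TendstoInMeasure P (fun n ω => resForm a P X (p + 2) (res (j n)) (fun l => w X l ω)
      - resSum a P X (p + 2) (res (j n))) atTop (fun _ => 0) ∧
    TendstoInMeasure P (fun n ω => resForm a P X (p + 2) (res (j n)) (fun l => wTilde X (M n) l ω)
      - resSum a P X (p + 2) (res (j n))) atTop (fun _ => 0) := by
  obtain ⟨K, c, hK, hc, hspec⟩ := exists_spectral_bounds ha hA
  refine hX.tendstoInMeasure_powerForm hA hB hD (Nat.succ_ne_zero _)
    -- One constant dominating both the total weight and `N` times the weight of tuples sharing a
    -- frequency.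
    (A := 3 * K + 2 * (p + 2) ^ 2 * (3 * K ^ 2))
    (fun n l hl i => Fintype.mem_piFinset.1 hl i) ?_
  filter_upwards [hD.tendsto_res.eventually hspec] with n hn
  have hh := hn.1
  refine ⟨fun l => hh.resWeight_nonneg l,
    (hh.sum_resWeight_le (p + 2) (Nat.succ_ne_zero _)).trans (le_add_of_nonneg_right (by positivity)),
    fun l _ => (hh.sum_resWeight_share_le p l).trans ?_⟩
  rw [← mul_div_assoc]
  gcongr
  exact le_add_of_nonneg_left (by positivity)

theorem tendstoInMeasure_bandMean (hX : IsTorusField P X) (ha : IsNeedletWindow a)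
    (hA : AssumptionA1 P X α) (hB : IsGaussianProcess X P) (hD : AssumptionD α j M) :
    TendstoInMeasure P (fun n ω => sigmaSqHat a X (res (j n)) ω / sigmaSq a P X (res (j n)))
      atTop (fun _ => 1) ∧
    TendstoInMeasure P (fun n ω => sigmaSqTilde a X (res (j n)) (M n) ω / sigmaSq a P X (res (j n)))
      atTop (fun _ => 1) := by
  obtain ⟨K, c, hK, hc, hspec⟩ := exists_spectral_bounds ha hA
  have hev := hD.tendsto_res.eventually hspec
  have hCne : ∀ n, ∀ l ∈ band (res (j n)),
      (∀ l ∈ band (res (j n)), c * (res (j n) : ℝ) ^ (-α) ≤ C P X l) → C P X l ≠ 0 :=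
    fun n l hl h => by
      have : (0 : ℝ) < res (j n) := by exact_mod_cast AssumptionD.res_pos (j n)
      exact (lt_of_lt_of_le (by positivity) (h l hl)).ne'
  have hsum : ∀ n, IsBandWeight (res (j n)) (specWeight a P X (res (j n))) K →
      ∑ l ∈ posBand (res (j n)), 2 * specWeight a P X (res (j n)) (l 0) = 1 := fun n hh => by
    rw [sum_posBand (fun l => 2 * specWeight a P X (res (j n)) l), ← Finset.mul_sum,
      ← sum_band_eq hh.pos.ne' (specWeight_neg ha P X _), hh.sum_eq]
  have h := hX.tendstoInMeasure_powerForm hA hB hD one_ne_zero (A := 1 + 2 * K)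
    (T := fun n => posBand (res (j n)))
    (κ := fun n l => 2 * specWeight a P X (res (j n)) (l 0))
    (fun n l hl i => (Finset.mem_filter.1 (Fintype.mem_piFinset.1 hl i)).1) (by
      filter_upwards [hev] with n hn
      have hh := hn.1
      refine ⟨fun l => mul_nonneg two_pos.le (hh.nonneg _), ?_, fun l hl => ?_⟩
      · rw [hsum n hh]
        linarith
      -- Positive one-tuples sharing a frequency up to sign coincide, so the shared weight is a
      -- single term, at most `2K/N`.
      · have hsub : (posBand (res (j n))).filter (fun l' => ∃ i j, |l i| = |l' j|) ⊆ {l} := by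
          intro l' hl'
          rw [Finset.mem_filter] at hl'
          obtain ⟨hl', i, i', h⟩ := hl'
          have e1 := (Finset.mem_filter.1 (Fintype.mem_piFinset.1 hl i)).2
          have e2 := (Finset.mem_filter.1 (Fintype.mem_piFinset.1 hl' i')).2
          rw [abs_of_pos e1, abs_of_pos e2] at h
          rw [Finset.mem_singleton]
          ext k
          rw [Subsingleton.elim k i', ← h, Subsingleton.elim i i']
        calc _ ≤ ∑ l' ∈ {l}, 2 * specWeight a P X (res (j n)) (l' 0) :=
              Finset.sum_le_sum_of_subset_of_nonneg hsub fun l _ _ =>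
                mul_nonneg two_pos.le (hh.nonneg _)
          _ ≤ 2 * (K / res (j n)) := by
              rw [Finset.sum_singleton]
              have := hh.le (l 0) (Finset.mem_filter.1 (Fintype.mem_piFinset.1 hl 0)).1
              gcongr
          _ ≤ _ := by
              rw [← mul_div_assoc]
              gcongr
              linarith)
  have hfin : ∀ v : ℕ → ℤ → Ω → ℂ, TendstoInMeasure P (fun n ω =>
      powerForm P (fun l ω => ‖w X l ω‖ ^ 2 / C P X l) (posBand (res (j n)))
        (fun l => 2 * specWeight a P X (res (j n)) (l 0)) (fun l => ‖v n l ω‖ ^ 2 / C P X l)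
        - ∑ l ∈ posBand (res (j n)), 2 * specWeight a P X (res (j n)) (l 0)) atTop (fun _ => 0) →
      TendstoInMeasure P (fun n ω => bandMean a (res (j n)) (fun l => ‖v n l ω‖ ^ 2)
        / sigmaSq a P X (res (j n))) atTop (fun _ => 1) := by
    intro v hv
    have h2 := tendstoInMeasure_comp (F := fun x => x + 1) (by fun_prop) hv
    simp only [zero_add] at h2
    refine tendstoInMeasure_of_eventuallyEq ?_ h2
    filter_upwards [hev] with n hn ω
    rw [bandMean_div_eq hn.1.pos.ne' hn.2.1.ne' fun l hl => hCne n l hl hn.2.2.1, hsum n hn.1]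
    ring
  exact ⟨hfin (fun _ l ω => w X l ω) h.1, hfin (fun n l ω => wTilde X (M n) l ω) h.2⟩

theorem tendstoInMeasure_normalizer (hX : IsTorusField P X) (ha : IsNeedletWindow a)
    (hA : AssumptionA1 P X α) (hB : IsGaussianProcess X P) (hD : AssumptionD α j M)
    (ν : Normalizer) : TendstoInMeasure P (fun n ω =>
      ν.value a P X (res (j n)) (M n) ω / sigmaSq a P X (res (j n))) atTop (fun _ => 1) := by
  cases ν with
  | exact =>
    obtain ⟨K, c, hK, hc, hspec⟩ := exists_spectral_bounds ha hA
    have h1 : TendstoInMeasure P (fun (_ : ℕ) (_ : Ω) => (1 : ℝ)) atTop (fun _ => 1) :=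
      tendstoInMeasure_iff_dist.2 fun ε hε => by simp [hε.not_ge]
    refine tendstoInMeasure_of_eventuallyEq ?_ h1
    filter_upwards [hD.tendsto_res.eventually hspec] with n hn ω
    exact (div_self hn.2.1.ne').symm
  | fourierBased => exact (hX.tendstoInMeasure_bandMean ha hA hB hD).1
  | sampleBased => exact (hX.tendstoInMeasure_bandMean ha hA hB hD).2

/-- The variance of `S_N`, kept away from zero for small `N`. -/
def skewScale (a : ℝ → ℝ) (P : Measure Ω) (X : Torus → Ω → ℝ) (c : ℝ) (N : ℕ) : ℝ :=
  max (6 * resSum a P X 3 N) c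

/-- The variance of `U_N`, kept away from zero for small `N`. -/
def kurtScale (a : ℝ → ℝ) (P : Measure Ω) (X : Torus → Ω → ℝ) (c : ℝ) (N : ℕ) : ℝ :=
  max (72 * resSum a P X 2 N + 24 * resSum a P X 4 N) c

omit [IsProbabilityMeasure P] in
theorem exists_scale (ha : IsNeedletWindow a) (hA : AssumptionA1 P X α) : ∃ K c : ℝ, 0 < K ∧ 0 < c ∧
    ∀ᶠ N : ℕ in atTop, IsBandWeight N (specWeight a P X N) K ∧ 0 < sigmaSq a P X N ∧
      (∀ l ∈ band N, C P X l ≠ 0) ∧ (∀ p, 0 ≤ resSum a P X p N) ∧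
      (∀ p, p ≠ 0 → resSum a P X p N ≤ 3 * K) ∧
      skewScale a P X c N = 6 * resSum a P X 3 N ∧
      kurtScale a P X c N = 72 * resSum a P X 2 N + 24 * resSum a P X 4 N := by
  obtain ⟨K, c, hK, hc, hspec⟩ := exists_spectral_bounds ha hA
  refine ⟨K, c, hK, hc, ?_⟩
  filter_upwards [hspec] with N ⟨hh, hσ, hC, h2, h3⟩
  have hN : (0 : ℝ) < N := by exact_mod_cast hh.pos
  have h0 : ∀ p, 0 ≤ resSum a P X p N := fun p => Finset.sum_nonneg fun l _ => hh.resWeight_nonneg l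
  refine ⟨hh, hσ, fun l hl => (lt_of_lt_of_le (by positivity) (hC l hl)).ne', h0,
    fun p hp => hh.sum_resWeight_le p hp, max_eq_left ?_, max_eq_left ?_⟩
  · have : c ≤ resSum a P X 3 N := h3
    linarith
  · have : c ≤ resSum a P X 2 N := h2
    have := h0 4
    linarith

omit [IsProbabilityMeasure P] in
-- `y d - q = y (d - q) + q (y - 1)`; `q` need not converge, only stay bounded.
theorem tendstoInMeasure_mul_sub {y d : ℕ → Ω → ℝ} {q : ℕ → ℝ} {B : ℝ}
    (hy : TendstoInMeasure P y atTop fun _ => 1)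
    (hd : TendstoInMeasure P (fun n ω => d n ω - q n) atTop fun _ => 0)
    (hq : ∀ᶠ n in atTop, |q n| ≤ B) :
    TendstoInMeasure P (fun n ω => y n ω * d n ω - q n) atTop fun _ => 0 := by
  have h1 := tendstoInMeasure_comp (F := fun x => x - 1) (by fun_prop) hy
  rw [sub_self] at h1
  have h := tendstoInMeasure_add (tendstoInMeasure_mul hy hd) (tendstoInMeasure_bounded_mul hq h1)
  rw [mul_zero, add_zero] at h
  exact tendstoInMeasure_of_eventuallyEq (Eventually.of_forall fun n ω => by ring) h

omit [IsProbabilityMeasure P] in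
/-- Consistency of the estimator of the variance of `S_N`. -/
theorem tendstoInMeasure_skewVar {c K : ℝ} (hc : 0 < c) {N : ℕ → ℕ} {s : ℕ → Ω → ℝ}
    {v : ℕ → ℤ → Ω → ℂ}
    (hev : ∀ᶠ n in atTop, 0 < N n ∧ 0 < sigmaSq a P X (N n) ∧
      (∀ l ∈ band (N n), C P X l ≠ 0) ∧ (∀ p, 0 ≤ resSum a P X p (N n)) ∧
      (∀ p, p ≠ 0 → resSum a P X p (N n) ≤ 3 * K) ∧
      skewScale a P X c (N n) = 6 * resSum a P X 3 (N n))
    (hs : TendstoInMeasure P (fun n ω => s n ω / sigmaSq a P X (N n)) atTop fun _ => 1)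
    (hv : TendstoInMeasure P (fun n ω => resForm a P X 3 (N n) (fun l => v n l ω)
      - resSum a P X 3 (N n)) atTop fun _ => 0) :
    TendstoInMeasure P (fun n ω => skewVar a P X (N n) (s n ω) (fun l => v n l ω)
      / skewScale a P X c (N n)) atTop fun _ => 1 := by
  have hy := tendstoInMeasure_comp (F := fun x => x⁻¹ ^ 3)
    ((continuousAt_inv₀ one_ne_zero).pow 3) hs
  simp only [inv_one, one_pow] at hy
  have h1 := tendstoInMeasure_mul_sub hy hv (B := 3 * K) (by
    filter_upwards [hev] with n hn
    rw [abs_of_nonneg (hn.2.2.2.1 3)]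
    exact hn.2.2.2.2.1 3 (by norm_num))
  have hpos : ∀ n, 0 < skewScale a P X c (N n) := fun n => lt_max_of_lt_right hc
  have h2 := tendstoInMeasure_bounded_mul (c := fun n => 6 / skewScale a P X c (N n)) (B := 6 / c)
    (Eventually.of_forall fun n => by
      rw [abs_of_nonneg (div_nonneg (by norm_num) (hpos n).le)]
      gcongr
      exact le_max_right _ _) h1
  have h3 := tendstoInMeasure_comp (F := fun x => x + 1) (by fun_prop) h2
  rw [zero_add] at h3
  refine tendstoInMeasure_of_eventuallyEq ?_ h3
  filter_upwards [hev] with n hn ω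
  obtain ⟨hN, hσ, hC, -, -, hV⟩ := hn
  have hne := (hpos n).ne'
  rw [skewVar_eq hN.ne' hσ.ne' hC]
  change _ = 6 * (s n ω / sigmaSq a P X (N n))⁻¹ ^ 3 * resForm a P X 3 (N n) (fun l => v n l ω) / _
  generalize (s n ω / sigmaSq a P X (N n))⁻¹ = y
  field_simp
  rw [hV]
  ring

omit [IsProbabilityMeasure P] in
/-- Consistency of the estimator of the variance of `U_N`. -/
theorem tendstoInMeasure_kurtVar {c K : ℝ} (hc : 0 < c) {N : ℕ → ℕ} {s : ℕ → Ω → ℝ}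
    {v : ℕ → ℤ → Ω → ℂ}
    (hev : ∀ᶠ n in atTop, 0 < N n ∧ 0 < sigmaSq a P X (N n) ∧
      (∀ l ∈ band (N n), C P X l ≠ 0) ∧ (∀ p, 0 ≤ resSum a P X p (N n)) ∧
      (∀ p, p ≠ 0 → resSum a P X p (N n) ≤ 3 * K) ∧
      kurtScale a P X c (N n) = 72 * resSum a P X 2 (N n) + 24 * resSum a P X 4 (N n))
    (hs : TendstoInMeasure P (fun n ω => s n ω / sigmaSq a P X (N n)) atTop fun _ => 1)
    (hv2 : TendstoInMeasure P (fun n ω => resForm a P X 2 (N n) (fun l => v n l ω)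
      - resSum a P X 2 (N n)) atTop fun _ => 0)
    (hv4 : TendstoInMeasure P (fun n ω => resForm a P X 4 (N n) (fun l => v n l ω)
      - resSum a P X 4 (N n)) atTop fun _ => 0) :
    TendstoInMeasure P (fun n ω => kurtVar a P X (N n) (s n ω) (fun l => v n l ω)
      / kurtScale a P X c (N n)) atTop fun _ => 1 := by
  have hy2 := tendstoInMeasure_comp (F := fun x => x⁻¹ ^ 2)
    ((continuousAt_inv₀ one_ne_zero).pow 2) hs
  have hy4 := tendstoInMeasure_comp (F := fun x => x⁻¹ ^ 4)
    ((continuousAt_inv₀ one_ne_zero).pow 4) hs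
  simp only [inv_one, one_pow] at hy2 hy4
  have hq : ∀ p, p ≠ 0 → ∀ᶠ n in atTop, |resSum a P X p (N n)| ≤ 3 * K := fun p hp => by
    filter_upwards [hev] with n hn
    rw [abs_of_nonneg (hn.2.2.2.1 p)]
    exact hn.2.2.2.2.1 p hp
  have h2 := tendstoInMeasure_mul_sub hy2 hv2 (hq 2 (by norm_num))
  have h4 := tendstoInMeasure_mul_sub hy4 hv4 (hq 4 (by norm_num))
  have hpos : ∀ n, 0 < kurtScale a P X c (N n) := fun n => lt_max_of_lt_right hc
  have hbd : ∀ r : ℝ, 0 ≤ r → ∀ᶠ n in atTop, |r / kurtScale a P X c (N n)| ≤ r / c := fun r hr =>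
    Eventually.of_forall fun n => by
      rw [abs_of_nonneg (div_nonneg hr (hpos n).le)]
      gcongr
      exact le_max_right _ _
  have h5 := tendstoInMeasure_add
    (tendstoInMeasure_bounded_mul (hbd 72 (by norm_num)) h2)
    (tendstoInMeasure_bounded_mul (hbd 24 (by norm_num)) h4)
  have h3 := tendstoInMeasure_comp (F := fun x => x + 1) (by fun_prop) h5
  rw [zero_add, zero_add] at h3
  refine tendstoInMeasure_of_eventuallyEq ?_ h3
  filter_upwards [hev] with n hn ω
  obtain ⟨hN, hσ, hC, -, -, hV⟩ := hn
  have hne := (hpos n).ne'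
  rw [kurtVar_eq hN.ne' hσ.ne' hC]
  change _ = (72 * (s n ω / sigmaSq a P X (N n))⁻¹ ^ 2 * resForm a P X 2 (N n) (fun l => v n l ω)
    + 24 * (s n ω / sigmaSq a P X (N n))⁻¹ ^ 4 * resForm a P X 4 (N n) (fun l => v n l ω)) / _
  generalize (s n ω / sigmaSq a P X (N n))⁻¹ = y
  field_simp
  rw [hV]
  ring

omit [IsProbabilityMeasure P] in
-- The quotient does not change when `f` and `g` are divided by the same `V`, and `(x - y)/y` is
-- continuous at `(1, 1)`.
theorem tendstoInMeasure_sub_div {f g : ℕ → Ω → ℝ} {V : ℕ → ℝ} (hV : ∀ n, V n ≠ 0)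
    (hf : TendstoInMeasure P (fun n ω => f n ω / V n) atTop fun _ => 1)
    (hg : TendstoInMeasure P (fun n ω => g n ω / V n) atTop fun _ => 1) :
    TendstoInMeasure P (fun n ω => (f n ω - g n ω) / g n ω) atTop fun _ => 0 := by
  have h := tendstoInMeasure_map₂ (F := fun p : ℝ × ℝ => (p.1 - p.2) / p.2)
    ((continuousAt_fst.sub continuousAt_snd).div continuousAt_snd one_ne_zero) hf hg
  simp only [sub_self, zero_div] at h
  refine tendstoInMeasure_of_eventuallyEq (Eventually.of_forall fun n ω => ?_) h
  rw [← sub_div, div_div_div_cancel_right₀ (hV n)]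

/-! ### Measurability -/

theorem aemeasurable_betaHat (hX : IsTorusField P X) (hA : AssumptionA1 P X α)
    (hB : IsGaussianProcess X P) (ha : IsNeedletWindow a) {N k : ℕ} (hk : k ∈ Finset.Icc 1 N) :
    AEMeasurable (betaHat a P X N k) P :=
  ((hX.hasGaussianLaw_betaHat hA hB ha.even N).eval ⟨k, hk⟩).aemeasurable

theorem aemeasurable_S (hX : IsTorusField P X) (hA : AssumptionA1 P X α)
    (hB : IsGaussianProcess X P) (ha : IsNeedletWindow a) (N : ℕ) : AEMeasurable (S a P X N) P := by
  refine (Finset.aemeasurable_fun_sum (Finset.Icc 1 N) fun k hk => ?_).const_mul _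
  exact (hX.aemeasurable_betaHat hA hB ha hk).pow_const 3

theorem aemeasurable_U (hX : IsTorusField P X) (hA : AssumptionA1 P X α)
    (hB : IsGaussianProcess X P) (ha : IsNeedletWindow a) (N : ℕ) : AEMeasurable (U a P X N) P := by
  refine (Finset.aemeasurable_fun_sum (Finset.Icc 1 N) fun k hk => ?_).const_mul _
  exact ((hX.aemeasurable_betaHat hA hB ha hk).pow_const 4).sub_const 3

omit [IsProbabilityMeasure P] in
theorem measurable_normalizer (hX : IsTorusField P X) (a : ℝ → ℝ) (ν : Normalizer) (N M : ℕ) :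
    Measurable fun ω => ν.value a P X N M ω := by
  have h1 := fun l => hX.measurable_w l
  have h2 := fun l => hX.measurable_wTilde M l
  cases ν
  · exact measurable_const
  · simp only [Normalizer.value, sigmaSqHat, bandMean]
    fun_prop
  · simp only [Normalizer.value, sigmaSqTilde, bandMean]
    fun_prop

omit [IsProbabilityMeasure P] in
theorem measurable_polySum (hX : IsTorusField P X) (a : ℝ → ℝ) (p N M : ℕ) :
    Measurable fun ω => polySum a P X p N fun l => wTilde X M l ω := by
  have h2 := fun l => hX.measurable_wTilde M l
  unfold polySum
  fun_prop

omit [IsProbabilityMeasure P] in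
theorem measurable_skewVarTilde (hX : IsTorusField P X) (a : ℝ → ℝ) (ν : Normalizer) (N M : ℕ) :
    Measurable (skewVarTilde a P X ν N M) := by
  have h1 := hX.measurable_normalizer a ν N M
  have h2 := hX.measurable_polySum a 3 N M
  unfold skewVarTilde skewVar
  fun_prop

omit [IsProbabilityMeasure P] in
theorem measurable_kurtVarTilde (hX : IsTorusField P X) (a : ℝ → ℝ) (ν : Normalizer) (N M : ℕ) :
    Measurable (kurtVarTilde a P X ν N M) := by
  have h1 := hX.measurable_normalizer a ν N M
  have h2 := hX.measurable_polySum a 2 N M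
  have h4 := hX.measurable_polySum a 4 N M
  unfold kurtVarTilde kurtVar
  fun_prop

/-! ### The central limit theorem -/

theorem charFun_skew_kurt (hX : IsTorusField P X) (hA : AssumptionA1 P X α)
    (hB : IsGaussianProcess X P) (ha : IsNeedletWindow a) {N : ℕ} (hN : N ≠ 0) (r s : ℝ)
    (t : EuclideanSpace ℝ (Fin 2)) :
    charFun (P.map fun ω => (!₂[S a P X N ω / r, U a P X N ω / s] : EuclideanSpace ℝ (Fin 2))) t
      = ∫ x : Finset.Icc 1 N → ℝ, Complex.exp (Complex.I * ((√(Fintype.card (Finset.Icc 1 N)))⁻¹ *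
          ∑ k, (t 0 / r * (x k ^ 3 - 3 * x k) + t 1 / s * (x k ^ 4 - 3)) : ℝ))
          ∂(P.map fun ω (k : Finset.Icc 1 N) => betaHat a P X N k ω) := by
  have hG := (hX.hasGaussianLaw_betaHat hA hB ha.even N).aemeasurable
  have hm : AEMeasurable (fun ω => (!₂[S a P X N ω / r, U a P X N ω / s] : EuclideanSpace ℝ (Fin 2))) P := by
    have h1 := hX.aemeasurable_S hA hB ha N
    have h2 := hX.aemeasurable_U hA hB ha N
    refine (WithLp.measurable_toLp 2 (Fin 2 → ℝ)).comp_aemeasurable (aemeasurable_pi_lambda _ fun i => ?_)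
    fin_cases i
    · exact h1.div_const r
    · exact h2.div_const s
  rw [charFun_apply, integral_map hm (by fun_prop), integral_map hG (by fun_prop)]
  refine integral_congr_ae ?_
  filter_upwards [hX.sum_betaHat ha.even hN] with ω hω
  rw [mul_comm]
  congr 2
  rw [PiLp.inner_apply, Fin.sum_univ_two]
  simp only [Fintype.card_coe, Nat.card_Icc, Nat.add_sub_cancel]
  congr 1
  -- The term `-3x` may be added because the wavelet coefficients sum to zero; it turns the cube
  -- into a Hermite polynomial.
  have e1 : S a P X N ω = (√(N : ℝ))⁻¹ * ∑ k : Finset.Icc 1 N, (betaHat a P X N k ω ^ 3 - 3 * betaHat a P X N k ω) := by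
    rw [Finset.sum_sub_distrib, ← Finset.mul_sum, hω, mul_zero, sub_zero, S, one_div]
    congr 1
    exact (Finset.sum_coe_sort (Finset.Icc 1 N) fun k => betaHat a P X N k ω ^ 3).symm
  have e2 : U a P X N ω = (√(N : ℝ))⁻¹ * ∑ k : Finset.Icc 1 N, (betaHat a P X N k ω ^ 4 - 3) := by
    rw [U, one_div]
    congr 1
    exact (Finset.sum_coe_sort (Finset.Icc 1 N) fun k => betaHat a P X N k ω ^ 4 - 3).symm
  rw [Finset.sum_add_distrib, ← Finset.mul_sum, ← Finset.mul_sum]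
  simp only [RCLike.inner_apply, conj_trivial, Matrix.cons_val_zero,
    Matrix.cons_val_one]
  rw [e1, e2]
  ring

/-- The joint central limit theorem for `S_N` and `U_N`, standardised by their variances. -/
theorem tendstoInDistribution_skew_kurt (hX : IsTorusField P X) (ha : IsNeedletWindow a)
    (hA : AssumptionA1 P X α) (hB : IsGaussianProcess X P) {K c : ℝ} (hK : 0 < K) (hc : 0 < c)
    {N : ℕ → ℕ} (hN : Tendsto N atTop atTop)
    (hev : ∀ᶠ n in atTop, IsBandWeight (N n) (specWeight a P X (N n)) K ∧ 0 < sigmaSq a P X (N n) ∧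
      skewScale a P X c (N n) = 6 * resSum a P X 3 (N n) ∧
      kurtScale a P X c (N n) = 72 * resSum a P X 2 (N n) + 24 * resSum a P X 4 (N n)) :
    TendstoInDistribution (fun n ω => (!₂[S a P X (N n) ω / √(skewScale a P X c (N n)),
        U a P X (N n) ω / √(kurtScale a P X c (N n))] : EuclideanSpace ℝ (Fin 2)))
      atTop (id : EuclideanSpace ℝ (Fin 2) → EuclideanSpace ℝ (Fin 2)) (fun _ => P)
      (stdGaussian (EuclideanSpace ℝ (Fin 2))) := by
  have hm : ∀ n, AEMeasurable (fun ω => (!₂[S a P X (N n) ω / √(skewScale a P X c (N n)),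
        U a P X (N n) ω / √(kurtScale a P X c (N n))] : EuclideanSpace ℝ (Fin 2))) P := fun n => by
    have h1 := hX.aemeasurable_S hA hB ha (N n)
    have h2 := hX.aemeasurable_U hA hB ha (N n)
    refine (WithLp.measurable_toLp 2 (Fin 2 → ℝ)).comp_aemeasurable (aemeasurable_pi_lambda _ fun i => ?_)
    fin_cases i
    · exact h1.div_const _
    · exact h2.div_const _
  refine ⟨hm, aemeasurable_id, ProbabilityMeasure.tendsto_iff_tendsto_charFun.2 fun t => ?_⟩
  simp only [ProbabilityMeasure.coe_mk, Measure.map_id]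
  rw [charFun_stdGaussian]
  -- Both scales are at least `c`, so the coefficients `t 0 / √skewScale` and `t 1 / √kurtScale`
  -- stay within this bound for all `n`.
  obtain ⟨D, hDb⟩ := IsCorrelatedGaussian.exists_charFun_skew_kurt_bound
    (max (|t 0| / √c) (|t 1| / √c)) (K := 2 * K) (by positivity)
  rw [tendsto_iff_norm_sub_tendsto_zero]
  have hlim : Tendsto (fun n => D / √√(N n : ℝ)) atTop (𝓝 0) := by
    refine tendsto_const_nhds.div_atTop ?_
    exact Real.tendsto_sqrt_atTop.comp (Real.tendsto_sqrt_atTop.comp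
      (tendsto_natCast_atTop_atTop.comp hN))
  refine squeeze_zero' (Eventually.of_forall fun n => norm_nonneg _) ?_ hlim
  filter_upwards [hev] with n ⟨hh, hσ, hS, hU⟩
  have hN0 := hh.pos.ne'
  have : Nonempty (Finset.Icc 1 (N n)) := ⟨⟨1, Finset.mem_Icc.2 ⟨le_rfl, hh.pos⟩⟩⟩
  have hSp : 0 < skewScale a P X c (N n) := lt_max_of_lt_right hc
  have hUp : 0 < kurtScale a P X c (N n) := lt_max_of_lt_right hc
  have hb := hDb _ _ _ (hX.isCorrelatedGaussian_betaHat hA hB ha hh hσ)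
    (t 0 / √(skewScale a P X c (N n))) (t 1 / √(kurtScale a P X c (N n)))
    (by
      rw [abs_div, abs_of_nonneg (Real.sqrt_nonneg _)]
      refine le_trans ?_ (le_max_left _ _)
      gcongr
      exact le_max_right _ _)
    (by
      rw [abs_div, abs_of_nonneg (Real.sqrt_nonneg _)]
      refine le_trans ?_ (le_max_right _ _)
      gcongr
      exact le_max_right _ _)
  rw [← hX.charFun_skew_kurt hA hB ha hN0] at hb
  -- The scales are the exact variances, so the linear combination has variance `‖t‖²`, matching the
  -- standard Gaussian exponent.
  have hV : (t 0 / √(skewScale a P X c (N n))) ^ 2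
        * IsCorrelatedGaussian.skewVariance (gridCorr (N n) (specWeight a P X (N n)))
      + (t 1 / √(kurtScale a P X c (N n))) ^ 2
        * IsCorrelatedGaussian.kurtVariance (gridCorr (N n) (specWeight a P X (N n))) = ‖t‖ ^ 2 := by
    have e1 : IsCorrelatedGaussian.skewVariance (gridCorr (N n) (specWeight a P X (N n)))
        = skewScale a P X c (N n) := by
      rw [skewVariance_gridCorr hN0 (specWeight_neg ha P X _), hS]; rfl
    have e2 : IsCorrelatedGaussian.kurtVariance (gridCorr (N n) (specWeight a P X (N n)))
        = kurtScale a P X c (N n) := by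
      rw [kurtVariance_gridCorr hN0 (specWeight_neg ha P X _), hU]; rfl
    rw [e1, e2, div_pow, div_pow, Real.sq_sqrt hSp.le, Real.sq_sqrt hUp.le,
      div_mul_cancel₀ _ hSp.ne', div_mul_cancel₀ _ hUp.ne', EuclideanSpace.norm_sq_eq,
      Fin.sum_univ_two]
    simp
  rw [hV] at hb
  simp only [Fintype.card_coe, Nat.card_Icc, Nat.add_sub_cancel] at hb
  refine le_trans (le_of_eq ?_) hb
  congr 3
  push_cast
  ring

end IsTorusField

end TorusNeedlet

/-! ### The studentized central limit theorem -/

namespace TorusNeedlet.IsTorusField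

variable {Ω : Type*} [MeasurableSpace Ω] {P : Measure Ω} {X : Torus → Ω → ℝ}
  [IsProbabilityMeasure P] {a : ℝ → ℝ} {α : ℝ} {j M : ℕ → ℕ}

/-- Consistency of the variance estimators from the sampled coefficients, and the studentized
central limit theorem for `S_N` and `U_N`. -/
theorem tendsto_studentized (hX : IsTorusField P X) (ha : IsNeedletWindow a)
    (hA1 : AssumptionA1 P X α) (hB : IsGaussianProcess X P) (hD : AssumptionD α j M)
    (ν ν' : Normalizer) :
    TendstoInMeasure P
      (fun n ω =>
        (skewVarTilde a P X ν (res (j n)) (M n) ω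
            - skewVarHat a P X (res (j n)) ω)
          / skewVarHat a P X (res (j n)) ω)
      atTop (fun _ => (0 : ℝ)) ∧
    TendstoInMeasure P
      (fun n ω =>
        (kurtVarTilde a P X ν' (res (j n)) (M n) ω
            - kurtVarHat a P X (res (j n)) ω)
          / kurtVarHat a P X (res (j n)) ω)
      atTop (fun _ => (0 : ℝ)) ∧
    TendstoInDistribution
      (fun n ω =>
        (!₂[S a P X (res (j n)) ω
              / √(skewVarTilde a P X ν (res (j n)) (M n) ω),
            U a P X (res (j n)) ω
              / √(kurtVarTilde a P X ν' (res (j n)) (M n) ω)] :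
          EuclideanSpace ℝ (Fin 2)))
      atTop (id : EuclideanSpace ℝ (Fin 2) → EuclideanSpace ℝ (Fin 2)) (fun _ => P)
      (stdGaussian (EuclideanSpace ℝ (Fin 2))) := by
  obtain ⟨K, c, hK, hc, hspec⟩ := exists_scale ha hA1
  have hev := hD.tendsto_res.eventually hspec
  have hskew := hev.mono fun n h =>
    And.intro h.1.pos <| And.intro h.2.1 <| And.intro h.2.2.1 <| And.intro h.2.2.2.1 <|
      And.intro h.2.2.2.2.1 h.2.2.2.2.2.1
  have hkurt := hev.mono fun n h =>
    And.intro h.1.pos <| And.intro h.2.1 <| And.intro h.2.2.1 <| And.intro h.2.2.2.1 <|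
      And.intro h.2.2.2.2.1 h.2.2.2.2.2.2
  have hσ := hX.tendstoInMeasure_normalizer ha hA1 hB hD
  -- `hform p` concerns tuples of length `p + 2`.
  have hform := hX.tendstoInMeasure_resForm ha hA1 hB hD
  have hSh : TendstoInMeasure P (fun n ω => skewVarHat a P X (res (j n)) ω
      / skewScale a P X c (res (j n))) atTop fun _ => 1 :=
    tendstoInMeasure_skewVar hc hskew (hσ .fourierBased) (hform 1).1
  have hSt : TendstoInMeasure P (fun n ω => skewVarTilde a P X ν (res (j n)) (M n) ω
      / skewScale a P X c (res (j n))) atTop fun _ => 1 :=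
    tendstoInMeasure_skewVar hc hskew (hσ ν) (hform 1).2
  have hUh : TendstoInMeasure P (fun n ω => kurtVarHat a P X (res (j n)) ω
      / kurtScale a P X c (res (j n))) atTop fun _ => 1 :=
    tendstoInMeasure_kurtVar hc hkurt (hσ .fourierBased) (hform 0).1 (hform 2).1
  have hUt : TendstoInMeasure P (fun n ω => kurtVarTilde a P X ν' (res (j n)) (M n) ω
      / kurtScale a P X c (res (j n))) atTop fun _ => 1 :=
    tendstoInMeasure_kurtVar hc hkurt (hσ ν') (hform 0).2 (hform 2).2
  have hSpos : ∀ N, 0 < skewScale a P X c N := fun N => lt_max_of_lt_right hc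
  have hUpos : ∀ N, 0 < kurtScale a P X c N := fun N => lt_max_of_lt_right hc
  refine ⟨tendstoInMeasure_sub_div (fun n => (hSpos (res (j n))).ne') hSt hSh,
    tendstoInMeasure_sub_div (fun n => (hUpos (res (j n))).ne') hUt hUh, ?_⟩
  have hclt := hX.tendstoInDistribution_skew_kurt ha hA1 hB hK hc hD.tendsto_res
    (hev.mono fun n h => ⟨h.1, h.2.1, h.2.2.2.2.2⟩)
  -- Slutsky: replacing the true scales by their estimators multiplies the components by factors
  -- tending to `1` in probability.
  have hR := tendstoInMeasure_map₂ (F := fun p : ℝ × ℝ => ((√p.1)⁻¹, (√p.2)⁻¹))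
    (((Real.continuous_sqrt.continuousAt.comp continuousAt_fst).inv₀ (by simp)).prodMk
      ((Real.continuous_sqrt.continuousAt.comp continuousAt_snd).inv₀ (by simp))) hSt hUt
  have hcont : Continuous fun q : EuclideanSpace ℝ (Fin 2) × ℝ × ℝ =>
      (!₂[q.1 0 * q.2.1, q.1 1 * q.2.2] : EuclideanSpace ℝ (Fin 2)) := by
    refine (PiLp.continuous_toLp 2 _).comp (continuous_pi fun i => ?_)
    fin_cases i
    · change Continuous fun q : EuclideanSpace ℝ (Fin 2) × ℝ × ℝ => q.1 0 * q.2.1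
      fun_prop
    · change Continuous fun q : EuclideanSpace ℝ (Fin 2) × ℝ × ℝ => q.1 1 * q.2.2
      fun_prop
  refine (hclt.continuous_comp_prodMk_of_tendstoInMeasure_const hcont hR fun n => ?_).congr
    (fun n => ae_of_all _ fun ω => ?_) (ae_of_all _ fun z => ?_)
  · have h1 := hX.measurable_skewVarTilde a ν (res (j n)) (M n)
    have h2 := hX.measurable_kurtVarTilde a ν' (res (j n)) (M n)
    fun_prop
  -- Valid for every real `v`: if `v ≤ 0`, then `√v = 0` and both sides are `0` by the convention
  -- for division by zero. So no positivity of the estimator is needed.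
  · have e : ∀ x v V : ℝ, 0 < V → x / √V * (√(v / V))⁻¹ = x / √v := fun x v V hV => by
      rw [Real.sqrt_div' _ hV.le, inv_div, div_mul_div_cancel₀ (Real.sqrt_pos.2 hV).ne']
    ext i
    fin_cases i
    · exact e _ _ _ (hSpos _)
    · exact e _ _ _ (hUpos _)
  · ext i
    fin_cases i <;> simp

end TorusNeedlet.IsTorusField

end

theorem mainTheorem6 {Ω : Type*} [MeasurableSpace Ω] (P : Measure Ω) [IsProbabilityMeasure P]
    (X : TorusNeedlet.Torus → Ω → ℝ) (a : ℝ → ℝ) (α : ℝ) (j M : ℕ → ℕ)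
    (ha : TorusNeedlet.IsNeedletWindow a)
    (hX : TorusNeedlet.IsTorusField P X)
    (hA1 : TorusNeedlet.AssumptionA1 P X α)
    (hB : IsGaussianProcess X P)
    (hC : TorusNeedlet.AssumptionC P X α)
    (hD : TorusNeedlet.AssumptionD α j M)
    (ν ν' : TorusNeedlet.Normalizer) :
    TendstoInMeasure P
      (fun n ω =>
        (TorusNeedlet.skewVarTilde a P X ν (TorusNeedlet.res (j n)) (M n) ω
            - TorusNeedlet.skewVarHat a P X (TorusNeedlet.res (j n)) ω)
          / TorusNeedlet.skewVarHat a P X (TorusNeedlet.res (j n)) ω)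
      atTop (fun _ => (0 : ℝ)) ∧
    TendstoInMeasure P
      (fun n ω =>
        (TorusNeedlet.kurtVarTilde a P X ν' (TorusNeedlet.res (j n)) (M n) ω
            - TorusNeedlet.kurtVarHat a P X (TorusNeedlet.res (j n)) ω)
          / TorusNeedlet.kurtVarHat a P X (TorusNeedlet.res (j n)) ω)
      atTop (fun _ => (0 : ℝ)) ∧
    TendstoInDistribution
      (fun n ω =>
        (!₂[TorusNeedlet.S a P X (TorusNeedlet.res (j n)) ω
              / √(TorusNeedlet.skewVarTilde a P X ν (TorusNeedlet.res (j n)) (M n) ω),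
            TorusNeedlet.U a P X (TorusNeedlet.res (j n)) ω
              / √(TorusNeedlet.kurtVarTilde a P X ν' (TorusNeedlet.res (j n)) (M n) ω)] :
          EuclideanSpace ℝ (Fin 2)))
      atTop (id : EuclideanSpace ℝ (Fin 2) → EuclideanSpace ℝ (Fin 2)) (fun _ => P)
      (stdGaussian (EuclideanSpace ℝ (Fin 2))) :=
  hX.tendsto_studentized ha hA1 hB hD ν ν'
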